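/- Let $n\in\mathbb N$, $T>0$, and let $H_1,H_2:\mathbb{R}^n\times\mathbb{R}^n\to\mathbb{R}$ be continuous, uniformly coercive, i.e. $\lim_{r\to\infty}\inf\{H_i(\xi,p)\mid \xi\in\mathbb{R}^n,\ |p|\ge r\}=\infty$, and $\mathbb{Z}^n$-periodic in $\xi$, i.e. $H_i(\xi+z,p)=H_i(\xi,p)$ for all $\xi,p\in\mathbb{R}^n$, $z\in\mathbb{Z}^n$ and $i=1,2$. Let $f_1,f_2\in C^1(\mathbb{R}^n)$ have bounded gradients. For each $\varepsilon>0$ let $(u_1^\varepsilon,u_2^\varepsilon)$ be a continuous viscosity solution on $\mathbb{R}^n\times[0,T]$, of at most linear growth in $x$ uniformly in $t\in[0,T]$ (with constants that may depend on $\varepsilon$), of $$(u_i^\varepsilon)_t+H_i\Big(\frac{x}{\varepsilon},Du_i^\varepsilon\Big)+\frac1\varepsilon\,(u_i^\varepsilon-u_j^\varepsilon)=0\ \text{ in }\mathbb{R}^n\times(0,T),\qquad u_i^\varepsilon(\cdot,0)=f_i\ \text{ on }\mathbb{R}^n,\qquad \{i,j\}=\{1,2\}.$$ Then for every $P\in\mathbb{R}^n$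 there is exactly one constant $\overline H(P)\in\mathbb R$ such that the cell problem $$H_i(\xi,P+Dv_i)+v_i-v_j=\overline H(P)\ \text{ in }\mathbb{R}^n,\qquad \{i,j\}=\{1,2\},$$ has a continuous $\mathbb{Z}^n$-periodic viscosity solution $(v_1,v_2)$; and there is a Lipschitz continuous function $u$ on $\mathbb{R}^n\times[0,T]$ such that, as $\varepsilon\to0^+$, both $u_1^\varepsilon$ and $u_2^\varepsilon$ converge to $u$ locally uniformly in $\mathbb{R}^n\times(0,T)$, and $u$ is a viscosity solution of $$u_t+\overline H(Du)=0\ \text{ in }\mathbb{R}^n\times(0,T),\qquad u(\cdot,0)=\overline f:=\frac{f_1+f_2}{2}\ \text{ on }\mathbb{R}^n.$$ -/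

import Mathlib

open Set Filter Topology

noncomputable section

namespace WeaklyCoupledHJ

/-- Euclidean space `ℝⁿ`. -/
abbrev E (n : ℕ) : Type := EuclideanSpace ℝ (Fin n)

/-- The integer vector `z ∈ ℤⁿ` seen as a point of `ℝⁿ`. -/
def latticePoint {n : ℕ} (z : Fin n → ℤ) : E n := WithLp.toLp 2 (fun k => (z k : ℝ))

/-- `ℤⁿ`-periodicity of a function on `ℝⁿ`. -/
def IsPeriodic {n : ℕ} (v : E n → ℝ) : Prop :=
  ∀ (ξ : E n) (z : Fin n → ℤ), v (ξ + latticePoint z) = v ξ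

/-- Uniform coercivity: `inf {K ξ p | ξ ∈ ℝⁿ, |p| ≥ r} → ∞` as `r → ∞`. -/
def IsUniformlyCoercive {n : ℕ} (K : E n → E n → ℝ) : Prop :=
  ∀ M : ℝ, ∃ r : ℝ, ∀ ξ p : E n, r ≤ ‖p‖ → M ≤ K ξ p

/-- The open space-time domain `ℝⁿ × (0, T)`. -/
def openCyl (n : ℕ) (T : ℝ) : Set (E n × ℝ) := univ ×ˢ Ioo 0 T

/-- The closed space-time domain `ℝⁿ × [0, T]`. -/
def closedCyl (n : ℕ) (T : ℝ) : Set (E n × ℝ) := univ ×ˢ Icc 0 T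

/-- The spatial gradient `Dφ(x, t)` at `z = (x, t)`. -/
def spaceGrad {n : ℕ} (φ : E n × ℝ → ℝ) (z : E n × ℝ) : E n :=
  gradient (fun x => φ (x, z.2)) z.1

/-- The time derivative `φ_t(x, t)` at `z = (x, t)`. -/
def timeDeriv {n : ℕ} (φ : E n × ℝ → ℝ) (z : E n × ℝ) : ℝ :=
  deriv (fun t => φ (z.1, t)) z.2

/-! The two components are indexed by `Fin 2`; `i.rev` is the index different from `i`. -/

/-- Viscosity subsolution in `ℝⁿ × (0, T)` of
`(u_i)_t + H_i(x/ε, Du_i) + (u_i - u_j)/ε = 0`, `{i, j} = {1, 2}`. -/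
def IsSystemSubsolution {n : ℕ} (H : Fin 2 → E n → E n → ℝ) (T ε : ℝ)
    (u : Fin 2 → E n × ℝ → ℝ) : Prop :=
  ∀ (i : Fin 2) (φ : E n × ℝ → ℝ), ContDiffOn ℝ 1 φ (openCyl n T) →
    ∀ z ∈ openCyl n T, IsLocalMax (fun w => u i w - φ w) z →
      timeDeriv φ z + H i (ε⁻¹ • z.1) (spaceGrad φ z) + (u i z - u i.rev z) / ε ≤ 0

/-- Viscosity supersolution of the same system. -/
def IsSystemSupersolution {n : ℕ} (H : Fin 2 → E n → E n → ℝ) (T ε : ℝ)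
    (u : Fin 2 → E n × ℝ → ℝ) : Prop :=
  ∀ (i : Fin 2) (φ : E n × ℝ → ℝ), ContDiffOn ℝ 1 φ (openCyl n T) →
    ∀ z ∈ openCyl n T, IsLocalMin (fun w => u i w - φ w) z →
      0 ≤ timeDeriv φ z + H i (ε⁻¹ • z.1) (spaceGrad φ z) + (u i z - u i.rev z) / ε

/-- Continuous viscosity solution on `ℝⁿ × [0, T]` of the weakly coupled Cauchy problem with
switching rate `1/ε` and initial data `f`. -/
structure IsSystemSolution {n : ℕ} (H : Fin 2 → E n → E n → ℝ) (f : Fin 2 → E n → ℝ)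
    (T ε : ℝ) (u : Fin 2 → E n × ℝ → ℝ) : Prop where
  continuousOn : ∀ i, ContinuousOn (u i) (closedCyl n T)
  subsolution : IsSystemSubsolution H T ε u
  supersolution : IsSystemSupersolution H T ε u
  initial : ∀ i x, u i (x, 0) = f i x

/-- At most linear growth in `x`, uniformly in `t ∈ [0, T]`. -/
def HasLinearGrowth {n : ℕ} (T : ℝ) (w : E n × ℝ → ℝ) : Prop :=
  ∃ C : ℝ, ∀ z ∈ closedCyl n T, |w z| ≤ C * (1 + ‖z.1‖)

/-- `(v_1, v_2)` is a continuous `ℤⁿ`-periodic viscosity solution in `ℝⁿ` of the cell problem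
`H_i(ξ, P + Dv_i) + v_i - v_j = c`, `{i, j} = {1, 2}`. -/
structure IsCellSolution {n : ℕ} (H : Fin 2 → E n → E n → ℝ) (P : E n) (c : ℝ)
    (v : Fin 2 → E n → ℝ) : Prop where
  continuous : ∀ i, Continuous (v i)
  periodic : ∀ i, IsPeriodic (v i)
  subsolution : ∀ (i : Fin 2) (φ : E n → ℝ), ContDiff ℝ 1 φ →
    ∀ ξ, IsLocalMax (fun y => v i y - φ y) ξ →
      H i ξ (P + gradient φ ξ) + v i ξ - v i.rev ξ ≤ c
  supersolution : ∀ (i : Fin 2) (φ : E n → ℝ), ContDiff ℝ 1 φ →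
    ∀ ξ, IsLocalMin (fun y => v i y - φ y) ξ →
      c ≤ H i ξ (P + gradient φ ξ) + v i ξ - v i.rev ξ

/-- `c` is a constant for which the cell problem at `P` is solvable. -/
def IsCellConstant {n : ℕ} (H : Fin 2 → E n → E n → ℝ) (P : E n) (c : ℝ) : Prop :=
  ∃ v : Fin 2 → E n → ℝ, IsCellSolution H P c v

/-- The effective Hamiltonian: the constant for which the cell problem at `P` is solvable. -/
def effectiveHamiltonian {n : ℕ} (H : Fin 2 → E n → E n → ℝ) (P : E n) : ℝ :=
  Classical.epsilon (IsCellConstant H P)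

/-- `u` is a continuous viscosity solution of `u_t + K(Du) = 0` in `ℝⁿ × (0, T)` with
`u(·, 0) = g`. -/
structure IsHJSolution {n : ℕ} (K : E n → ℝ) (g : E n → ℝ) (T : ℝ)
    (u : E n × ℝ → ℝ) : Prop where
  continuousOn : ContinuousOn u (closedCyl n T)
  subsolution : ∀ φ : E n × ℝ → ℝ, ContDiffOn ℝ 1 φ (openCyl n T) →
    ∀ z ∈ openCyl n T, IsLocalMax (fun w => u w - φ w) z →
      timeDeriv φ z + K (spaceGrad φ z) ≤ 0
  supersolution : ∀ φ : E n × ℝ → ℝ, ContDiffOn ℝ 1 φ (openCyl n T) →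
    ∀ z ∈ openCyl n T, IsLocalMin (fun w => u w - φ w) z →
      0 ≤ timeDeriv φ z + K (spaceGrad φ z)
  initial : ∀ x, u (x, 0) = g x

end WeaklyCoupledHJ

end

noncomputable section

namespace WeaklyCoupledHJ

/-! ### Gradient calculus -/

section Gradient

variable {F : Type*} [NormedAddCommGroup F] [InnerProductSpace ℝ F] [CompleteSpace F]

/-! The coupling `(u_i - u_j)/ε` pulls the two components together on a time scale of order `ε`.
Near `t = 0` they follow the linear relaxation `initialLayer`, which tends to the mean of the data
for every `t > 0`. Its spatial gradients are bounded uniformly in `ε`, so the layer plus or minus `B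
t`, with `B` independent of `ε`, is a pair of barriers (`exists_barriers`). Hence the half-relaxed
limits are finite and lie within `B t` of the mean of the data.

The formal expansion `u_i ≈ u(x, t) + ε v_i(x/ε)` leads to the cell problem at `P = Du`. It is
solved by vanishing discount: Perron's method gives discounted solutions
(`exists_discounted_solution`), coercivity bounds their slopes and the difference of the components
independently of the discount, and a limit exists after subtracting a constant
(`exists_ergodic_solution`). Doubling of variables (`cell_comparison`) shows that the constant is
unique and depends continuously on `P`.

Evans' perturbed test function (`exists_perturbed_touching`, `upperLim_subsolution`) makes the upper
half-relaxed limit a subsolution of the effective equation. The lower one is a supersolution by the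
same argument applied to `-u` and `-H_i(ξ, -p)`. Finally `effective_comparison` bounds upper limit
at `z` minus lower limit at `w` by `L |x - y| + B |t - s|`. On the diagonal this forces the two
limits to agree, which is local uniform convergence; off the diagonal it is the Lipschitz bound.

Systems are handled throughout by one device: maximise over the component index as well as over the
point. At the maximising index the coupling terms then have a favourable sign and drop out. -/

theorem hasGradientAt_add {f g : F → ℝ} {p q x : F} (hf : HasGradientAt f p x)
    (hg : HasGradientAt g q x) : HasGradientAt (fun y => f y + g y) (p + q) x := by
  rw [hasGradientAt_iff_hasFDerivAt] at *
  rw [map_add]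
  exact hf.add hg

theorem hasGradientAt_neg {f : F → ℝ} {p x : F} (hf : HasGradientAt f p x) :
    HasGradientAt (fun y => -f y) (-p) x := by
  rw [hasGradientAt_iff_hasFDerivAt] at *
  rw [map_neg]
  exact hf.neg

theorem hasGradientAt_const_mul {f : F → ℝ} {p x : F} (c : ℝ) (hf : HasGradientAt f p x) :
    HasGradientAt (fun y => c * f y) (c • p) x := by
  rw [hasGradientAt_iff_hasFDerivAt] at *
  rw [map_smulₛₗ]
  exact hf.const_mul c

theorem hasGradientAt_add_const {f : F → ℝ} {p x : F} (hf : HasGradientAt f p x) (c : ℝ) :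
    HasGradientAt (fun y => f y + c) p x := by
  simpa using hasGradientAt_add hf (hasGradientAt_const x c)

theorem hasGradientAt_normSq_sub (a x : F) :
    HasGradientAt (fun y => ‖y - a‖ ^ 2) ((2 : ℝ) • (x - a)) x := by
  rw [hasGradientAt_iff_hasFDerivAt]
  have h := ((hasFDerivAt_id x).sub_const a).norm_sq
  refine h.congr_fderiv ?_
  ext y
  simp

theorem hasGradientAt_sqrt_add_normSq_sub (r : ℝ) (a x : F) (h : 0 < r + ‖x - a‖ ^ 2) :
    HasGradientAt (fun y => √(r + ‖y - a‖ ^ 2)) ((√(r + ‖x - a‖ ^ 2))⁻¹ • (x - a)) x := by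
  have h1 := hasGradientAt_add_const (hasGradientAt_normSq_sub a x) r
  rw [hasGradientAt_iff_hasFDerivAt] at *
  have h2 : HasFDerivAt (fun y => r + ‖y - a‖ ^ 2)
      (InnerProductSpace.toDual ℝ F ((2 : ℝ) • (x - a))) x := by
    simpa only [add_comm] using h1
  refine (h2.sqrt h.ne').congr_fderiv ?_
  rw [map_smulₛₗ, map_smulₛₗ, smul_smul]
  congr 1
  simp

theorem gradient_eq_toDual_symm (f : F → ℝ) (x : F) :
    gradient f x = (InnerProductSpace.toDual ℝ F).symm (fderiv ℝ f x) := rfl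

theorem continuous_gradient {f : F → ℝ} (hf : ContDiff ℝ 1 f) : Continuous (gradient f) :=
  (InnerProductSpace.toDual ℝ F).symm.continuous.comp (hf.continuous_fderiv one_ne_zero)

theorem hasGradientAt_of_contDiff {f : F → ℝ} (hf : ContDiff ℝ 1 f) (x : F) :
    HasGradientAt f (gradient f x) x :=
  (hf.differentiable one_ne_zero x).hasGradientAt

theorem gradient_eq_of_isLocalMax_sub {f g : F → ℝ} {x : F} (h : IsLocalMax (fun y => f y - g y) x)
    (hf : DifferentiableAt ℝ f x) (hg : DifferentiableAt ℝ g x) : gradient f x = gradient g x := by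
  have h0 := h.fderiv_eq_zero
  rw [show (fun y => f y - g y) = f - g from rfl, fderiv_sub hf hg, sub_eq_zero] at h0
  rw [gradient_eq_toDual_symm, h0, gradient_eq_toDual_symm]

end Gradient

theorem contDiff_normSq_sub {n : ℕ} (a : E n) : ContDiff ℝ 1 (fun y : E n => ‖y - a‖ ^ 2) :=
  (contDiff_id.sub contDiff_const).norm_sq ℝ

theorem contDiffAt_sqrt_add_normSq_sub {n : ℕ} (r : ℝ) (a x : E n) (h : 0 < r + ‖x - a‖ ^ 2) :
    ContDiffAt ℝ 1 (fun y : E n => √(r + ‖y - a‖ ^ 2)) x :=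
  (contDiffAt_const.add (contDiff_normSq_sub a).contDiffAt).sqrt (ne_of_gt h)

/-- A function that is `C¹` near a point agrees near that point with a global `C¹` function. -/
theorem exists_contDiff_eventuallyEq {n : ℕ} {φ : E n → ℝ} {x : E n}
    (h : ContDiffAt ℝ 1 φ x) : ∃ ψ : E n → ℝ, ContDiff ℝ 1 ψ ∧ ψ =ᶠ[𝓝 x] φ := by
  obtain ⟨r, hr, hball⟩ := Metric.eventually_nhds_iff_ball.1 (h.eventually (by simp))
  -- The support is the closed ball of radius `r / 2`, inside the ball where `φ` is `C¹`, so the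
  -- product is `C¹` everywhere.
  let b : ContDiffBump x := ⟨r / 4, r / 2, by linarith, by linarith⟩
  refine ⟨fun y => b y * φ y, ?_, ?_⟩
  · refine contDiff_iff_contDiffAt.2 fun y => ?_
    by_cases hy : y ∈ Metric.ball x r
    · exact b.contDiff.contDiffAt.mul (hball y hy)
    · have : (fun y => b y * φ y) =ᶠ[𝓝 y] fun _ => 0 := by
        have h1 : (tsupport b)ᶜ ∈ 𝓝 y := by
          refine (isClosed_tsupport _).isOpen_compl.mem_nhds ?_
          rw [mem_compl_iff, b.tsupport_eq]
          intro h2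
          apply hy
          have : dist y x ≤ r / 2 := h2
          exact Metric.mem_ball.2 (by linarith)
        filter_upwards [h1] with z hz
        rw [image_eq_zero_of_notMem_tsupport hz, zero_mul]
      exact contDiffAt_const.congr_of_eventuallyEq this
  · filter_upwards [b.eventuallyEq_one] with y hy
    rw [hy]; simp

/-! ### Existence of maxima -/

/-- The maximum is joint in the index and the point: at the winning index, the other component's
difference at the same point is no larger, and this is what controls the coupling. -/
theorem exists_max_fin_two {X : Type*} [TopologicalSpace X] {S : Set X} (hS : IsCompact S)
    (hne : S.Nonempty) {F : Fin 2 → X → ℝ} (hF : ∀ i, UpperSemicontinuousOn (F i) S) :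
    ∃ i, ∃ z ∈ S, ∀ j, ∀ w ∈ S, F j w ≤ F i z := by
  choose z hz hmax using fun i => (hF i).exists_isMaxOn hne hS
  rcases le_total (F 0 (z 0)) (F 1 (z 1)) with h | h
  · refine ⟨1, z 1, hz 1, fun j w hw => ?_⟩
    fin_cases j
    · exact (hmax 0 hw).trans h
    · exact hmax 1 hw
  · refine ⟨0, z 0, hz 0, fun j w hw => ?_⟩
    fin_cases j
    · exact hmax 0 hw
    · exact (hmax 1 hw).trans h

/-- Test functions touch a continuous function from above on a dense set. -/
theorem exists_touching_near {n : ℕ} {v : E n → ℝ} (hv : Continuous v) (x : E n) {r : ℝ}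
    (hr : 0 < r) : ∃ y ∈ Metric.ball x r, ∃ φ : E n → ℝ, ContDiff ℝ 1 φ ∧
      IsLocalMax (fun z => v z - φ z) y := by
  obtain ⟨C, hC⟩ := (isCompact_closedBall x (r / 2)).exists_bound_of_continuousOn hv.continuousOn
  have hx : x ∈ Metric.closedBall x (r / 2) := Metric.mem_closedBall_self (by linarith)
  have hC0 : 0 ≤ C := (norm_nonneg _).trans (hC x hx)
  -- On the sphere of radius `r / 2` the penalty equals `2 C + 1`, more than `v` can oscillate, so
  -- the maximum is interior.
  set k : ℝ := (2 * C + 1) / (r / 2) ^ 2 with hk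
  let φ : E n → ℝ := fun z => k * ‖z - x‖ ^ 2
  have hφ : ContDiff ℝ 1 φ := contDiff_const.mul (contDiff_normSq_sub x)
  obtain ⟨y, hy, hmax⟩ := (isCompact_closedBall x (r / 2)).exists_isMaxOn ⟨x, hx⟩
    (hv.sub hφ.continuous).continuousOn
  have hlt : y ∈ Metric.ball x (r / 2) := by
    by_contra hcon
    have hd : ‖y - x‖ = r / 2 := by
      rw [← dist_eq_norm]
      exact le_antisymm hy (not_lt.1 hcon)
    have h1 : v x - φ x ≤ v y - φ y := hmax hx
    have h2 : φ x = 0 := by simp [φ]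
    have h3 : φ y = 2 * C + 1 := by
      simp only [φ, hd, hk]
      field_simp
    have h4 := abs_le.1 (hC x hx)
    have h5 := abs_le.1 (hC y hy)
    linarith [h4.1, h5.2]
  refine ⟨y, Metric.ball_subset_ball (by linarith) hlt, φ, hφ, ?_⟩
  exact hmax.isLocalMax (mem_of_superset (Metric.isOpen_ball.mem_nhds hlt)
    Metric.ball_subset_closedBall)

/-- A bounded continuous function whose superdifferentials are bounded by `R` is
`R`-Lipschitz. -/
theorem lipschitz_of_superdifferential_le {n : ℕ} {v : E n → ℝ} (hv : Continuous v) {C R : ℝ}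
    (hC : ∀ x, |v x| ≤ C) (hR : 0 ≤ R)
    (h : ∀ φ : E n → ℝ, ContDiff ℝ 1 φ → ∀ x, IsLocalMax (fun y => v y - φ y) x →
      ‖gradient φ x‖ ≤ R) (x y : E n) : v y - v x ≤ R * ‖y - x‖ := by
  refine le_of_forall_pos_le_add fun η hη => ?_
  rcases eq_or_ne y x with rfl | hxy
  · simpa using hη.le
  have hpos : 0 < ‖y - x‖ := norm_pos_iff.2 (sub_ne_zero.2 hxy)
  -- A slope strictly above `R` rules out touching away from the vertex; the excess costs exactly
  -- `η` at `y`.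
  set R' := R + η / ‖y - x‖ with hR'
  have hRR' : R < R' := by rw [hR']; linarith [div_pos hη hpos]
  have hR'0 : 0 < R' := hR.trans_lt hRR'
  -- Beyond this radius the cone exceeds `2 C`, so the maximum over the ball is global.
  set ρ := max (‖y - x‖) (2 * C / R' + 1)
  have hxm : x ∈ Metric.closedBall x ρ :=
    Metric.mem_closedBall_self (hpos.le.trans (le_max_left _ _))
  have hym : y ∈ Metric.closedBall x ρ := by
    rw [Metric.mem_closedBall, dist_eq_norm]; exact le_max_left _ _
  have hcont : Continuous fun z => v z - R' * ‖z - x‖ := by fun_prop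
  obtain ⟨z, hz, hmax⟩ := (isCompact_closedBall x ρ).exists_isMaxOn ⟨x, hxm⟩ hcont.continuousOn
  have hglob : ∀ w, v w - R' * ‖w - x‖ ≤ v z - R' * ‖z - x‖ := by
    intro w
    by_cases hw : w ∈ Metric.closedBall x ρ
    · exact hmax hw
    · have h1 : v x - R' * ‖x - x‖ ≤ v z - R' * ‖z - x‖ := hmax hxm
      have h2 : ρ < ‖w - x‖ := by
        rw [← dist_eq_norm]; exact not_le.1 hw
      have h3 : 2 * C / R' + 1 < ‖w - x‖ := (le_max_right _ _).trans_lt h2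
      have h4 : 2 * C < R' * ‖w - x‖ := by
        have : 2 * C / R' < ‖w - x‖ := by linarith
        rwa [div_lt_iff₀' hR'0] at this
      have h5 := abs_le.1 (hC x)
      have h6 := abs_le.1 (hC w)
      simp only [sub_self, norm_zero, mul_zero, sub_zero] at h1
      linarith [h5.1, h6.2]
  -- Away from its vertex the cone is smooth with gradient of norm `R' > R`, against the bound on
  -- superdifferentials. Hence the maximum sits at the vertex.
  have hzx : z = x := by
    by_contra hne
    have hp : 0 < 0 + ‖z - x‖ ^ 2 := by
      have := norm_pos_iff.2 (sub_ne_zero.2 hne)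
      positivity
    have hgr := hasGradientAt_const_mul R' (hasGradientAt_sqrt_add_normSq_sub 0 x z hp)
    obtain ⟨ψ, hψ, heq⟩ := exists_contDiff_eventuallyEq
      (contDiffAt_const (c := R').mul (contDiffAt_sqrt_add_normSq_sub 0 x z hp))
    have hloc : IsLocalMax (fun w => v w - ψ w) z := by
      have hz0 := heq.self_of_nhds
      filter_upwards [heq] with w hw
      have := hglob w
      rw [hw, hz0]
      simpa using this
    have h1 := h ψ hψ z hloc
    rw [heq.gradient_eq, hgr.gradient, norm_smul, norm_smul] at h1
    have h2 : 0 < ‖z - x‖ := norm_pos_iff.2 (sub_ne_zero.2 hne)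
    simp only [zero_add, Real.sqrt_sq h2.le, norm_inv, Real.norm_eq_abs, abs_of_pos h2,
      inv_mul_cancel₀ h2.ne', abs_of_pos hR'0, mul_one] at h1
    linarith
  have h1 := hglob y
  rw [hzx] at h1
  simp only [sub_self, norm_zero, mul_zero, sub_zero] at h1
  have h2 : R' * ‖y - x‖ = R * ‖y - x‖ + η := by rw [hR']; field_simp
  linarith

/-! ### Periodic Hamiltonians -/

theorem exists_lattice_translate_norm_le {n : ℕ} (ξ : E n) :
    ∃ z : Fin n → ℤ, ‖ξ + latticePoint z‖ ≤ √n := by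
  refine ⟨fun k => -⌊ξ k⌋, ?_⟩
  rw [EuclideanSpace.norm_eq]
  refine Real.sqrt_le_sqrt ?_
  calc ∑ k, ‖(ξ + latticePoint fun k => -⌊ξ k⌋) k‖ ^ 2 ≤ ∑ _k : Fin n, (1 : ℝ) := by
        refine Finset.sum_le_sum fun k _ => ?_
        have h : (ξ + latticePoint fun k => -⌊ξ k⌋) k = Int.fract (ξ k) := by
          simp [latticePoint, Int.fract, sub_eq_add_neg]
        rw [h, Real.norm_eq_abs, sq_abs]
        have h0 := Int.fract_nonneg (ξ k)
        have h1 := (Int.fract_lt_one (ξ k)).le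
        nlinarith
    _ = n := by simp

theorem exists_bound_of_periodic {n : ℕ} {K : E n → E n → ℝ}
    (hK : Continuous fun q : E n × E n => K q.1 q.2) (hper : ∀ p, IsPeriodic fun ξ => K ξ p)
    (ρ : ℝ) : ∃ B, 0 ≤ B ∧ ∀ ξ p, ‖p‖ ≤ ρ → |K ξ p| ≤ B := by
  obtain ⟨B, hB⟩ := ((isCompact_closedBall (0 : E n) (√n)).prod
    (isCompact_closedBall (0 : E n) ρ)).exists_bound_of_continuousOn hK.continuousOn
  refine ⟨max B 0, le_max_right _ _, fun ξ p hp => ?_⟩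
  obtain ⟨z, hz⟩ := exists_lattice_translate_norm_le ξ
  rw [show K ξ p = K (ξ + latticePoint z) p from (hper p ξ z).symm]
  exact (hB (ξ + latticePoint z, p) (by simpa using ⟨hz, hp⟩)).trans (le_max_left _ _)

/-- Translating `ξ` and `ξ'` by the same lattice vector moves both into a fixed compact set, where
uniform continuity applies. Only `p` needs a bound, since `δ ≤ 1` keeps `p'` within `ρ + 1`. -/
theorem exists_modulus_of_periodic {n : ℕ} {K : E n → E n → ℝ}
    (hK : Continuous fun q : E n × E n => K q.1 q.2) (hper : ∀ p, IsPeriodic fun ξ => K ξ p)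
    (ρ : ℝ) {η : ℝ} (hη : 0 < η) : ∃ δ > 0, ∀ ξ ξ' p p',
    ‖p‖ ≤ ρ → ‖ξ - ξ'‖ ≤ δ → ‖p - p'‖ ≤ δ → |K ξ p - K ξ' p'| ≤ η := by
  have hc := ((isCompact_closedBall (0 : E n) (√n + 1)).prod
    (isCompact_closedBall (0 : E n) (ρ + 1))).uniformContinuousOn_of_continuous hK.continuousOn
  obtain ⟨δ, hδ, h⟩ := Metric.uniformContinuousOn_iff.1 hc η hη
  refine ⟨min (δ / 2) 1, by positivity, fun ξ ξ' p p' hp hξ hpp => ?_⟩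
  obtain ⟨z, hz⟩ := exists_lattice_translate_norm_le ξ
  rw [show K ξ p = K (ξ + latticePoint z) p from (hper p ξ z).symm,
    show K ξ' p' = K (ξ' + latticePoint z) p' from (hper p' ξ' z).symm]
  have h1 : ‖ξ' + latticePoint z‖ ≤ √n + 1 := by
    have : ξ' + latticePoint z = (ξ + latticePoint z) - (ξ - ξ') := by abel
    rw [this]
    exact (norm_sub_le _ _).trans (add_le_add hz (hξ.trans (min_le_right _ _)))
  have h2 : ‖p'‖ ≤ ρ + 1 := by
    have : p' = p - (p - p') := by abel
    rw [this]
    exact (norm_sub_le _ _).trans (add_le_add hp (hpp.trans (min_le_right _ _)))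
  refine (h (ξ + latticePoint z, p) (by simpa using ⟨by linarith, by linarith⟩)
    (ξ' + latticePoint z, p') (by simpa using ⟨h1, h2⟩) ?_).le
  rw [Prod.dist_eq, max_lt_iff]
  have h3 := min_le_left (δ / 2) 1
  simp only [dist_eq_norm, add_sub_add_right_eq_sub]
  constructor <;> linarith

theorem exists_lower_bound_of_coercive {n : ℕ} {K : E n → E n → ℝ}
    (hK : Continuous fun q : E n × E n => K q.1 q.2) (hper : ∀ p, IsPeriodic fun ξ => K ξ p)
    (hcoer : IsUniformlyCoercive K) :
    ∃ M, 0 ≤ M ∧ ∀ ξ p, -M ≤ K ξ p := by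
  obtain ⟨r, hr⟩ := hcoer 0
  obtain ⟨B, hB0, hB⟩ := exists_bound_of_periodic hK hper r
  refine ⟨B, hB0, fun ξ p => ?_⟩
  rcases le_total r ‖p‖ with h | h
  · linarith [hr ξ p h]
  · exact (abs_le.1 (hB ξ p h)).1

theorem exists_bound_of_isPeriodic {n : ℕ} {v : E n → ℝ} (hv : Continuous v)
    (hper : IsPeriodic v) : ∃ B, 0 ≤ B ∧ ∀ ξ, |v ξ| ≤ B := by
  obtain ⟨B, h0, h⟩ := exists_bound_of_periodic (K := fun ξ _ => v ξ) (by fun_prop)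
    (fun _ => hper) 0
  exact ⟨B, h0, fun ξ => h ξ 0 (by simp)⟩

/-! ### Discounted systems -/

/-- Viscosity subsolution of `lam * w_i + G_i(ξ, Dw_i) + w_i - w_j = c`. -/
def IsDiscSub {n : ℕ} (G : Fin 2 → E n → E n → ℝ) (lam c : ℝ) (w : Fin 2 → E n → ℝ) : Prop :=
  ∀ (i : Fin 2) (φ : E n → ℝ), ContDiff ℝ 1 φ → ∀ ξ, IsLocalMax (fun y => w i y - φ y) ξ →
    lam * w i ξ + G i ξ (gradient φ ξ) + w i ξ - w i.rev ξ ≤ c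

/-- Viscosity supersolution of `lam * w_i + G_i(ξ, Dw_i) + w_i - w_j = c`. -/
def IsDiscSuper {n : ℕ} (G : Fin 2 → E n → E n → ℝ) (lam c : ℝ) (w : Fin 2 → E n → ℝ) : Prop :=
  ∀ (i : Fin 2) (φ : E n → ℝ), ContDiff ℝ 1 φ → ∀ ξ, IsLocalMin (fun y => w i y - φ y) ξ →
    c ≤ lam * w i ξ + G i ξ (gradient φ ξ) + w i ξ - w i.rev ξ

/-- The Hamiltonian `-G_i(ξ, -p)`, which governs `-w` when `G` governs `w`. -/
def reflect {n : ℕ} (G : Fin 2 → E n → E n → ℝ) : Fin 2 → E n → E n → ℝ :=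
  fun i ξ p => -G i ξ (-p)

theorem continuous_reflect {n : ℕ} {G : Fin 2 → E n → E n → ℝ} {i : Fin 2}
    (hG : Continuous fun q : E n × E n => G i q.1 q.2) :
    Continuous fun q : E n × E n => reflect G i q.1 q.2 :=
  (hG.comp (continuous_fst.prodMk continuous_snd.neg)).neg

theorem isPeriodic_reflect {n : ℕ} {G : Fin 2 → E n → E n → ℝ} {i : Fin 2}
    (hG : ∀ p, IsPeriodic fun ξ => G i ξ p) (p : E n) : IsPeriodic fun ξ => reflect G i ξ p :=
  fun ξ z => congrArg Neg.neg (hG (-p) ξ z)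

theorem gradient_neg_fun {n : ℕ} (φ : E n → ℝ) (ξ : E n) :
    gradient (fun y => -φ y) ξ = -gradient φ ξ := by
  rw [gradient_eq_toDual_symm, gradient_eq_toDual_symm, ← map_neg]
  congr 1
  exact fderiv_fun_neg

theorem isLocalMax_neg_sub_neg {X : Type*} [TopologicalSpace X] {f g : X → ℝ} {x : X} :
    IsLocalMax (fun y => -f y - -g y) x ↔ IsLocalMin (fun y => f y - g y) x := by
  unfold IsLocalMax IsLocalMin IsMaxFilter IsMinFilter
  refine eventually_congr (Eventually.of_forall fun y => ?_)
  constructor <;> intro h <;> linarith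

/-- The coupling is linear, so it survives the change of sign, and supersolution statements follow
from subsolution ones. Reflection destroys coercivity, so only results that do not use coercivity
transfer this way. -/
theorem isDiscSub_reflect_neg_iff {n : ℕ} {G : Fin 2 → E n → E n → ℝ} {lam c : ℝ}
    {w : Fin 2 → E n → ℝ} :
    IsDiscSub (reflect G) lam (-c) (fun i ξ => -w i ξ) ↔ IsDiscSuper G lam c w := by
  constructor
  · intro h i φ hφ ξ hmin
    have := h i (fun y => -φ y) hφ.neg ξ (isLocalMax_neg_sub_neg.2 hmin)
    simp only [reflect, gradient_neg_fun, neg_neg] at this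
    linarith
  · intro h i φ hφ ξ hmax
    have := h i (fun y => -φ y) hφ.neg ξ (isLocalMax_neg_sub_neg.1 (by simpa using hmax))
    simp only [gradient_neg_fun] at this
    simp only [reflect]
    linarith

/-- A bound on `w_i - w_j` and a Lipschitz bound for subsolutions, uniform in the discount. -/
theorem IsDiscSub.sub_le {n : ℕ} {G : Fin 2 → E n → E n → ℝ} {lam c : ℝ} {w : Fin 2 → E n → ℝ}
    (h : IsDiscSub G lam c w) (hw : ∀ i, Continuous (w i)) {M M' : ℝ}
    (hM : ∀ i ξ, c - lam * w i ξ ≤ M) (hM' : ∀ i ξ p, -M' ≤ G i ξ p) (i : Fin 2) (ξ : E n) :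
    w i ξ - w i.rev ξ ≤ M + M' := by
  by_contra! hcon
  have hopen : IsOpen {x | M + M' < w i x - w i.rev x} :=
    isOpen_lt continuous_const ((hw i).sub (hw i.rev))
  obtain ⟨r, hr, hball⟩ := Metric.isOpen_iff.1 hopen ξ hcon
  -- The inequality is available only where a test function touches; such points are dense and the
  -- violating set is open.
  obtain ⟨y, hy, φ, hφ, hmax⟩ := exists_touching_near (hw i) ξ hr
  have h1 := h i φ hφ y hmax
  have h2 := hM i y
  have h3 := hM' i y (gradient φ y)
  have h4 : M + M' < w i y - w i.rev y := hball hy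
  linarith

/-- The bound on the difference of the components controls the coupling, so at a touching point
`G_i` is at most `2 M + M'`, and coercivity caps the gradient. The constant `R` does not involve the
sup bound `C`, so it survives the vanishing of the discount. -/
theorem IsDiscSub.lipschitz {n : ℕ} {G : Fin 2 → E n → E n → ℝ} {lam c : ℝ}
    {w : Fin 2 → E n → ℝ} (h : IsDiscSub G lam c w) (hw : ∀ i, Continuous (w i)) {M M' C R : ℝ}
    (hM : ∀ i ξ, c - lam * w i ξ ≤ M) (hM' : ∀ i ξ p, -M' ≤ G i ξ p) (hC : ∀ i ξ, |w i ξ| ≤ C)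
    (hR0 : 0 ≤ R) (hR : ∀ i ξ p, R ≤ ‖p‖ → 2 * M + M' + 1 ≤ G i ξ p) (i : Fin 2) (x y : E n) :
    w i y - w i x ≤ R * ‖y - x‖ := by
  refine lipschitz_of_superdifferential_le (hw i) (hC i) hR0 (fun φ hφ ξ hmax => ?_) x y
  by_contra! hcon
  have h1 := h i φ hφ ξ hmax
  have h2 := h.sub_le hw hM hM' i.rev ξ
  rw [Fin.rev_rev] at h2
  linarith [hM i ξ, hR i ξ _ hcon.le]

theorem exists_radius_of_coercive {n : ℕ} {G : Fin 2 → E n → E n → ℝ}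
    (hG : ∀ i, IsUniformlyCoercive (G i)) (M : ℝ) :
    ∃ R, 0 ≤ R ∧ ∀ i ξ p, R ≤ ‖p‖ → M ≤ G i ξ p := by
  choose r hr using fun i => hG i M
  refine ⟨max 0 (max (r 0) (r 1)), le_max_left _ _, fun i ξ p hp => hr i ξ p ?_⟩
  fin_cases i
  · exact ((le_max_left _ _).trans (le_max_right _ _)).trans hp
  · exact ((le_max_right _ _).trans (le_max_right _ _)).trans hp

/-! ### Stability -/

/-- Maxima of `w_k - φ` converge to a strict maximum of `v - φ`, also when `w_k` approaches `v`
from above only at the limit point. -/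
theorem eventually_exists_isLocalMax {n : ℕ} {ι : Type*} {l : Filter ι} {w : ι → E n → ℝ}
    (hw : ∀ k, Continuous (w k)) {v φ : E n → ℝ} (hφ : Continuous φ) {x : E n}
    (hmax : IsLocalMax (fun y => v y - φ y) x) (hx : Tendsto (fun k => w k x) l (𝓝 (v x)))
    {r : ℝ} (hr : 0 < r)
    (hup : ∀ η > 0, ∀ᶠ k in l, ∀ y ∈ Metric.closedBall x r, w k y ≤ v y + η)
    {η : ℝ} (hη : 0 < η) :
    ∀ᶠ k in l, ∃ y ∈ Metric.ball x η, IsLocalMax (fun z => w k z - (φ z + ‖z - x‖ ^ 2)) y ∧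
      |w k y - v x| < η := by
  obtain ⟨r₁, hr₁, hball⟩ := Metric.eventually_nhds_iff_ball.1 hmax
  obtain ⟨r₂, hr₂, hφc⟩ := Metric.continuous_iff.1 hφ x (η / 2) (by linarith)
  set s := min (min (r / 2) (r₁ / 2)) (min (r₂ / 2) (η / 2)) with hs
  have hs0 : 0 < s := by positivity
  have hsr : s ≤ r / 2 := (min_le_left _ _).trans (min_le_left _ _)
  have hsr₁ : s ≤ r₁ / 2 := (min_le_left _ _).trans (min_le_right _ _)
  have hsr₂ : s ≤ r₂ / 2 := (min_le_right _ _).trans (min_le_left _ _)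
  have hsη : s ≤ η / 2 := (min_le_right _ _).trans (min_le_right _ _)
  -- The two errors of size `τ`, one at `x` and one at `y`, give `‖y - x‖² < 2 τ < s²`, so the
  -- maximum is interior; `τ ≤ η / 4` serves the estimate of the value.
  set τ := min (s ^ 2 / 4) (η / 4) with hτ
  have hτ0 : 0 < τ := by positivity
  have hτs : τ ≤ s ^ 2 / 4 := min_le_left _ _
  have hτη : τ ≤ η / 4 := min_le_right _ _
  filter_upwards [hup τ hτ0, hx.eventually (lt_mem_nhds (sub_lt_self (v x) hτ0))] with k hk hkx
  have hxm : x ∈ Metric.closedBall x s := Metric.mem_closedBall_self hs0.le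
  have hcont : Continuous fun z => w k z - (φ z + ‖z - x‖ ^ 2) := by
    have := hw k
    fun_prop
  obtain ⟨y, hy, hym⟩ := (isCompact_closedBall x s).exists_isMaxOn ⟨x, hxm⟩ hcont.continuousOn
  have h1 : w k x - (φ x + ‖x - x‖ ^ 2) ≤ w k y - (φ y + ‖y - x‖ ^ 2) := hym hxm
  simp only [sub_self, norm_zero, ne_eq, OfNat.ofNat_ne_zero, not_false_eq_true, zero_pow,
    add_zero] at h1
  have hyd : dist y x ≤ s := hy
  have h2 : v y - φ y ≤ v x - φ x := hball y (Metric.mem_ball.2 (by linarith))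
  have h3 := hk y (Metric.mem_closedBall.2 (by linarith))
  have h4 := abs_lt.1 (hφc y (by linarith))
  have h5 : ‖y - x‖ ^ 2 < s ^ 2 := by nlinarith [sq_nonneg s]
  have h6 : ‖y - x‖ < s := lt_of_pow_lt_pow_left₀ 2 hs0.le h5
  have hyb : y ∈ Metric.ball x s := by rwa [Metric.mem_ball, dist_eq_norm]
  refine ⟨y, Metric.ball_subset_ball (by linarith) hyb, ?_, ?_⟩
  · exact hym.isLocalMax (mem_of_superset (Metric.isOpen_ball.mem_nhds hyb)
      Metric.ball_subset_closedBall)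
  · rw [abs_lt]
    constructor <;> nlinarith [sq_nonneg ‖y - x‖]

/-- Away from `x` only upper bounds on `w k` are needed: the other component enters with a minus
sign, so bounding it from above bounds the left side from below. This weak convergence covers both a
Perron supremum, approximated at a single point, and a locally uniform limit. -/
theorem discSub_limit {n : ℕ} {ι : Type*} {l : Filter ι} [l.NeBot]
    {G : Fin 2 → E n → E n → ℝ} {lam c : ι → ℝ} {lam₀ c₀ : ℝ} {w : ι → Fin 2 → E n → ℝ}
    {v : Fin 2 → E n → ℝ} (hlam : Tendsto lam l (𝓝 lam₀)) (hc : Tendsto c l (𝓝 c₀))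
    (hsub : ∀ k, IsDiscSub G (lam k) (c k) (w k)) (hw : ∀ k i, Continuous (w k i)) {i : Fin 2}
    (hG : Continuous fun q : E n × E n => G i q.1 q.2) (hv : Continuous (v i.rev)) {x : E n}
    (hx : Tendsto (fun k => w k i x) l (𝓝 (v i x))) {r : ℝ} (hr : 0 < r)
    (hup : ∀ j, ∀ η > 0, ∀ᶠ k in l, ∀ y ∈ Metric.closedBall x r, w k j y ≤ v j y + η)
    {φ : E n → ℝ} (hφ : ContDiff ℝ 1 φ) (hmax : IsLocalMax (fun y => v i y - φ y) x) :
    lam₀ * v i x + G i x (gradient φ x) + v i x - v i.rev x ≤ c₀ := by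
  have hex := fun (m : ℕ) => eventually_exists_isLocalMax (fun k => hw k i) hφ.continuous hmax hx hr
    (hup i) (η := 1 / ((m : ℝ) + 1)) Nat.one_div_pos_of_nat
  have hlamE := fun (m : ℕ) => Metric.tendsto_nhds.1 hlam (1 / ((m : ℝ) + 1))
    Nat.one_div_pos_of_nat
  have hcE := fun (m : ℕ) => Metric.tendsto_nhds.1 hc (1 / ((m : ℝ) + 1)) Nat.one_div_pos_of_nat
  have hall := fun (m : ℕ) => ((hex m).and ((hlamE m).and ((hcE m).and
    (hup i.rev (1 / ((m : ℝ) + 1)) Nat.one_div_pos_of_nat)))).exists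
  -- One index is picked for each tolerance `1/(m+1)`, which turns the filter limit into a sequence;
  -- no countable basis of `l` is required.
  choose k hk1 hk2 hk3 hk4 using hall
  choose y hy hloc hval using hk1
  have hzero : Tendsto (fun m : ℕ => 1 / ((m : ℝ) + 1)) atTop (𝓝 0) :=
    tendsto_one_div_add_atTop_nhds_zero_nat
  have ty : Tendsto y atTop (𝓝 x) := by
    rw [tendsto_iff_dist_tendsto_zero]
    exact squeeze_zero (fun _ => dist_nonneg) (fun m => (hy m).le) hzero
  have tl : Tendsto (fun m => lam (k m)) atTop (𝓝 lam₀) := by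
    rw [tendsto_iff_dist_tendsto_zero]
    exact squeeze_zero (fun _ => dist_nonneg) (fun m => (hk2 m).le) hzero
  have tc : Tendsto (fun m => c (k m)) atTop (𝓝 c₀) := by
    rw [tendsto_iff_dist_tendsto_zero]
    exact squeeze_zero (fun _ => dist_nonneg) (fun m => (hk3 m).le) hzero
  have tw : Tendsto (fun m => w (k m) i (y m)) atTop (𝓝 (v i x)) := by
    rw [tendsto_iff_dist_tendsto_zero]
    exact squeeze_zero (fun _ => dist_nonneg) (fun m => (hval m).le) hzero
  have tg : Tendsto (fun m => gradient φ (y m) + (2 : ℝ) • (y m - x)) atTop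
      (𝓝 (gradient φ x)) := by
    have := ((continuous_gradient hφ).tendsto x).comp ty |>.add
      ((ty.sub_const x).const_smul (2 : ℝ))
    simpa using this
  have tG := (hG.tendsto (x, gradient φ x)).comp (ty.prodMk_nhds tg)
  have tv := (hv.tendsto x).comp ty
  have hlhs := ((((tl.mul tw).add tG).add tw).sub (tv.add hzero))
  rw [add_zero] at hlhs
  refine le_of_tendsto_of_tendsto hlhs tc ?_
  filter_upwards [ty.eventually (Metric.closedBall_mem_nhds x hr)] with m hm
  have h1 := hsub (k m) i (fun z => φ z + ‖z - x‖ ^ 2) (hφ.add (contDiff_normSq_sub x)) (y m)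
    (hloc m)
  rw [(hasGradientAt_add (hasGradientAt_of_contDiff hφ (y m))
    (hasGradientAt_normSq_sub x (y m))).gradient] at h1
  have h2 := hk4 m (y m) hm
  simp only [Function.comp_apply]
  linarith

/-! ### Perron's method for the discounted system -/

/-- Continuous subsolutions of the discounted system with values in `[-A, A]`. -/
def perronFamily {n : ℕ} (G : Fin 2 → E n → E n → ℝ) (lam A : ℝ) : Set (Fin 2 → E n → ℝ) :=
  {w | (∀ i, Continuous (w i)) ∧ (∀ i ξ, |w i ξ| ≤ A) ∧ IsDiscSub G lam 0 w}

/-- The pointwise supremum of the Perron family. -/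
def perronSup {n : ℕ} (G : Fin 2 → E n → E n → ℝ) (lam A : ℝ) (i : Fin 2) (ξ : E n) : ℝ :=
  sSup ((fun w => w i ξ) '' perronFamily G lam A)

section Perron

variable {n : ℕ} {G : Fin 2 → E n → E n → ℝ} {lam A : ℝ}

theorem const_mem_perronFamily (hA : 0 ≤ A) (hGA : ∀ i ξ, G i ξ 0 ≤ lam * A) :
    (fun _ _ => -A) ∈ perronFamily G lam A := by
  refine ⟨fun _ => continuous_const, fun _ _ => by rw [abs_neg, abs_of_nonneg hA], ?_⟩
  intro i φ hφ ξ hmax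
  have h1 := gradient_eq_of_isLocalMax_sub hmax (differentiableAt_const _)
    (hφ.differentiable one_ne_zero ξ)
  rw [gradient_fun_const] at h1
  rw [← h1]
  linarith [hGA i ξ]

theorem bddAbove_perronFamily (i : Fin 2) (ξ : E n) :
    BddAbove ((fun w : Fin 2 → E n → ℝ => w i ξ) '' perronFamily G lam A) := by
  refine ⟨A, ?_⟩
  rintro _ ⟨w, hw, rfl⟩
  exact (abs_le.1 (hw.2.1 i ξ)).2

theorem le_perronSup {w : Fin 2 → E n → ℝ} (hw : w ∈ perronFamily G lam A) (i : Fin 2)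
    (ξ : E n) : w i ξ ≤ perronSup G lam A i ξ :=
  le_csSup (bddAbove_perronFamily i ξ) ⟨w, hw, rfl⟩

theorem perronSup_le (hne : (perronFamily G lam A).Nonempty) {i : Fin 2} {ξ : E n} {b : ℝ}
    (h : ∀ w ∈ perronFamily G lam A, w i ξ ≤ b) : perronSup G lam A i ξ ≤ b := by
  refine csSup_le (hne.image _) ?_
  rintro _ ⟨w, hw, rfl⟩
  exact h w hw

theorem abs_perronSup_le (hne : (perronFamily G lam A).Nonempty) (i : Fin 2) (ξ : E n) :
    |perronSup G lam A i ξ| ≤ A := by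
  refine abs_le.2 ⟨?_, perronSup_le hne fun w hw => (abs_le.1 (hw.2.1 i ξ)).2⟩
  obtain ⟨w, hw⟩ := hne
  exact (abs_le.1 (hw.2.1 i ξ)).1.trans (le_perronSup hw i ξ)

/-- A common Lipschitz constant passes to the supremum. Perron's method can thus stay within
continuous functions, without semicontinuous envelopes. -/
theorem continuous_perronSup (hne : (perronFamily G lam A).Nonempty) {R : ℝ}
    (hR : ∀ w ∈ perronFamily G lam A, ∀ i x y, w i y - w i x ≤ R * ‖y - x‖) (i : Fin 2) :
    Continuous (perronSup G lam A i) := by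
  refine (LipschitzWith.of_le_add_mul' R fun y x => ?_).continuous
  refine perronSup_le hne fun w hw => ?_
  rw [dist_eq_norm]
  linarith [hR w hw i x y, le_perronSup hw i x]

/-- A sequence of members that nearly attains the supremum of component `i` at `ξ` is enough:
everywhere else, and for the other component, members lie below the supremum. -/
theorem isDiscSub_perronSup (hne : (perronFamily G lam A).Nonempty)
    (hG : ∀ i, Continuous fun q : E n × E n => G i q.1 q.2)
    (hcont : ∀ i, Continuous (perronSup G lam A i)) : IsDiscSub G lam 0 (perronSup G lam A) := by
  intro i φ hφ ξ hmax
  obtain ⟨s, -, hs, hmem⟩ := exists_seq_tendsto_sSup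
    (hne.image fun w : Fin 2 → E n → ℝ => w i ξ) (bddAbove_perronFamily i ξ)
  choose w hw hws using hmem
  refine discSub_limit (l := atTop) (lam := fun _ => lam) (c := fun _ => 0) tendsto_const_nhds
    tendsto_const_nhds (fun k => (hw k).2.2) (fun k => (hw k).1) (hG i) (hcont i.rev) (x := ξ)
    ?_ one_pos ?_ hφ hmax
  · exact hs.congr fun k => (hws k).symm
  · intro j η hη
    refine Eventually.of_forall fun k y _ => ?_
    linarith [le_perronSup (hw k) j y]

/-- Members need not be periodic, but the family is invariant under lattice translations, hence so
is its supremum. -/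
theorem isPeriodic_perronSup (hne : (perronFamily G lam A).Nonempty)
    (hper : ∀ i p, IsPeriodic fun ξ => G i ξ p) (i : Fin 2) :
    IsPeriodic (perronSup G lam A i) := by
  have hshift : ∀ w ∈ perronFamily G lam A, ∀ a : E n, (∀ i ξ p, G i (ξ + a) p = G i ξ p) →
      (fun i ξ => w i (ξ + a)) ∈ perronFamily G lam A := by
    intro w hw a ha
    refine ⟨fun i => (hw.1 i).comp (continuous_id.add continuous_const),
      fun i ξ => hw.2.1 i _, fun i φ hφ ξ hmax => ?_⟩
    have htend : Tendsto (fun y => y - a) (𝓝 (ξ + a)) (𝓝 ξ) := by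
      have : Continuous fun y : E n => y - a := by fun_prop
      simpa using this.tendsto (ξ + a)
    have hmax' : IsLocalMax (fun y => w i y - φ (y - a)) (ξ + a) := by
      filter_upwards [htend.eventually hmax] with y hy
      simpa using hy
    have h1 := hw.2.2 i (fun y => φ (y - a)) (hφ.comp (contDiff_id.sub contDiff_const)) _ hmax'
    have h2 : gradient (fun y => φ (y - a)) (ξ + a) = gradient φ ξ := by
      rw [gradient_eq_toDual_symm, gradient_eq_toDual_symm, fderiv_comp_sub,
        add_sub_cancel_right]
    rw [h2, ha] at h1
    exact h1
  have key : ∀ (z : Fin n → ℤ) (i : Fin 2) (ξ : E n) (p : E n),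
      G i (ξ + latticePoint z) p = G i ξ p := fun z i ξ p => hper i p ξ z
  intro ξ z
  refine le_antisymm (perronSup_le hne fun w hw => ?_) (perronSup_le hne fun w hw => ?_)
  · exact le_perronSup (hshift w hw (latticePoint z) (key z)) i ξ
  · have hz : ∀ (i : Fin 2) (ξ : E n) (p : E n), G i (ξ + -latticePoint z) p = G i ξ p := by
      intro i ξ p
      have := key z i (ξ + -latticePoint z) p
      rw [neg_add_cancel_right] at this
      exact this.symm
    have := le_perronSup (hshift w hw (-latticePoint z) hz) i (ξ + latticePoint z)
    simpa using this

/-- If the inequality failed at `ξ`, component `i` could be raised near `ξ` to a larger member of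
the family. Raising one component never spoils the equation of the other, because it enters there
with a minus sign. -/
theorem isDiscSuper_perronSup (hne : (perronFamily G lam A).Nonempty)
    (hG : ∀ i, Continuous fun q : E n × E n => G i q.1 q.2)
    (hGA : ∀ i ξ, -(lam * A) ≤ G i ξ 0)
    (hcont : ∀ i, Continuous (perronSup G lam A i)) : IsDiscSuper G lam 0 (perronSup G lam A) := by
  intro i φ hφ ξ hmin
  set v := perronSup G lam A with hv
  by_contra! hcon
  have hsub : IsDiscSub G lam 0 v := isDiscSub_perronSup hne hG hcont
  -- the supremum is not constrained by the upper bound at `ξ`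
  have hlt : v i ξ < A := by
    by_contra! hge
    have hvA : v i ξ = A := le_antisymm (abs_le.1 (abs_perronSup_le hne i ξ)).2 hge
    -- Where `v i` reaches the ceiling `A`, the test function has a local maximum and so zero
    -- gradient; the constant `A` being a supersolution then contradicts the assumed failure.
    have hloc : IsLocalMax (fun y => φ y - A) ξ := by
      filter_upwards [hmin] with y hy
      have := (abs_le.1 (abs_perronSup_le hne i y)).2
      rw [← hv] at this
      have hy' : v i ξ - φ ξ ≤ v i y - φ y := hy
      linarith
    have h1 := gradient_eq_of_isLocalMax_sub hloc (hφ.differentiable one_ne_zero ξ)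
      (differentiableAt_const _)
    rw [gradient_fun_const] at h1
    rw [h1, hvA] at hcon
    have h2 := (abs_le.1 (abs_perronSup_le hne i.rev ξ)).2
    rw [← hv] at h2
    linarith [hGA i ξ]
  -- the bump
  let ψ : E n → ℝ := fun y => φ y + v i ξ - φ ξ - ‖y - ξ‖ ^ 2
  have hψ : ContDiff ℝ 1 ψ :=
    ((hφ.add contDiff_const).sub contDiff_const).sub (contDiff_normSq_sub ξ)
  have hψξ : ψ ξ = v i ξ := by simp [ψ]
  have hgψ : gradient ψ ξ = gradient φ ξ := by
    have h := hasGradientAt_add (hasGradientAt_add_const (hasGradientAt_of_contDiff hφ ξ)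
      (v i ξ - φ ξ)) (hasGradientAt_neg (hasGradientAt_normSq_sub ξ ξ))
    have h' : HasGradientAt ψ (gradient φ ξ + -((2 : ℝ) • (ξ - ξ))) ξ := by
      convert h using 2
      simp only [ψ]
      ring
    rw [h'.gradient]
    simp
  have hev1 : ∀ᶠ q : E n × ℝ in 𝓝 (ξ, 0), lam * (ψ q.1 + q.2) + G i q.1 (gradient ψ q.1) +
      (ψ q.1 + q.2) - v i.rev q.1 < 0 := by
    have hc : Continuous fun q : E n × ℝ => lam * (ψ q.1 + q.2) + G i q.1 (gradient ψ q.1) +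
        (ψ q.1 + q.2) - v i.rev q.1 := by
      have h1 := hψ.continuous
      have h2 := continuous_gradient hψ
      have h3 : Continuous (v i.rev) := hcont i.rev
      have h4 : Continuous fun q : E n × ℝ => G i q.1 (gradient ψ q.1) :=
        (hG i).comp (continuous_fst.prodMk (h2.comp continuous_fst))
      fun_prop
    refine hc.continuousAt.eventually_lt continuousAt_const ?_
    simp only [add_zero, hψξ, hgψ]
    exact hcon
  have hev2 : ∀ᶠ q : E n × ℝ in 𝓝 (ξ, 0), ψ q.1 + q.2 < A := by
    have hc : Continuous fun q : E n × ℝ => ψ q.1 + q.2 := by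
      have h1 := hψ.continuous
      fun_prop
    refine hc.continuousAt.eventually_lt continuousAt_const ?_
    simpa [hψξ] using hlt
  obtain ⟨r, hr, hball⟩ := Metric.eventually_nhds_iff_ball.1
    ((hev1.and hev2).and (continuousAt_fst.eventually hmin))
  set s := r / 2 with hs
  have hs0 : 0 < s := by rw [hs]; linarith
  -- On the sphere of radius `s` the quadratic term lowers `ψ` by `s²`, so `δ ≤ s² / 2` keeps `ψ +
  -- δ` below `v i` there and the gluing is continuous. The bound `δ ≤ s` keeps `(y, δ)` in the
  -- product ball.
  set δ := min s (s ^ 2 / 2) with hδ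
  have hδ0 : 0 < δ := by positivity
  have hin : ∀ y, ‖y - ξ‖ ≤ s → (lam * (ψ y + δ) + G i y (gradient ψ y) +
      (ψ y + δ) - v i.rev y < 0 ∧ ψ y + δ < A) ∧ v i ξ - φ ξ ≤ v i y - φ y := by
    intro y hy
    refine hball (y, δ) ?_
    rw [Metric.mem_ball, Prod.dist_eq, max_lt_iff, dist_eq_norm, Real.dist_eq, sub_zero,
      abs_of_pos hδ0]
    have := min_le_left s (s ^ 2 / 2)
    constructor <;> linarith
  let b : E n → ℝ := fun y => if ‖y - ξ‖ ≤ s then max (v i y) (ψ y + δ) else v i y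
  have hbcont : Continuous b := by
    refine Continuous.if_le ((hcont i).max (hψ.continuous.add continuous_const)) (hcont i)
      (by fun_prop) continuous_const fun y hy => ?_
    refine max_eq_left ?_
    have h1 := (hin y hy.le).2
    have h2 := min_le_right s (s ^ 2 / 2)
    simp only [ψ, hy]
    nlinarith
  have hvb : ∀ y, v i y ≤ b y := by
    intro y
    simp only [b]
    split_ifs
    · exact le_max_left _ _
    · exact le_rfl
  have hrev : i.rev ≠ i := by fin_cases i <;> decide
  let w : Fin 2 → E n → ℝ := fun j => if j = i then b else v j
  have hwi : w i = b := by simp [w]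
  have hwr : w i.rev = v i.rev := by simp [w, hrev]
  have hcases : ∀ j, j = i ∨ j = i.rev := by
    intro j
    fin_cases i <;> fin_cases j <;> decide
  have hmem : w ∈ perronFamily G lam A := by
    refine ⟨fun j => ?_, fun j y => ?_, fun j η hη y hmax => ?_⟩
    · rcases hcases j with rfl | rfl
      · rw [hwi]; exact hbcont
      · rw [hwr]; exact hcont _
    · rcases hcases j with rfl | rfl
      · rw [hwi]
        have h1 := abs_le.1 (abs_perronSup_le hne j y)
        rw [← hv] at h1
        refine abs_le.2 ⟨h1.1.trans (hvb y), ?_⟩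
        simp only [b]
        split_ifs with hy
        · exact max_le h1.2 (hin y hy).1.2.le
        · exact h1.2
      · rw [hwr]; exact abs_perronSup_le hne _ y
    · rcases hcases j with rfl | rfl
      · rw [hwi] at hmax ⊢
        rw [hwr]
        by_cases hby : b y = v j y
        · have hloc : IsLocalMax (fun z => v j z - η z) y := by
            filter_upwards [hmax] with z hz
            simp only [hby] at hz
            linarith [hvb z]
          rw [hby]
          exact hsub j η hη y hloc
        · have hys : ‖y - ξ‖ ≤ s := by
            by_contra h
            exact hby (by simp [b, h])
          have hbψ : b y = ψ y + δ := by
            simp only [b, hys, if_true] at hby ⊢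
            rcases max_choice (v j y) (ψ y + δ) with h | h
            · exact absurd h hby
            · exact h
          have hys' : ‖y - ξ‖ < s := by
            refine lt_of_le_of_ne hys fun h => hby ?_
            simp only [b, hys, if_true]
            refine max_eq_left ?_
            have h1 := (hin y hys).2
            have h2 := min_le_right s (s ^ 2 / 2)
            simp only [ψ, h]
            nlinarith
          have hloc : IsLocalMax (fun z => ψ z - (η z - δ)) y := by
            have hnear : ∀ᶠ z in 𝓝 y, ‖z - ξ‖ < s :=
              (by fun_prop : Continuous fun z : E n => ‖z - ξ‖).continuousAt.eventually_lt
                continuousAt_const hys'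
            filter_upwards [hmax, hnear] with z hz hzs
            have : ψ z + δ ≤ b z := by
              simp only [b, hzs.le, if_true]
              exact le_max_right _ _
            rw [hbψ] at hz
            linarith
          have hg := gradient_eq_of_isLocalMax_sub hloc (hψ.differentiable one_ne_zero y)
            ((hη.differentiable one_ne_zero y).sub_const δ)
          have hg' : gradient (fun z => η z - δ) y = gradient η y := by
            rw [gradient_eq_toDual_symm, fderiv_sub_const]
            rfl
          rw [hbψ, ← hg', ← hg]
          exact (hin y hys).1.1.le
      -- For the untouched component only the coupling changes, and it decreases.
      · rw [hwr] at hmax ⊢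
        rw [Fin.rev_rev, hwi]
        have := hsub i.rev η hη y hmax
        rw [Fin.rev_rev] at this
        linarith [hvb y]
  have h1 := le_perronSup hmem i ξ
  rw [hwi, ← hv] at h1
  have h2 : ψ ξ + δ ≤ b ξ := by
    simp only [b, sub_self, norm_zero, hs0.le, if_true]
    exact le_max_right _ _
  rw [hψξ] at h2
  linarith

end Perron

/-- The discounted system has a periodic solution. -/
theorem exists_discounted_solution {n : ℕ} {G : Fin 2 → E n → E n → ℝ}
    (hG : ∀ i, Continuous fun q : E n × E n => G i q.1 q.2)
    (hper : ∀ i p, IsPeriodic fun ξ => G i ξ p) {lam M M' R : ℝ} (hlam : 0 < lam)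
    (hM : ∀ i ξ, |G i ξ 0| ≤ M) (hM' : ∀ i ξ p, -M' ≤ G i ξ p) (hM0 : 0 ≤ M) (hR0 : 0 ≤ R)
    (hR : ∀ i ξ p, R ≤ ‖p‖ → 2 * M + M' + 1 ≤ G i ξ p) :
    ∃ v : Fin 2 → E n → ℝ, (∀ i, Continuous (v i)) ∧ (∀ i, IsPeriodic (v i)) ∧
      (∀ i ξ, |lam * v i ξ| ≤ M) ∧ (∀ i x y, v i y - v i x ≤ R * ‖y - x‖) ∧
      (∀ i ξ, v i ξ - v i.rev ξ ≤ M + M') ∧ IsDiscSub G lam 0 v ∧ IsDiscSuper G lam 0 v := by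
  -- With `lam * A = M ≥ |G_i(ξ, 0)|`, the constants `-A` and `A` are a sub- and a supersolution.
  set A := M / lam with hA
  have hlA : lam * A = M := by rw [hA]; field_simp
  have hA0 : 0 ≤ A := by positivity
  have hne : (perronFamily G lam A).Nonempty :=
    ⟨_, const_mem_perronFamily hA0 fun i ξ => by rw [hlA]; exact (abs_le.1 (hM i ξ)).2⟩
  have hbd : ∀ t : ℝ, |t| ≤ A → |lam * t| ≤ M := by
    intro t ht
    rw [abs_mul, abs_of_pos hlam, ← hlA]
    exact mul_le_mul_of_nonneg_left ht hlam.le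
  have hbd' : ∀ t : ℝ, |t| ≤ A → 0 - lam * t ≤ M := by
    intro t ht
    linarith [(abs_le.1 (hbd t ht)).1]
  have hLip : ∀ w ∈ perronFamily G lam A, ∀ i x y, w i y - w i x ≤ R * ‖y - x‖ := by
    intro w hw i x y
    exact hw.2.2.lipschitz hw.1 (fun j ξ => hbd' _ (hw.2.1 j ξ)) hM' hw.2.1 hR0 hR i x y
  have hcont := continuous_perronSup hne hLip
  have hsub := isDiscSub_perronSup hne hG hcont
  have hmem : perronSup G lam A ∈ perronFamily G lam A := ⟨hcont, abs_perronSup_le hne, hsub⟩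
  refine ⟨perronSup G lam A, hcont, isPeriodic_perronSup hne hper,
    fun i ξ => hbd _ (abs_perronSup_le hne i ξ), hLip _ hmem, fun i ξ => ?_, hsub,
    isDiscSuper_perronSup hne hG (fun i ξ => by rw [hlA]; exact (abs_le.1 (hM i ξ)).1) hcont⟩
  exact hsub.sub_le (M := M) (M' := M') hcont (fun j ξ => hbd' _ (abs_perronSup_le hne j ξ))
    hM' (i := i) (ξ := ξ)

/-! ### Solvability of the cell problem -/

/-- Pointwise limits of equi-Lipschitz functions are locally uniform. -/
theorem eventually_closedBall_abs_sub_le {n : ℕ} {ι : Type*} {l : Filter ι} {w : ι → E n → ℝ}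
    {v : E n → ℝ} {R : ℝ} (hR : 0 ≤ R) (hw : ∀ k x y, w k y - w k x ≤ R * ‖y - x‖)
    (hv : ∀ x y, v y - v x ≤ R * ‖y - x‖) (hlim : ∀ x, Tendsto (fun k => w k x) l (𝓝 (v x)))
    (x : E n) (r : ℝ) {η : ℝ} (hη : 0 < η) :
    ∀ᶠ k in l, ∀ y ∈ Metric.closedBall x r, |w k y - v y| ≤ η := by
  set ρ := η / (3 * (R + 1)) with hρ
  have hρ0 : 0 < ρ := by positivity
  have hRρ : R * ρ ≤ η / 3 := by
    have : (R + 1) * ρ = η / 3 := by rw [hρ]; field_simp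
    nlinarith
  obtain ⟨t, -, htf, hcov⟩ := (isCompact_closedBall x r).finite_cover_balls hρ0
  have hev : ∀ᶠ k in l, ∀ z ∈ t, |w k z - v z| < η / 3 := by
    rw [eventually_all_finite htf]
    intro z _
    exact Metric.tendsto_nhds.1 (hlim z) (η / 3) (by linarith)
  filter_upwards [hev] with k hk y hy
  obtain ⟨z, hzt, hz⟩ := mem_iUnion₂.1 (hcov hy)
  have hz' : ‖y - z‖ < ρ := by rwa [Metric.mem_ball, dist_eq_norm] at hz
  have hz'' : ‖z - y‖ < ρ := by rwa [norm_sub_rev]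
  have h0 := abs_lt.1 (hk z hzt)
  have h1 := hw k z y
  have h2 := hw k y z
  have h3 := hv z y
  have h4 := hv y z
  have h5 : R * ‖y - z‖ ≤ η / 3 := (mul_le_mul_of_nonneg_left hz'.le hR).trans hRρ
  have h6 : R * ‖z - y‖ ≤ η / 3 := (mul_le_mul_of_nonneg_left hz''.le hR).trans hRρ
  exact abs_le.2 ⟨by linarith, by linarith⟩

theorem exists_tendsto_ultrafilter_of_abs_le {ι : Type*} (U : Ultrafilter ι) {f : ι → ℝ} {C : ℝ}
    (h : ∀ k, |f k| ≤ C) : ∃ a, Tendsto f U (𝓝 a) := by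
  obtain ⟨a, -, ha⟩ := (isCompact_Icc (a := -C) (b := C)).ultrafilter_le_nhds (U.map f)
    (le_principal_iff.2 (Ultrafilter.mem_map.2 (univ_mem' fun k => abs_le.1 (h k))))
  exact ⟨a, ha⟩

/-- Vanishing discount. The discounted solutions may blow up, but their slopes and the differences
of their components are bounded uniformly, so they are bounded locally once `v k 0 0` is subtracted.
The subtracted constant, multiplied by the discount, stays bounded and yields `c`. -/
theorem exists_ergodic_solution {n : ℕ} {G : Fin 2 → E n → E n → ℝ}
    (hG : ∀ i, Continuous fun q : E n × E n => G i q.1 q.2)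
    (hper : ∀ i p, IsPeriodic fun ξ => G i ξ p) (hcoer : ∀ i, IsUniformlyCoercive (G i)) :
    ∃ (c : ℝ) (v : Fin 2 → E n → ℝ), (∀ i, Continuous (v i)) ∧ (∀ i, IsPeriodic (v i)) ∧
      IsDiscSub G 0 c v ∧ IsDiscSuper G 0 c v := by
  choose B hB0 hB using fun i => exists_bound_of_periodic (hG i) (hper i) 0
  choose b hb0 hb using fun i => exists_lower_bound_of_coercive (hG i) (hper i) (hcoer i)
  set M := B 0 + B 1
  set M' := b 0 + b 1
  have hM0 : 0 ≤ M := add_nonneg (hB0 0) (hB0 1)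
  have hM'0 : 0 ≤ M' := add_nonneg (hb0 0) (hb0 1)
  have hBM : ∀ i, B i ≤ M := by
    intro i
    fin_cases i
    · exact le_add_of_nonneg_right (hB0 1)
    · exact le_add_of_nonneg_left (hB0 0)
  have hbM : ∀ i, b i ≤ M' := by
    intro i
    fin_cases i
    · exact le_add_of_nonneg_right (hb0 1)
    · exact le_add_of_nonneg_left (hb0 0)
  have hM : ∀ i ξ, |G i ξ 0| ≤ M := fun i ξ => (hB i ξ 0 (by simp)).trans (hBM i)
  have hM' : ∀ i ξ p, -M' ≤ G i ξ p := fun i ξ p => (neg_le_neg (hbM i)).trans (hb i ξ p)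
  obtain ⟨R, hR0, hR⟩ := exists_radius_of_coercive hcoer (2 * M + M' + 1)
  have hlam : ∀ k : ℕ, 0 < 1 / ((k : ℝ) + 1) := fun k => Nat.one_div_pos_of_nat
  choose v hvc hvp hvM hvL hvd hvs hvS using fun k : ℕ =>
    exists_discounted_solution hG hper (hlam k) hM hM' hM0 hR0 hR
  -- Along an ultrafilter every bounded real family converges, so all pointwise limits exist at once
  -- and no diagonal subsequence is extracted.
  let U : Ultrafilter ℕ := Ultrafilter.of atTop
  have hU : (U : Filter ℕ) ≤ atTop := Ultrafilter.of_le atTop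
  let w : ℕ → Fin 2 → E n → ℝ := fun k i ξ => v k i ξ - v k 0 0
  let c : ℕ → ℝ := fun k => -(1 / ((k : ℝ) + 1) * v k 0 0)
  have hwL : ∀ i k x y, w k i y - w k i x ≤ R * ‖y - x‖ := by
    intro i k x y
    simpa [w] using hvL k i x y
  have hd : ∀ k i ξ, |v k i ξ - v k 0 ξ| ≤ M + M' := by
    intro k i ξ
    have h0 := hvd k 0 ξ
    have h1 := hvd k 1 ξ
    have e0 : (0 : Fin 2).rev = 1 := rfl
    have e1 : (1 : Fin 2).rev = 0 := rfl
    rw [e0] at h0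
    rw [e1] at h1
    fin_cases i
    · simp only [Fin.zero_eta, sub_self, abs_zero]
      linarith
    · exact abs_le.2 ⟨by simp only [Fin.mk_one]; linarith, h1⟩
  have hwb : ∀ i ξ k, |w k i ξ| ≤ R * ‖ξ‖ + (M + M') := by
    intro i ξ k
    have h1 := abs_le.1 (hd k i ξ)
    have h2 := hvL k 0 0 ξ
    have h3 := hvL k 0 ξ 0
    rw [sub_zero] at h2
    rw [zero_sub, norm_neg] at h3
    exact abs_le.2 ⟨by simp only [w]; linarith, by simp only [w]; linarith⟩
  choose V hV using fun i ξ => exists_tendsto_ultrafilter_of_abs_le U (hwb i ξ)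
  obtain ⟨c₀, hc₀⟩ := exists_tendsto_ultrafilter_of_abs_le U (f := c) (C := M)
    (fun k => by rw [abs_neg]; exact hvM k 0 0)
  have hVL : ∀ i x y, V i y - V i x ≤ R * ‖y - x‖ := fun i x y =>
    le_of_tendsto ((hV i y).sub (hV i x)) (Eventually.of_forall fun k => hwL i k x y)
  have hVc : ∀ i, Continuous (V i) := fun i =>
    (LipschitzWith.of_le_add_mul' R fun y x => by
      rw [dist_eq_norm]; linarith [hVL i x y]).continuous
  have hwc : ∀ k i, Continuous (w k i) := fun k i => (hvc k i).sub continuous_const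
  have hlim0 : Tendsto (fun k : ℕ => 1 / ((k : ℝ) + 1)) U (𝓝 0) :=
    tendsto_one_div_add_atTop_nhds_zero_nat.mono_left hU
  have hshift : ∀ k i (φ : E n → ℝ),
      (fun y => v k i y - (φ y + v k 0 0)) = fun y => w k i y - φ y := by
    intro k i φ
    ext y
    simp only [w]
    ring
  have hgr : ∀ (φ : E n → ℝ) (a : ℝ) ξ, gradient (fun y => φ y + a) ξ = gradient φ ξ := by
    intro φ a ξ
    rw [gradient_eq_toDual_symm, fderiv_add_const]
    rfl
  have hws : ∀ k : ℕ, IsDiscSub G (1 / ((k : ℝ) + 1)) (c k) (w k) := by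
    intro k i φ hφ ξ hmax
    have h := hvs k i (fun y => φ y + v k 0 0) (hφ.add contDiff_const) ξ (by rwa [hshift])
    rw [hgr] at h
    simp only [w, c]
    linarith
  have hwS : ∀ k : ℕ, IsDiscSuper G (1 / ((k : ℝ) + 1)) (c k) (w k) := by
    intro k i φ hφ ξ hmin
    have h := hvS k i (fun y => φ y + v k 0 0) (hφ.add contDiff_const) ξ (by rwa [hshift])
    rw [hgr] at h
    simp only [w, c]
    linarith
  have hunif : ∀ i x, ∀ η > 0, ∀ᶠ k in (U : Filter ℕ), ∀ y ∈ Metric.closedBall x 1,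
      |w k i y - V i y| ≤ η := fun i x η hη =>
    eventually_closedBall_abs_sub_le hR0 (hwL i) (hVL i) (hV i) x 1 hη
  refine ⟨c₀, V, hVc, fun i ξ z => ?_, fun i φ hφ ξ hmax => ?_, ?_⟩
  · refine tendsto_nhds_unique (hV i (ξ + latticePoint z)) ((hV i ξ).congr fun k => ?_)
    simp only [w]
    rw [hvp k i ξ z]
  · refine discSub_limit hlim0 hc₀ hws hwc (hG i) (hVc i.rev) (hV i ξ) one_pos ?_ hφ hmax
    intro j η hη
    filter_upwards [hunif j ξ η hη] with k hk y hy
    linarith [(abs_le.1 (hk y hy)).2]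
  · rw [← isDiscSub_reflect_neg_iff]
    intro i φ hφ ξ hmax
    refine discSub_limit (w := fun k i ξ => -w k i ξ) (v := fun i ξ => -V i ξ) hlim0 hc₀.neg
      (fun k => isDiscSub_reflect_neg_iff.2 (hwS k)) (fun k i => (hwc k i).neg)
      (continuous_reflect (hG i)) (hVc i.rev).neg (hV i ξ).neg one_pos ?_ hφ hmax
    intro j η hη
    filter_upwards [hunif j ξ η hη] with k hk y hy
    linarith [(abs_le.1 (hk y hy)).1]

/-! ### Comparison for the cell problem and the effective Hamiltonian -/

/-- Doubling of variables. Only the subsolution has to be Lipschitz: this bounds the penalty's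
momentum by `2 R` and forces the two points together. Periodicity supplies compactness. -/
theorem cell_comparison {n : ℕ} {G : Fin 2 → E n → E n → ℝ}
    (hG : ∀ i, Continuous fun q : E n × E n => G i q.1 q.2)
    (hper : ∀ i p, IsPeriodic fun ξ => G i ξ p) {c c' R : ℝ} {v v' : Fin 2 → E n → ℝ}
    (hR : 0 ≤ R) (hv : ∀ i, Continuous (v i)) (hvp : ∀ i, IsPeriodic (v i))
    (hvL : ∀ i x y, v i y - v i x ≤ R * ‖y - x‖) (hsub : IsDiscSub G 0 c v)
    (hv' : ∀ i, Continuous (v' i)) (hvp' : ∀ i, IsPeriodic (v' i))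
    (hsuper : IsDiscSuper G 0 c' v') : c' ≤ c := by
  refine le_of_forall_pos_le_add fun η hη => ?_
  choose δ hδ hmod using fun i => exists_modulus_of_periodic (hG i) (hper i) (2 * R) hη
  set τ := min (δ 0) (δ 1) with hτ
  have hτ0 : 0 < τ := lt_min (hδ 0) (hδ 1)
  have hτi : ∀ i, τ ≤ δ i := by
    intro i
    fin_cases i
    · exact min_le_left _ _
    · exact min_le_right _ _
  choose C hC0 hC using fun i => exists_bound_of_isPeriodic (hv' i) (hvp' i)
  -- At the maximum `k ‖x - y‖ ≤ R < k τ`, so the points are within the modulus `τ`.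
  set k := (R + 1) / τ with hk
  have hk0 : 0 < k := by positivity
  -- The penalty at distance `s` equals `2 (C 0 + C 1)`, which dominates the oscillation of `v'`;
  -- larger offsets cannot beat a zero offset.
  set s := √(2 * (C 0 + C 1) / k) with hs
  have hCsum : 0 ≤ C 0 + C 1 := add_nonneg (hC0 0) (hC0 1)
  have hs2 : k * s ^ 2 = 2 * (C 0 + C 1) := by
    rw [hs, Real.sq_sqrt (by positivity)]
    field_simp
  have hCi : ∀ i, C i ≤ C 0 + C 1 := by
    intro i
    fin_cases i
    · exact le_add_of_nonneg_right (hC0 1)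
    · exact le_add_of_nonneg_left (hC0 0)
  -- The second variable is the offset `y - x`, so a lattice translation acts on the first variable
  -- alone.
  let F : Fin 2 → E n × E n → ℝ := fun i q => v i q.1 - v' i (q.1 + q.2) - k * ‖q.2‖ ^ 2
  have hF : ∀ i, Continuous (F i) := by
    intro i
    have h1 := hv i
    have h2 := hv' i
    fun_prop
  obtain ⟨i, q, hq, hmax⟩ := exists_max_fin_two
    ((isCompact_closedBall (0 : E n) (√n)).prod (isCompact_closedBall (0 : E n) s))
    ⟨(0, 0), by simp [hs]⟩ fun i => (hF i).upperSemicontinuous.upperSemicontinuousOn _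
  have hglob : ∀ j x y, v j x - v' j y - k * ‖x - y‖ ^ 2 ≤ F i q := by
    intro j x y
    obtain ⟨z, hz⟩ := exists_lattice_translate_norm_le x
    have hx : v j x = v j (x + latticePoint z) := (hvp j x z).symm
    have hy : v' j y = v' j (x + latticePoint z + (y - x)) := by
      rw [← hvp' j y z]
      congr 1
      abel
    rw [hx, hy, norm_sub_rev x y]
    by_cases hys : ‖y - x‖ ≤ s
    · exact hmax j (x + latticePoint z, y - x) (by simpa using ⟨hz, hys⟩)
    · have h0 : F j (x + latticePoint z, 0) ≤ F i q :=
        hmax j (x + latticePoint z, 0) (by simpa using ⟨hz, Real.sqrt_nonneg _⟩)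
      simp only [F, add_zero, norm_zero, ne_eq, OfNat.ofNat_ne_zero, not_false_eq_true, zero_pow,
        mul_zero, sub_zero] at h0
      have h1 : s ^ 2 ≤ ‖y - x‖ ^ 2 := pow_le_pow_left₀ (Real.sqrt_nonneg _) (not_le.1 hys).le 2
      have h2 := mul_le_mul_of_nonneg_left h1 hk0.le
      have h3 := abs_le.1 (hC j (x + latticePoint z))
      have h4 := abs_le.1 (hC j (x + latticePoint z + (y - x)))
      simp only [F] at h0 ⊢
      linarith [h3.2, h4.1, hCi j]
  set x := q.1 with hx
  set y := q.1 + q.2 with hy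
  have hFq : F i q = v i x - v' i y - k * ‖x - y‖ ^ 2 := by
    have : ‖x - y‖ = ‖q.2‖ := by
      rw [hx, hy, norm_sub_rev]
      simp
    rw [this]
  rw [hFq] at hglob
  have h1 := hsub i (fun z => k * ‖z - y‖ ^ 2) (contDiff_const.mul (contDiff_normSq_sub y)) x
    (Eventually.of_forall fun z => by
      have := hglob i z y
      simp only
      linarith)
  rw [(hasGradientAt_const_mul k (hasGradientAt_normSq_sub y x)).gradient] at h1
  have h2 := hsuper i (fun z => -(k * ‖z - x‖ ^ 2))
    (contDiff_const.mul (contDiff_normSq_sub x)).neg y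
    (Eventually.of_forall fun z => by
      have := hglob i x z
      simp only
      rw [norm_sub_rev z x, norm_sub_rev y x]
      linarith)
  rw [(hasGradientAt_neg (hasGradientAt_const_mul k (hasGradientAt_normSq_sub x y))).gradient,
    show -(k • (2 : ℝ) • (y - x)) = k • (2 : ℝ) • (x - y) by
      rw [← smul_neg, ← smul_neg, neg_sub]] at h2
  -- Comparing the maximum with the pair `(y, y)` cancels `v'` and leaves an increment of `v`.
  have hkR : k * ‖x - y‖ ≤ R := by
    have h3 := hglob i y y
    have h4 := hvL i y x
    simp only [sub_self, norm_zero, ne_eq, OfNat.ofNat_ne_zero, not_false_eq_true, zero_pow,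
      mul_zero, sub_zero] at h3
    rcases (norm_nonneg (x - y)).eq_or_lt with h0 | h0
    · rw [← h0, mul_zero]; exact hR
    · refine le_of_mul_le_mul_right ?_ h0
      linarith [sq ‖x - y‖]
  have hp : ‖k • (2 : ℝ) • (x - y)‖ ≤ 2 * R := by
    rw [norm_smul, norm_smul, Real.norm_eq_abs, Real.norm_eq_abs, abs_of_pos hk0,
      abs_of_pos two_pos]
    linarith
  have hxy : ‖y - x‖ ≤ δ i := by
    refine le_trans ?_ (hτi i)
    rw [norm_sub_rev]
    refine le_of_mul_le_mul_left ?_ hk0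
    have : k * τ = R + 1 := by rw [hk]; field_simp
    linarith
  have h5 := abs_le.1 (hmod i y x _ (k • (2 : ℝ) • (x - y)) hp hxy (by simpa using (hδ i).le))
  -- The other index at the same pair: the subsolution's coupling is at least the supersolution's.
  have h6 := hglob i.rev x y
  linarith [h5.2]

/-- A step `-t g` against the gradient `g` lowers `φ` by about `t ‖g‖²`, while the hypothesis allows
only `R t ‖g‖`. -/
theorem norm_gradient_le_of_eventually_sub_le {n : ℕ} {φ : E n → ℝ} {x : E n} {R : ℝ}
    (hφ : DifferentiableAt ℝ φ x) (hR : 0 ≤ R) (h : ∀ᶠ y in 𝓝 x, φ x - φ y ≤ R * ‖y - x‖) :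
    ‖gradient φ x‖ ≤ R := by
  refine le_of_forall_pos_le_add fun η hη => ?_
  set g := gradient φ x with hg
  rcases (norm_nonneg g).eq_or_lt with h0 | h0
  · rw [← h0]; linarith
  have hlit := (hasGradientAt_iff_hasFDerivAt.1 hφ.hasGradientAt).isLittleO.def hη
  have htend : Tendsto (fun t : ℝ => x - t • g) (𝓝[>] 0) (𝓝 x) := by
    have : Continuous fun t : ℝ => x - t • g := by fun_prop
    have h := this.tendsto 0
    rw [zero_smul, sub_zero] at h
    exact h.mono_left nhdsWithin_le_nhds
  obtain ⟨t, ⟨h1, h2⟩, ht⟩ := ((htend.eventually (h.and hlit)).and self_mem_nhdsWithin).exists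
  have ht : 0 < t := ht
  have e1 : x - t • g - x = -(t • g) := by abel
  rw [e1, norm_neg, norm_smul, Real.norm_eq_abs, abs_of_pos ht] at h1
  rw [e1, norm_neg, norm_smul, Real.norm_eq_abs, Real.norm_eq_abs, abs_of_pos ht] at h2
  have e2 : (InnerProductSpace.toDual ℝ (E n)) g (-(t • g)) = -(t * ‖g‖ ^ 2) := by
    rw [InnerProductSpace.toDual_apply_apply, inner_neg_right, inner_smul_right,
      real_inner_self_eq_norm_sq]
  rw [e2] at h2
  have h3 := (abs_le.1 h2).2
  have h4 : t * ‖g‖ * ‖g‖ ≤ t * ‖g‖ * (R + η) := by nlinarith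
  exact le_of_mul_le_mul_left h4 (by positivity)

/-- The Hamiltonian `H_i(ξ, P + p)` of the cell problem at `P`. -/
def shiftHam {n : ℕ} (H : Fin 2 → E n → E n → ℝ) (P : E n) : Fin 2 → E n → E n → ℝ :=
  fun i ξ p => H i ξ (P + p)

theorem isCellSolution_iff {n : ℕ} {H : Fin 2 → E n → E n → ℝ} {P : E n} {c : ℝ}
    {v : Fin 2 → E n → ℝ} : IsCellSolution H P c v ↔ (∀ i, Continuous (v i)) ∧
      (∀ i, IsPeriodic (v i)) ∧ IsDiscSub (shiftHam H P) 0 c v ∧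
      IsDiscSuper (shiftHam H P) 0 c v := by
  constructor
  · intro h
    refine ⟨h.continuous, h.periodic, fun i φ hφ ξ hm => ?_, fun i φ hφ ξ hm => ?_⟩
    · simpa [shiftHam] using h.subsolution i φ hφ ξ hm
    · simpa [shiftHam] using h.supersolution i φ hφ ξ hm
  · rintro ⟨h1, h2, h3, h4⟩
    refine ⟨h1, h2, fun i φ hφ ξ hm => ?_, fun i φ hφ ξ hm => ?_⟩
    · simpa [shiftHam] using h3 i φ hφ ξ hm
    · simpa [shiftHam] using h4 i φ hφ ξ hm

section Effective

variable {n : ℕ} {H : Fin 2 → E n → E n → ℝ}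

theorem continuous_shiftHam (hH : ∀ i, Continuous fun q : E n × E n => H i q.1 q.2) (P : E n)
    (i : Fin 2) : Continuous fun q : E n × E n => shiftHam H P i q.1 q.2 :=
  (hH i).comp (continuous_fst.prodMk (continuous_const.add continuous_snd))

theorem isUniformlyCoercive_shiftHam (hcoer : ∀ i, IsUniformlyCoercive (H i)) (P : E n)
    (i : Fin 2) : IsUniformlyCoercive (shiftHam H P i) := by
  intro M
  obtain ⟨r, hr⟩ := hcoer i M
  refine ⟨r + ‖P‖, fun ξ p hp => hr ξ (P + p) ?_⟩
  have := norm_sub_norm_le p (-P)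
  rw [norm_neg, sub_neg_eq_add, add_comm p P] at this
  linarith

/-- Subsolutions of the cell problem are Lipschitz. -/
theorem exists_lipschitz_of_cell {G : Fin 2 → E n → E n → ℝ}
    (hG : ∀ i, Continuous fun q : E n × E n => G i q.1 q.2)
    (hper : ∀ i p, IsPeriodic fun ξ => G i ξ p) (hcoer : ∀ i, IsUniformlyCoercive (G i))
    {c : ℝ} {v : Fin 2 → E n → ℝ} (hv : ∀ i, Continuous (v i)) (hvp : ∀ i, IsPeriodic (v i))
    (hsub : IsDiscSub G 0 c v) : ∃ R, 0 ≤ R ∧ ∀ i x y, v i y - v i x ≤ R * ‖y - x‖ := by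
  choose b hb0 hb using fun i => exists_lower_bound_of_coercive (hG i) (hper i) (hcoer i)
  choose C hC0 hC using fun i => exists_bound_of_isPeriodic (hv i) (hvp i)
  have hbM : ∀ i ξ p, -(b 0 + b 1) ≤ G i ξ p := by
    intro i ξ p
    have h0 := hb0 0
    have h1 := hb0 1
    have h2 := hb i ξ p
    fin_cases i
    · simp only [Fin.zero_eta] at h2 ⊢; linarith
    · simp only [Fin.mk_one] at h2 ⊢; linarith
  have hCM : ∀ i ξ, |v i ξ| ≤ C 0 + C 1 := by
    intro i ξ
    have h0 := hC0 0
    have h1 := hC0 1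
    have h2 := hC i ξ
    fin_cases i
    · simp only [Fin.zero_eta] at h2 ⊢; linarith
    · simp only [Fin.mk_one] at h2 ⊢; linarith
  obtain ⟨R, hR0, hR⟩ := exists_radius_of_coercive hcoer (2 * c + (b 0 + b 1) + 1)
  exact ⟨R, hR0, hsub.lipschitz hv (fun i ξ => by simp) hbM hCM hR0 hR⟩

theorem isCellConstant_effectiveHamiltonian
    (hH : ∀ i, Continuous fun q : E n × E n => H i q.1 q.2)
    (hper : ∀ i p, IsPeriodic fun ξ => H i ξ p) (hcoer : ∀ i, IsUniformlyCoercive (H i))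
    (P : E n) : IsCellConstant H P (effectiveHamiltonian H P) := by
  obtain ⟨c, v, h1, h2, h3, h4⟩ := exists_ergodic_solution (continuous_shiftHam hH P)
    (fun i p => hper i (P + p)) (isUniformlyCoercive_shiftHam hcoer P)
  exact Classical.epsilon_spec (p := IsCellConstant H P)
    ⟨c, v, isCellSolution_iff.2 ⟨h1, h2, h3, h4⟩⟩

theorem isCellConstant_iff (hH : ∀ i, Continuous fun q : E n × E n => H i q.1 q.2)
    (hper : ∀ i p, IsPeriodic fun ξ => H i ξ p) (hcoer : ∀ i, IsUniformlyCoercive (H i))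
    (P : E n) (c : ℝ) : IsCellConstant H P c ↔ c = effectiveHamiltonian H P := by
  have key : ∀ c c', IsCellConstant H P c → IsCellConstant H P c' → c' ≤ c := by
    rintro c c' ⟨v, hv⟩ ⟨v', hv'⟩
    obtain ⟨h1, h2, h3, -⟩ := isCellSolution_iff.1 hv
    obtain ⟨h1', h2', -, h4'⟩ := isCellSolution_iff.1 hv'
    obtain ⟨R, hR0, hR⟩ := exists_lipschitz_of_cell (continuous_shiftHam hH P)
      (fun i p => hper i (P + p)) (isUniformlyCoercive_shiftHam hcoer P) h1 h2 h3
    exact cell_comparison (continuous_shiftHam hH P) (fun i p => hper i (P + p)) hR0 h1 h2 hR h3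
      h1' h2' h4'
  have hex := isCellConstant_effectiveHamiltonian hH hper hcoer P
  constructor
  · intro h
    exact le_antisymm (key _ _ hex h) (key _ _ h hex)
  · rintro rfl
    exact hex

/-- A cell solution at `P₀` is Lipschitz, so only bounded momenta occur where it is touched, and for
nearby `P` it solves the cell problem up to `η / 2` in the constant. Comparison with a solution at
`P`, in both directions, finishes. -/
theorem continuous_effectiveHamiltonian
    (hH : ∀ i, Continuous fun q : E n × E n => H i q.1 q.2)
    (hper : ∀ i p, IsPeriodic fun ξ => H i ξ p) (hcoer : ∀ i, IsUniformlyCoercive (H i)) :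
    Continuous (effectiveHamiltonian H) := by
  rw [Metric.continuous_iff]
  intro P₀ η hη
  obtain ⟨v, hv⟩ := isCellConstant_effectiveHamiltonian hH hper hcoer P₀
  obtain ⟨h1, h2, h3, h4⟩ := isCellSolution_iff.1 hv
  obtain ⟨R, hR0, hR⟩ := exists_lipschitz_of_cell (continuous_shiftHam hH P₀)
    (fun i p => hper i (P₀ + p)) (isUniformlyCoercive_shiftHam hcoer P₀) h1 h2 h3
  choose δ hδ hmod using fun i => exists_modulus_of_periodic (hH i) (hper i) (‖P₀‖ + R)
    (half_pos hη)
  refine ⟨min (δ 0) (δ 1), lt_min (hδ 0) (hδ 1), fun P hP => ?_⟩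
  have hPi : ∀ i, ‖P₀ - P‖ ≤ δ i := by
    intro i
    rw [norm_sub_rev, ← dist_eq_norm]
    refine hP.le.trans ?_
    fin_cases i
    · exact min_le_left _ _
    · exact min_le_right _ _
  have hnear : ∀ i ξ p, ‖p‖ ≤ R → |H i ξ (P₀ + p) - H i ξ (P + p)| ≤ η / 2 := by
    intro i ξ p hp
    refine hmod i ξ ξ _ _ ((norm_add_le _ _).trans (by linarith)) (by simpa using (hδ i).le) ?_
    rw [add_sub_add_right_eq_sub]
    exact hPi i
  have hsub : IsDiscSub (shiftHam H P) 0 (effectiveHamiltonian H P₀ + η / 2) v := by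
    intro i φ hφ ξ hmax
    have hg : ‖gradient φ ξ‖ ≤ R := by
      refine norm_gradient_le_of_eventually_sub_le (hφ.differentiable one_ne_zero ξ) hR0 ?_
      filter_upwards [hmax] with y hy
      have h := hR i y ξ
      rw [norm_sub_rev] at h
      linarith
    have h5 := h3 i φ hφ ξ hmax
    have h6 := abs_le.1 (hnear i ξ _ hg)
    simp only [shiftHam] at h5 ⊢
    linarith [h6.1]
  have hsuper : IsDiscSuper (shiftHam H P) 0 (effectiveHamiltonian H P₀ - η / 2) v := by
    intro i φ hφ ξ hmin
    have hg : ‖gradient φ ξ‖ ≤ R := by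
      rw [← norm_neg, ← gradient_neg_fun]
      refine norm_gradient_le_of_eventually_sub_le (hφ.differentiable one_ne_zero ξ).neg hR0 ?_
      filter_upwards [hmin] with y hy
      have h := hR i ξ y
      linarith
    have h5 := h4 i φ hφ ξ hmin
    have h6 := abs_le.1 (hnear i ξ _ hg)
    simp only [shiftHam] at h5 ⊢
    linarith [h6.2]
  obtain ⟨v', hv'⟩ := isCellConstant_effectiveHamiltonian hH hper hcoer P
  obtain ⟨h1', h2', h3', h4'⟩ := isCellSolution_iff.1 hv'
  obtain ⟨R', hR0', hR'⟩ := exists_lipschitz_of_cell (continuous_shiftHam hH P)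
    (fun i p => hper i (P + p)) (isUniformlyCoercive_shiftHam hcoer P) h1' h2' h3'
  have hle := cell_comparison (continuous_shiftHam hH P) (fun i p => hper i (P + p)) hR0 h1 h2 hR
    hsub h1' h2' h4'
  have hge := cell_comparison (continuous_shiftHam hH P) (fun i p => hper i (P + p)) hR0' h1' h2'
    hR' h3' h1 h2 hsuper
  rw [Real.dist_eq, abs_lt]
  constructor <;> linarith

end Effective

/-! ### Space-time test functions -/

theorem isOpen_openCyl (n : ℕ) (T : ℝ) : IsOpen (openCyl n T) :=
  isOpen_univ.prod isOpen_Ioo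

theorem contDiff_sqrt_add_normSq_sub {n : ℕ} {r : ℝ} (hr : 0 < r) (a : E n) :
    ContDiff ℝ 1 (fun y : E n => √(r + ‖y - a‖ ^ 2)) :=
  contDiff_iff_contDiffAt.2 fun x => contDiffAt_sqrt_add_normSq_sub r a x (by positivity)

theorem norm_inv_sqrt_smul_le {n : ℕ} {r : ℝ} (hr : 0 < r) (x : E n) :
    ‖(√(r + ‖x‖ ^ 2))⁻¹ • x‖ ≤ 1 := by
  have hpos : 0 < √(r + ‖x‖ ^ 2) := Real.sqrt_pos.2 (by positivity)
  rw [norm_smul, norm_inv, Real.norm_eq_abs, abs_of_pos hpos, inv_mul_le_one₀ hpos]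
  exact Real.le_sqrt_of_sq_le (by linarith)

theorem norm_le_sqrt_add_normSq {n : ℕ} {r : ℝ} (hr : 0 ≤ r) (x : E n) :
    ‖x‖ ≤ √(r + ‖x‖ ^ 2) :=
  Real.le_sqrt_of_sq_le (by linarith)

theorem hasDerivAt_const_div_sub (κ : ℝ) {T t : ℝ} (h : t < T) :
    HasDerivAt (fun s => κ / (T - s)) (κ / (T - t) ^ 2) t := by
  have h1 : HasDerivAt (fun s : ℝ => T - s) (-1) t := by
    simpa using (hasDerivAt_id t).const_sub T
  have h2 := (h1.fun_inv (sub_ne_zero.2 h.ne')).const_mul κ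
  refine (h2.congr_deriv ?_).congr_of_eventuallyEq
    (Eventually.of_forall fun s => div_eq_mul_inv _ _)
  ring

theorem contDiffOn_const_div_sub (n : ℕ) (κ T : ℝ) :
    ContDiffOn ℝ 1 (fun z : E n × ℝ => κ / (T - z.2)) (openCyl n T) :=
  contDiffOn_const.div (contDiff_const.sub contDiff_snd).contDiffOn
    fun _ hz => sub_ne_zero.2 hz.2.2.ne'

theorem hasGradientAt_slice {n : ℕ} {T : ℝ} {φ : E n × ℝ → ℝ}
    (hφ : ContDiffOn ℝ 1 φ (openCyl n T)) {z : E n × ℝ} (hz : z ∈ openCyl n T) :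
    HasGradientAt (fun x => φ (x, z.2)) (spaceGrad φ z) z.1 := by
  have hd : DifferentiableAt ℝ φ z :=
    (hφ.differentiableOn one_ne_zero).differentiableAt ((isOpen_openCyl n T).mem_nhds hz)
  have h : DifferentiableAt ℝ (fun x => φ (x, z.2)) z.1 :=
    DifferentiableAt.comp (g := φ) (f := fun x => (x, z.2)) z.1 hd (by fun_prop)
  exact h.hasGradientAt

theorem hasDerivAt_slice {n : ℕ} {T : ℝ} {φ : E n × ℝ → ℝ}
    (hφ : ContDiffOn ℝ 1 φ (openCyl n T)) {z : E n × ℝ} (hz : z ∈ openCyl n T) :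
    HasDerivAt (fun t => φ (z.1, t)) (timeDeriv φ z) z.2 := by
  have hd : DifferentiableAt ℝ φ z :=
    (hφ.differentiableOn one_ne_zero).differentiableAt ((isOpen_openCyl n T).mem_nhds hz)
  have h : DifferentiableAt ℝ (fun t => φ (z.1, t)) z.2 :=
    DifferentiableAt.comp (g := φ) (f := fun t => (z.1, t)) z.2 hd (by fun_prop)
  exact h.hasDerivAt

theorem spaceGrad_neg {n : ℕ} (φ : E n × ℝ → ℝ) (z : E n × ℝ) :
    spaceGrad (fun w => -φ w) z = -spaceGrad φ z :=
  gradient_neg_fun _ _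

theorem timeDeriv_neg {n : ℕ} (φ : E n × ℝ → ℝ) (z : E n × ℝ) :
    timeDeriv (fun w => -φ w) z = -timeDeriv φ z :=
  deriv.fun_neg

theorem isSystemSubsolution_reflect_neg {n : ℕ} {H : Fin 2 → E n → E n → ℝ} {T ε : ℝ}
    {u : Fin 2 → E n × ℝ → ℝ} (h : IsSystemSupersolution H T ε u) :
    IsSystemSubsolution (reflect H) T ε (fun i z => -u i z) := by
  intro i φ hφ z hz hmax
  have := h i (fun w => -φ w) hφ.neg z hz (isLocalMax_neg_sub_neg.1 (by simpa using hmax))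
  rw [timeDeriv_neg, spaceGrad_neg] at this
  simp only [reflect]
  have e : (-u i z - -u i.rev z) / ε = -((u i z - u i.rev z) / ε) := by ring
  rw [e]
  linarith

/-! ### The initial layer -/

/-- The solution of `(U_i)_t + (U_i - U_j)/ε = 0` with initial data `f`. -/
def initialLayer {n : ℕ} (f : Fin 2 → E n → ℝ) (ε : ℝ) (i : Fin 2) (z : E n × ℝ) : ℝ :=
  (f i z.1 + f i.rev z.1) / 2 + (f i z.1 - f i.rev z.1) / 2 * Real.exp (-(2 / ε) * z.2)

section InitialLayer

variable {n : ℕ} {f : Fin 2 → E n → ℝ} {ε L : ℝ}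

theorem initialLayer_zero (i : Fin 2) (x : E n) : initialLayer f ε i (x, 0) = f i x := by
  simp [initialLayer]
  ring

theorem initialLayer_neg (i : Fin 2) (z : E n × ℝ) :
    initialLayer (fun i x => -f i x) ε i z = -initialLayer f ε i z := by
  simp only [initialLayer]
  ring

theorem contDiff_initialLayer (hf : ∀ i, ContDiff ℝ 1 (f i)) (i : Fin 2) :
    ContDiff ℝ 1 (initialLayer f ε i) := by
  have h1 := (hf i).comp (contDiff_fst (𝕜 := ℝ) (n := 1) (E := E n) (F := ℝ))
  have h2 := (hf i.rev).comp (contDiff_fst (𝕜 := ℝ) (n := 1) (E := E n) (F := ℝ))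
  have h3 : ContDiff ℝ 1 fun z : E n × ℝ => Real.exp (-(2 / ε) * z.2) :=
    (contDiff_const.mul contDiff_snd).exp
  exact ((h1.add h2).div_const 2).add (((h1.sub h2).div_const 2).mul h3)

/-- The layer is a convex combination of the two data, with weights `(1 ± e) / 2`; this makes the
bound independent of `ε`. -/
theorem exists_hasGradientAt_initialLayer (hf : ∀ i, ContDiff ℝ 1 (f i))
    (hL : ∀ i x, ‖gradient (f i) x‖ ≤ L) (hε : 0 < ε) (i : Fin 2) (x : E n) {t : ℝ}
    (ht : 0 ≤ t) :
    ∃ g, ‖g‖ ≤ L ∧ HasGradientAt (fun y => initialLayer f ε i (y, t)) g x := by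
  set e := Real.exp (-(2 / ε) * t) with he
  have he0 : 0 < e := Real.exp_pos _
  have he1 : e ≤ 1 := by
    rw [he, Real.exp_le_one_iff]
    have : 0 < 2 / ε := by positivity
    nlinarith
  refine ⟨((1 + e) / 2) • gradient (f i) x + ((1 - e) / 2) • gradient (f i.rev) x, ?_, ?_⟩
  · refine (norm_add_le _ _).trans ?_
    rw [norm_smul, norm_smul, Real.norm_eq_abs, Real.norm_eq_abs,
      abs_of_nonneg (by linarith : 0 ≤ (1 + e) / 2), abs_of_nonneg (by linarith : 0 ≤ (1 - e) / 2)]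
    nlinarith [hL i x, hL i.rev x]
  · convert hasGradientAt_add
      (hasGradientAt_const_mul ((1 + e) / 2) (hasGradientAt_of_contDiff (hf i) x))
      (hasGradientAt_const_mul ((1 - e) / 2) (hasGradientAt_of_contDiff (hf i.rev) x)) using 2
    simp only [initialLayer, ← he]
    ring

theorem hasDerivAt_initialLayer (i : Fin 2) (x : E n) (t : ℝ) :
    HasDerivAt (fun s => initialLayer f ε i (x, s))
      (-((initialLayer f ε i (x, t) - initialLayer f ε i.rev (x, t)) / ε)) t := by
  have h1 : HasDerivAt (fun s : ℝ => -(2 / ε) * s) (-(2 / ε)) t := by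
    simpa using (hasDerivAt_id t).const_mul (-(2 / ε))
  have h2 := (h1.exp.const_mul ((f i x - f i.rev x) / 2)).const_add ((f i x + f i.rev x) / 2)
  refine h2.congr_deriv ?_
  simp only [initialLayer, Fin.rev_rev]
  ring

theorem abs_sub_le_of_gradient_le {g : E n → ℝ} (hg : ContDiff ℝ 1 g)
    (hL : ∀ x, ‖gradient g x‖ ≤ L) (x y : E n) : |g x - g y| ≤ L * ‖x - y‖ := by
  have h := (convex_univ (𝕜 := ℝ) (E := E n)).norm_image_sub_le_of_norm_fderiv_le
    (f := g) (C := L) (fun z _ => hg.differentiable one_ne_zero z) (fun z _ => by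
      rw [← toDual_gradient, LinearIsometryEquiv.norm_map]
      exact hL z) (mem_univ y) (mem_univ x)
  simpa using h

/-- A subsolution stays below the initial layer plus a smooth penalty, provided it does so at
spatial infinity. -/
theorem le_initialLayer_add_penalty {K : Fin 2 → E n → E n → ℝ} {T A B C a : ℝ}
    {u : Fin 2 → E n × ℝ → ℝ} (hε : 0 < ε)
    (hf : ∀ i, ContDiff ℝ 1 (f i)) (hL : ∀ i x, ‖gradient (f i) x‖ ≤ L)
    (hu : ∀ i, ContinuousOn (u i) (closedCyl n T)) (hsub : IsSystemSubsolution K T ε u)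
    (hzero : ∀ i x, u i (x, 0) ≤ f i x) (ha : 0 ≤ a) (haA : a < A) (hB0 : 0 ≤ B)
    (hgrow : ∀ i x t, 0 ≤ t → t < T → u i (x, t) - initialLayer f ε i (x, t) ≤ C + a * ‖x‖)
    (hB : ∀ i ξ p, ‖p‖ ≤ L + A → -B ≤ K i ξ p) (x₀ : E n) (i₁ : Fin 2) (x₁ : E n) {t₁ : ℝ}
    (ht₁ : 0 ≤ t₁) (ht₁T : t₁ < T) :
    u i₁ (x₁, t₁) ≤ initialLayer f ε i₁ (x₁, t₁) + A * √(1 + ‖x₁ - x₀‖ ^ 2) + B * t₁ := by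
  by_contra! hcon
  have hT : 0 < T := ht₁.trans_lt ht₁T
  have hA : 0 < A := ha.trans_lt haA
  obtain ⟨Θ, hΘ⟩ : ∃ Θ, Θ = u i₁ (x₁, t₁) -
      (initialLayer f ε i₁ (x₁, t₁) + A * √(1 + ‖x₁ - x₀‖ ^ 2) + B * t₁) := ⟨_, rfl⟩
  have hΘ0 : 0 < Θ := by linarith
  -- The terms with `η` and `κ` each use at most a quarter of the assumed excess `Θ` at `(x₁, t₁)`.
  -- The first makes the inequality strict, the second keeps the maximum away from `t = T`.
  set η := Θ / (4 * T) with hη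
  have hη0 : 0 < η := by positivity
  set κ := Θ * (T - t₁) / 4 with hκ
  have hTt : 0 < T - t₁ := by linarith
  have hκ0 : 0 < κ := by positivity
  let ψ : Fin 2 → E n × ℝ → ℝ := fun i z => initialLayer f ε i z +
    A * √(1 + ‖z.1 - x₀‖ ^ 2) + (B + η) * z.2 + κ / (T - z.2)
  have hval : 0 < u i₁ (x₁, t₁) - ψ i₁ (x₁, t₁) := by
    have e1 : κ / (T - t₁) = Θ / 4 := by rw [hκ]; field_simp
    have e2 : η * t₁ ≤ Θ / 4 := by
      have : η * T = Θ / 4 := by rw [hη]; field_simp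
      nlinarith
    simp only [ψ]
    rw [e1]
    linarith
  set D := max (C + A * ‖x₀‖) 0 with hD
  have hD0 : 0 ≤ D := le_max_right _ _
  set ρ := D / (A - a) with hρ
  set τ := κ / (D + 1) with hτ
  have hτ0 : 0 < τ := by positivity
  have hupper : ∀ i x t, 0 ≤ t → t < T →
      u i (x, t) - ψ i (x, t) ≤ D - (A - a) * ‖x‖ - κ / (T - t) := by
    intro i x t h0 hT
    have h1 := hgrow i x t h0 hT
    have h2 := norm_le_sqrt_add_normSq zero_le_one (x - x₀)
    have h3 := norm_sub_norm_le x x₀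
    have h4 : A * (‖x‖ - ‖x₀‖) ≤ A * √(1 + ‖x - x₀‖ ^ 2) :=
      mul_le_mul_of_nonneg_left (h3.trans h2) hA.le
    have h5 : C + A * ‖x₀‖ ≤ D := le_max_left _ _
    have h6 : 0 ≤ (B + η) * t := by positivity
    simp only [ψ]
    linarith
  -- Outside `S` either the spatial penalty or `κ / (T - t)` outweighs `D`, so a positive maximum is
  -- attained inside.
  let S : Set (E n × ℝ) := Metric.closedBall 0 ρ ×ˢ Icc 0 (T - τ)
  have hout : ∀ i x t, 0 ≤ t → t < T → (x, t) ∉ S → u i (x, t) - ψ i (x, t) ≤ 0 := by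
    intro i x t h0 hT hS
    have h1 := hupper i x t h0 hT
    have hpos : 0 < κ / (T - t) := div_pos hκ0 (by linarith)
    by_cases hx : ‖x‖ ≤ ρ
    · have ht : T - τ < t := by
        by_contra! h
        exact hS ⟨by simpa using hx, h0, h⟩
      have h2 : D + 1 ≤ κ / (T - t) := by
        rw [le_div_iff₀ (by linarith)]
        have : (D + 1) * τ = κ := by rw [hτ]; field_simp
        nlinarith
      nlinarith [norm_nonneg x]
    · have h2 : D ≤ (A - a) * ‖x‖ := by
        have : (A - a) * ρ = D := by
          rw [hρ]
          field_simp [(sub_pos.2 haA).ne']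
        nlinarith
      linarith
  have hx₁S : (x₁, t₁) ∈ S := by
    by_contra h
    linarith [hout i₁ x₁ t₁ ht₁ ht₁T h]
  have hSsub : ∀ z ∈ S, 0 ≤ z.2 ∧ z.2 < T := fun z hz => ⟨hz.2.1, by linarith [hz.2.2]⟩
  have hψc : ∀ i, ContinuousOn (ψ i) S := by
    intro i
    have h1 := (contDiff_initialLayer (ε := ε) hf i).continuous
    have h2 : Continuous fun z : E n × ℝ => A * √(1 + ‖z.1 - x₀‖ ^ 2) := by fun_prop
    have h3 : ContinuousOn (fun z : E n × ℝ => κ / (T - z.2)) S :=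
      continuousOn_const.div (by fun_prop) fun z hz => by linarith [(hSsub z hz).2]
    exact ((h1.add h2).add (by fun_prop : Continuous fun z : E n × ℝ =>
      (B + η) * z.2)).continuousOn.add h3
  have hucS : ∀ i, ContinuousOn (u i) S := fun i => (hu i).mono fun z hz =>
    ⟨mem_univ _, (hSsub z hz).1, (hSsub z hz).2.le⟩
  obtain ⟨i, z, hzS, hmax⟩ := exists_max_fin_two (F := fun i z => u i z - ψ i z)
    ((isCompact_closedBall (0 : E n) ρ).prod isCompact_Icc) ⟨_, hx₁S⟩
    fun i => ((hucS i).sub (hψc i)).upperSemicontinuousOn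
  obtain ⟨x, t⟩ := z
  have hzpos : 0 < u i (x, t) - ψ i (x, t) := hval.trans_le (hmax i₁ _ hx₁S)
  have ht0 : 0 < t := by
    refine lt_of_le_of_ne (hSsub _ hzS).1 fun h => ?_
    rw [← h] at hzpos
    simp only [ψ, initialLayer_zero] at hzpos
    have h1 := hzero i x
    have h2 : 0 < κ / (T - 0) := by rw [sub_zero]; positivity
    have h3 : 0 ≤ A * √(1 + ‖x - x₀‖ ^ 2) := by positivity
    linarith
  have htT : t < T := (hSsub _ hzS).2
  have hmem : (x, t) ∈ openCyl n T := ⟨mem_univ _, ht0, htT⟩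
  have hglob : ∀ j, ∀ w ∈ openCyl n T, u j w - ψ j w ≤ u i (x, t) - ψ i (x, t) := by
    rintro j ⟨y, s⟩ hw
    by_cases hwS : (y, s) ∈ S
    · exact hmax j _ hwS
    · exact (hout j y s hw.2.1.le hw.2.2 hwS).trans hzpos.le
  have hψd : ContDiffOn ℝ 1 (ψ i) (openCyl n T) := by
    have h1 : ContDiff ℝ 1 fun z : E n × ℝ => A * √(1 + ‖z.1 - x₀‖ ^ 2) :=
      contDiff_const.mul ((contDiff_sqrt_add_normSq_sub one_pos x₀).comp contDiff_fst)
    exact (((contDiff_initialLayer hf i).add h1).add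
      (contDiff_const.mul contDiff_snd)).contDiffOn.add (contDiffOn_const_div_sub n κ T)
  have hvisc := hsub i (ψ i) hψd (x, t) hmem
    (mem_of_superset ((isOpen_openCyl n T).mem_nhds hmem) fun w hw => hglob i w hw)
  obtain ⟨g, hgL, hg⟩ := exists_hasGradientAt_initialLayer hf hL hε i x ht0.le
  have hsg : spaceGrad (ψ i) (x, t) = g + A • ((√(1 + ‖x - x₀‖ ^ 2))⁻¹ • (x - x₀)) :=
    (hasGradientAt_add_const (hasGradientAt_add_const (hasGradientAt_add hg
      (hasGradientAt_const_mul A (hasGradientAt_sqrt_add_normSq_sub 1 x₀ x (by positivity))))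
      ((B + η) * t)) (κ / (T - t))).gradient
  have htd : timeDeriv (ψ i) (x, t) =
      -((initialLayer f ε i (x, t) - initialLayer f ε i.rev (x, t)) / ε) + (B + η) +
        κ / (T - t) ^ 2 := by
    have h1 : HasDerivAt (fun s : ℝ => (B + η) * s) (B + η) t := by
      simpa using (hasDerivAt_id t).const_mul (B + η)
    exact ((((hasDerivAt_initialLayer i x t).add_const (A * √(1 + ‖x - x₀‖ ^ 2))).add h1).add
      (hasDerivAt_const_div_sub κ htT)).deriv
  have hnorm : ‖spaceGrad (ψ i) (x, t)‖ ≤ L + A := by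
    rw [hsg]
    refine (norm_add_le _ _).trans (add_le_add hgL ?_)
    rw [norm_smul, Real.norm_eq_abs, abs_of_pos hA]
    have := norm_inv_sqrt_smul_le one_pos (x - x₀)
    nlinarith
  have hK := hB i (ε⁻¹ • x) _ hnorm
  rw [htd] at hvisc
  have hrev := hglob i.rev (x, t) hmem
  -- Maximality over the index: the coupling of `u` dominates that of the layer, which is exactly
  -- cancelled by the layer's time derivative.
  have hcoup : (initialLayer f ε i (x, t) - initialLayer f ε i.rev (x, t)) / ε ≤
      (u i (x, t) - u i.rev (x, t)) / ε := by
    refine div_le_div_of_nonneg_right ?_ hε.le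
    simp only [ψ] at hrev
    linarith
  have hpos : 0 ≤ κ / (T - t) ^ 2 := by positivity
  simp only at hvisc
  linarith

/-- Upper barrier for subsolutions of linear growth. -/
theorem le_initialLayer_add {K : Fin 2 → E n → E n → ℝ} {T B : ℝ}
    {u : Fin 2 → E n × ℝ → ℝ} (hε : 0 < ε)
    (hK : ∀ i, Continuous fun q : E n × E n => K i q.1 q.2)
    (hper : ∀ i p, IsPeriodic fun ξ => K i ξ p)
    (hf : ∀ i, ContDiff ℝ 1 (f i)) (hL : ∀ i x, ‖gradient (f i) x‖ ≤ L)
    (hu : ∀ i, ContinuousOn (u i) (closedCyl n T)) (hsub : IsSystemSubsolution K T ε u)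
    (hzero : ∀ i x, u i (x, 0) ≤ f i x) (hgrow : ∀ i, HasLinearGrowth T (u i)) (hB0 : 0 ≤ B)
    (hB : ∀ i ξ p, ‖p‖ ≤ L + 1 → -B ≤ K i ξ p) (i : Fin 2) (x : E n) {t : ℝ}
    (ht : 0 ≤ t) (htT : t < T) :
    u i (x, t) ≤ initialLayer f ε i (x, t) + B * t := by
  have hT : 0 < T := ht.trans_lt htT
  have hL0 : 0 ≤ L := (norm_nonneg _).trans (hL 0 0)
  choose c hc using hgrow
  -- crude bound
  have hlay : ∀ i x t, 0 ≤ t → -initialLayer f ε i (x, t) ≤ |f 0 0| + |f 1 0| + L * ‖x‖ := by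
    intro i x t h0
    have he0 : 0 < Real.exp (-(2 / ε) * t) := Real.exp_pos _
    have he1 : Real.exp (-(2 / ε) * t) ≤ 1 := by
      rw [Real.exp_le_one_iff]
      have : 0 < 2 / ε := by positivity
      nlinarith
    have hfb : ∀ j, -(f j x) ≤ |f 0 0| + |f 1 0| + L * ‖x‖ := by
      intro j
      have h1 := (abs_le.1 (abs_sub_le_of_gradient_le (hf j) (hL j) x 0)).1
      rw [sub_zero] at h1
      have h2 := neg_abs_le (f j 0)
      have h3 := abs_nonneg (f 0 0)
      have h4 := abs_nonneg (f 1 0)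
      fin_cases j
      · simp only [Fin.zero_eta] at *; linarith
      · simp only [Fin.mk_one] at *; linarith
    have h1 := hfb i
    have h2 := hfb i.rev
    simp only [initialLayer]
    nlinarith
  set a := |c 0| + |c 1| + L with ha
  have ha0 : 0 ≤ a := by positivity
  have hg1 : ∀ i x t, 0 ≤ t → t < T → u i (x, t) - initialLayer f ε i (x, t) ≤
      (|f 0 0| + |f 1 0| + |c 0| + |c 1|) + a * ‖x‖ := by
    intro i x t h0 h1
    have h2 := (abs_le.1 (hc i (x, t) ⟨mem_univ _, h0, h1.le⟩)).2
    have h3 := hlay i x t h0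
    have h4 : c i ≤ |c 0| + |c 1| := by
      have h5 := le_abs_self (c i)
      have h6 := abs_nonneg (c 0)
      have h7 := abs_nonneg (c 1)
      fin_cases i
      · simp only [Fin.zero_eta] at *; linarith
      · simp only [Fin.mk_one] at *; linarith
    have h5 : c i * (1 + ‖x‖) ≤ (|c 0| + |c 1|) * (1 + ‖x‖) :=
      mul_le_mul_of_nonneg_right h4 (by positivity)
    simp only at h2
    rw [ha]
    linarith
  choose b hb0 hb using fun i => exists_bound_of_periodic (hK i) (hper i) (L + (a + 1))
  have hbK : ∀ i ξ p, ‖p‖ ≤ L + (a + 1) → -(b 0 + b 1) ≤ K i ξ p := by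
    intro i ξ p hp
    have h1 := (abs_le.1 (hb i ξ p hp)).1
    have h2 := hb0 0
    have h3 := hb0 1
    fin_cases i
    · simp only [Fin.zero_eta] at *; linarith
    · simp only [Fin.mk_one] at *; linarith
  have hbs : 0 ≤ b 0 + b 1 := add_nonneg (hb0 0) (hb0 1)
  -- First pass: a penalty steeper than the linear growth, centred at `x` itself, shows that the
  -- excess over the layer is bounded. The constants may still depend on `ε` through the growth of
  -- `u`.
  have hg2 : ∀ i x t, 0 ≤ t → t < T → u i (x, t) - initialLayer f ε i (x, t) ≤
      (a + 1 + (b 0 + b 1) * T) + 0 * ‖x‖ := by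
    intro i x t h0 h1
    have h := le_initialLayer_add_penalty hε hf hL hu hsub hzero ha0 (lt_add_one a) hbs hg1 hbK
      x i x h0 h1
    have h2 : (b 0 + b 1) * t ≤ (b 0 + b 1) * T := mul_le_mul_of_nonneg_left h1.le hbs
    simp only [sub_self, norm_zero, ne_eq, OfNat.ofNat_ne_zero, not_false_eq_true, zero_pow,
      add_zero, Real.sqrt_one, mul_one] at h
    linarith
  refine le_of_forall_pos_le_add fun η hη => ?_
  -- Second pass: with bounded excess an arbitrarily small slope suffices. Slopes at most `1` keep
  -- the momenta in the range where `B` applies, so the growth constants disappear.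
  have h := le_initialLayer_add_penalty (A := min η 1) hε hf hL hu hsub hzero le_rfl
    (by positivity) hB0 hg2
    (fun i ξ p hp => hB i ξ p (hp.trans (add_le_add le_rfl (min_le_right _ _)))) x i x ht htT
  simp only [sub_self, norm_zero, ne_eq, OfNat.ofNat_ne_zero, not_false_eq_true, zero_pow,
    add_zero, Real.sqrt_one, mul_one] at h
  linarith [min_le_left η 1]

end InitialLayer

/-! ### Half-relaxed limits -/

/-- The upper half-relaxed limit of `max (u ε 0) (u ε 1)` as `ε → 0⁺`. -/
def upperLim {n : ℕ} (u : ℝ → Fin 2 → E n × ℝ → ℝ) (z : E n × ℝ) : ℝ :=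
  limsup (fun p : ℝ × (E n × ℝ) => max (u p.1 0 p.2) (u p.1 1 p.2)) (𝓝[>] 0 ×ˢ 𝓝 z)

/-- Boundedness of the family `u` near `z` for small `ε`. -/
def IsBoundedNear {n : ℕ} (u : ℝ → Fin 2 → E n × ℝ → ℝ) (z : E n × ℝ) : Prop :=
  ∃ C, ∀ᶠ p : ℝ × (E n × ℝ) in 𝓝[>] 0 ×ˢ 𝓝 z, ∀ i, |u p.1 i p.2| ≤ C

section UpperLim

variable {n : ℕ} {u : ℝ → Fin 2 → E n × ℝ → ℝ} {z : E n × ℝ} {a : ℝ}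

theorem IsBoundedNear.isBoundedUnder (h : IsBoundedNear u z) :
    IsBoundedUnder (· ≤ ·) (𝓝[>] (0 : ℝ) ×ˢ 𝓝 z)
      (fun p : ℝ × (E n × ℝ) => max (u p.1 0 p.2) (u p.1 1 p.2)) := by
  obtain ⟨C, hC⟩ := h
  refine ⟨C, ?_⟩
  rw [eventually_map]
  filter_upwards [hC] with p hp
  exact max_le (abs_le.1 (hp 0)).2 (abs_le.1 (hp 1)).2

theorem IsBoundedNear.isCoboundedUnder (h : IsBoundedNear u z) :
    IsCoboundedUnder (· ≤ ·) (𝓝[>] (0 : ℝ) ×ˢ 𝓝 z)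
      (fun p : ℝ × (E n × ℝ) => max (u p.1 0 p.2) (u p.1 1 p.2)) := by
  obtain ⟨C, hC⟩ := h
  refine IsBoundedUnder.isCoboundedUnder_le ⟨-C, ?_⟩
  rw [eventually_map]
  filter_upwards [hC] with p hp
  exact (abs_le.1 (hp 0)).1.trans (le_max_left _ _)

theorem eventually_lt_of_upperLim_lt (h : IsBoundedNear u z) (ha : upperLim u z < a) :
    ∀ᶠ p : ℝ × (E n × ℝ) in 𝓝[>] 0 ×ˢ 𝓝 z, ∀ i, u p.1 i p.2 < a := by
  filter_upwards [eventually_lt_of_limsup_lt ha h.isBoundedUnder] with p hp i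
  fin_cases i
  · exact (le_max_left _ _).trans_lt hp
  · exact (le_max_right _ _).trans_lt hp

theorem frequently_lt_of_lt_upperLim (h : IsBoundedNear u z) (ha : a < upperLim u z) :
    ∃ᶠ p : ℝ × (E n × ℝ) in 𝓝[>] 0 ×ˢ 𝓝 z, ∃ i, a < u p.1 i p.2 := by
  refine (frequently_lt_of_lt_limsup h.isCoboundedUnder ha).mono fun p hp => ?_
  rcases lt_max_iff.1 hp with h | h
  · exact ⟨0, h⟩
  · exact ⟨1, h⟩

theorem upperLim_le (h : IsBoundedNear u z)
    (ha : ∀ᶠ p : ℝ × (E n × ℝ) in 𝓝[>] 0 ×ˢ 𝓝 z, ∀ i, u p.1 i p.2 ≤ a) : upperLim u z ≤ a := by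
  refine limsup_le_of_le h.isCoboundedUnder ?_
  filter_upwards [ha] with p hp
  exact max_le (hp 0) (hp 1)

theorem neg_upperLim_neg_le (h : IsBoundedNear u z) (h' : IsBoundedNear (fun ε i w => -u ε i w) z) :
    -upperLim (fun ε i w => -u ε i w) z ≤ upperLim u z := by
  refine le_of_forall_pos_le_add fun η hη => ?_
  have h1 := eventually_lt_of_upperLim_lt h (lt_add_of_pos_right _ (half_pos hη))
  have h2 := eventually_lt_of_upperLim_lt h' (lt_add_of_pos_right _ (half_pos hη))
  obtain ⟨p, h3, h4⟩ := (h1.and h2).exists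
  linarith [h3 0, h4 0]

theorem IsBoundedNear.neg (h : IsBoundedNear u z) : IsBoundedNear (fun ε i w => -u ε i w) z := by
  obtain ⟨C, hC⟩ := h
  exact ⟨C, hC.mono fun p hp i => by rw [abs_neg]; exact hp i⟩

theorem eventually_prod_nhds_nhds {l : Filter ℝ} {P : ℝ × (E n × ℝ) → Prop}
    (h : ∀ᶠ p in l ×ˢ 𝓝 z, P p) : ∀ᶠ w in 𝓝 z, ∀ᶠ p in l ×ˢ 𝓝 w, P p := by
  obtain ⟨p₁, h1, p₂, h2, h3⟩ := eventually_prod_iff.1 h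
  filter_upwards [eventually_eventually_nhds.2 h2] with w hw
  exact eventually_prod_iff.2 ⟨p₁, h1, p₂, hw, h3⟩

theorem upperSemicontinuousOn_upperLim {T : ℝ} (h : ∀ z ∈ openCyl n T, IsBoundedNear u z) :
    UpperSemicontinuousOn (upperLim u) (openCyl n T) := by
  intro z hz a ha
  obtain ⟨b, hb1, hb2⟩ := exists_between ha
  have h1 := eventually_prod_nhds_nhds (eventually_lt_of_upperLim_lt (h z hz) hb1)
  filter_upwards [nhdsWithin_le_nhds h1, self_mem_nhdsWithin] with w hw hwT
  exact (upperLim_le (h w hwT) (hw.mono fun p hp i => (hp i).le)).trans_lt hb2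

end UpperLim

/-! ### The perturbed test function -/

theorem continuousOn_spaceGrad {n : ℕ} {T : ℝ} {φ : E n × ℝ → ℝ}
    (hφ : ContDiffOn ℝ 1 φ (openCyl n T)) : ContinuousOn (spaceGrad φ) (openCyl n T) := by
  have h1 := hφ.continuousOn_fderiv_of_isOpen (isOpen_openCyl n T) le_rfl
  have h2 : ContinuousOn (fun z => (InnerProductSpace.toDual ℝ (E n)).symm
      ((fderiv ℝ φ z).comp (ContinuousLinearMap.inl ℝ (E n) ℝ))) (openCyl n T) :=
    (InnerProductSpace.toDual ℝ (E n)).symm.continuous.comp_continuousOn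
      (h1.clm_comp continuousOn_const)
  refine h2.congr fun z hz => ?_
  have hd : DifferentiableAt ℝ φ z :=
    (hφ.differentiableOn one_ne_zero).differentiableAt ((isOpen_openCyl n T).mem_nhds hz)
  have h3 : HasFDerivAt (fun x => φ (x, z.2))
      ((fderiv ℝ φ z).comp (ContinuousLinearMap.inl ℝ (E n) ℝ)) z.1 :=
    HasFDerivAt.comp (g := φ) (f := fun x => (x, z.2)) z.1 hd.hasFDerivAt
      (hasFDerivAt_prodMk_left z.1 z.2)
  simp only [spaceGrad, gradient_eq_toDual_symm]
  rw [h3.fderiv]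

theorem continuousOn_timeDeriv {n : ℕ} {T : ℝ} {φ : E n × ℝ → ℝ}
    (hφ : ContDiffOn ℝ 1 φ (openCyl n T)) : ContinuousOn (timeDeriv φ) (openCyl n T) := by
  have h1 := hφ.continuousOn_fderiv_of_isOpen (isOpen_openCyl n T) le_rfl
  have h2 : ContinuousOn (fun z => fderiv ℝ φ z (0, 1)) (openCyl n T) :=
    h1.clm_apply continuousOn_const
  refine h2.congr fun z hz => ?_
  have hd : DifferentiableAt ℝ φ z :=
    (hφ.differentiableOn one_ne_zero).differentiableAt ((isOpen_openCyl n T).mem_nhds hz)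
  have h3 : HasFDerivAt (fun t => φ (z.1, t))
      ((fderiv ℝ φ z).comp (ContinuousLinearMap.inr ℝ (E n) ℝ)) z.2 :=
    HasFDerivAt.comp (g := φ) (f := fun t => (z.1, t)) z.2 hd.hasFDerivAt
      (hasFDerivAt_prodMk_right z.1 z.2)
  simp only [timeDeriv]
  rw [← fderiv_apply_one_eq_deriv, h3.fderiv]
  simp

/-- Comparison, near a point, of a subsolution of the oscillating system with a test function
perturbed by a Lipschitz supersolution of the cell problem. -/
theorem exists_perturbed_touching {n : ℕ} {K : Fin 2 → E n → E n → ℝ} {T ε c R V r : ℝ}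
    {u : Fin 2 → E n × ℝ → ℝ} (hε : 0 < ε) (hu : ∀ i, ContinuousOn (u i) (closedCyl n T))
    (hsub : IsSystemSubsolution K T ε u) {φ : E n × ℝ → ℝ} (hφ : ContDiffOn ℝ 1 φ (openCyl n T))
    {z₀ : E n × ℝ} (hr : 0 < r) (hball : Metric.closedBall z₀ r ⊆ openCyl n T) {P : E n}
    {v : Fin 2 → E n → ℝ} (hv : ∀ i, Continuous (v i)) (hV : ∀ i ξ, |v i ξ| ≤ V) (hR : 0 ≤ R)
    (hvL : ∀ i x y, v i y - v i x ≤ R * ‖y - x‖) (hsuper : IsDiscSuper (shiftHam K P) 0 c v)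
    {m : ℝ} (hεV : ε * V ≤ r ^ 2 / 16)
    (hup : ∀ i, ∀ z ∈ Metric.closedBall z₀ r, u i z - φ z ≤ m + r ^ 2 / 4)
    (hlow : ∃ i, ∃ z ∈ Metric.closedBall z₀ r,
      m - r ^ 2 / 8 < u i z - φ z - (‖z.1 - z₀.1‖ ^ 2 + (z.2 - z₀.2) ^ 2)) :
    ∃ i, ∃ z ∈ Metric.ball z₀ r, ∃ η p : E n, ‖p‖ ≤ 2 * R ∧ ‖η - ε⁻¹ • z.1‖ ≤ ε * R ∧
      timeDeriv φ z + 2 * (z.2 - z₀.2) + c ≤ K i η (P + p) -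
        K i (ε⁻¹ • z.1) (spaceGrad φ z + (2 : ℝ) • (z.1 - z₀.1) + p) := by
  -- This makes the maximum at `z₀` strict, so nearby maxima stay in the open ball.
  let q : E n × ℝ → ℝ := fun z => ‖z.1 - z₀.1‖ ^ 2 + (z.2 - z₀.2) ^ 2
  have hqc : Continuous q := by fun_prop
  -- The perturbed test function is `φ + ε v(x/ε)`. Since `v` need not be `C¹`, its argument is
  -- decoupled by the offset `y.2`, penalised quadratically.
  let F : Fin 2 → (E n × ℝ) × E n → ℝ := fun i y =>
    u i y.1 - φ y.1 - q y.1 - ε * v i (ε⁻¹ • y.1.1 + y.2) - ‖y.2‖ ^ 2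
  let S : Set ((E n × ℝ) × E n) := Metric.closedBall z₀ r ×ˢ Metric.closedBall 0 (ε * R)
  have hcyl : openCyl n T ⊆ closedCyl n T := fun z hz => ⟨hz.1, hz.2.1.le, hz.2.2.le⟩
  have hF : ∀ i, ContinuousOn (F i) S := by
    intro i
    have h1 : ContinuousOn (fun y : (E n × ℝ) × E n => u i y.1 - φ y.1) S :=
      (((hu i).mono (hball.trans hcyl)).sub (hφ.continuousOn.mono hball)).comp
        continuousOn_fst fun y hy => hy.1
    have h2 := hv i
    have h3 : Continuous fun y : (E n × ℝ) × E n =>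
        q y.1 + ε * v i (ε⁻¹ • y.1.1 + y.2) + ‖y.2‖ ^ 2 := by fun_prop
    refine (h1.sub h3.continuousOn).congr fun y _ => ?_
    simp only [F, Pi.sub_apply]
    ring
  obtain ⟨i₁, z₁, hz₁, hlow⟩ := hlow
  have hεR : 0 ≤ ε * R := mul_nonneg hε.le hR
  obtain ⟨i, y, hyS, hmax⟩ := exists_max_fin_two (F := F)
    ((isCompact_closedBall z₀ r).prod (isCompact_closedBall (0 : E n) (ε * R)))
    ⟨(z₁, 0), hz₁, by simpa using hεR⟩ fun i => (hF i).upperSemicontinuousOn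
  obtain ⟨z, d⟩ := y
  have hz : z ∈ Metric.closedBall z₀ r := hyS.1
  set ξ := ε⁻¹ • z.1 with hξ
  set η := ξ + d with hη
  -- the maximum is global in the fast variable
  have hglob : ∀ j, ∀ w ∈ Metric.closedBall z₀ r, ∀ ζ : E n,
      u j w - φ w - q w - ε * v j ζ - ‖ζ - ε⁻¹ • w.1‖ ^ 2 ≤
        u i z - φ z - q z - ε * v i η - ‖d‖ ^ 2 := by
    intro j w hw ζ
    by_cases hζ : ‖ζ - ε⁻¹ • w.1‖ ≤ ε * R
    · have h := hmax j (w, ζ - ε⁻¹ • w.1) ⟨hw, by simpa using hζ⟩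
      simp only [F, add_sub_cancel] at h
      exact h
    -- An offset longer than `ε * R` gains at most `ε R` times its length from `v`, less than its
    -- square; a zero offset does better.
    · have h := hmax j (w, 0) ⟨hw, by simpa using hεR⟩
      simp only [F, add_zero, norm_zero, ne_eq, OfNat.ofNat_ne_zero, not_false_eq_true, zero_pow,
        sub_zero] at h
      refine le_trans ?_ h
      have h1 := hvL j ζ (ε⁻¹ • w.1)
      rw [norm_sub_rev] at h1
      nlinarith [norm_nonneg (ζ - ε⁻¹ • w.1)]
  have hdR : ‖d‖ ≤ ε * R := by simpa using hyS.2
  have hqz : q z < r ^ 2 := by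
    have h1 := hglob i₁ z₁ hz₁ (ε⁻¹ • z₁.1)
    rw [sub_self, norm_zero] at h1
    have h2 := hup i z hz
    have h3 := abs_le.1 (hV i₁ (ε⁻¹ • z₁.1))
    have h4 := abs_le.1 (hV i η)
    have h5 : ε * v i₁ (ε⁻¹ • z₁.1) ≤ r ^ 2 / 16 := by nlinarith [h3.2]
    have h6 : -(r ^ 2 / 16) ≤ ε * v i η := by nlinarith [h4.1]
    have h7 : 0 ≤ ‖d‖ ^ 2 := by positivity
    have h8 : 0 < r ^ 2 := by positivity
    simp only [q] at h1 ⊢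
    nlinarith
  have hzb : z ∈ Metric.ball z₀ r := by
    rw [Metric.mem_ball, Prod.dist_eq, max_lt_iff, dist_eq_norm, Real.dist_eq]
    simp only [q] at hqz
    constructor
    · exact lt_of_pow_lt_pow_left₀ 2 hr.le (by nlinarith [sq_nonneg (z.2 - z₀.2)])
    · exact lt_of_pow_lt_pow_left₀ 2 hr.le (by rw [sq_abs]; nlinarith [sq_nonneg ‖z.1 - z₀.1‖])
  have hzT : z ∈ openCyl n T := hball hz
  -- The momentum of the fast-variable penalty, common to the tests for `u i` and for `v i`.
  set p : E n := (2 * ε⁻¹) • (ξ - η) with hp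
  have hξη : ‖ξ - η‖ = ‖d‖ := by
    rw [norm_sub_rev, hη, add_sub_cancel_left]
  have hpR : ‖p‖ ≤ 2 * R := by
    rw [hp, norm_smul, hξη, Real.norm_eq_abs, abs_of_pos (by positivity)]
    calc 2 * ε⁻¹ * ‖d‖ ≤ 2 * ε⁻¹ * (ε * R) := mul_le_mul_of_nonneg_left hdR (by positivity)
      _ = 2 * R := by field_simp
  -- test for `u i`
  have hscale : ∀ x : E n, ‖η - ε⁻¹ • x‖ ^ 2 = (ε⁻¹) ^ 2 * ‖x - ε • η‖ ^ 2 := by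
    intro x
    have : η - ε⁻¹ • x = (-ε⁻¹) • (x - ε • η) := by
      rw [smul_sub, smul_smul, neg_mul, inv_mul_cancel₀ hε.ne']
      simp only [neg_smul, one_smul]
      abel
    rw [this, norm_smul, mul_pow, norm_neg, Real.norm_eq_abs, sq_abs]
  let ψ : E n × ℝ → ℝ := fun w => φ w + (‖w.1 - z₀.1‖ ^ 2 + (w.2 - z₀.2) ^ 2) +
    (ε⁻¹) ^ 2 * ‖w.1 - ε • η‖ ^ 2
  have hψ : ContDiffOn ℝ 1 ψ (openCyl n T) := by
    have h1 : ContDiff ℝ 1 fun w : E n × ℝ => ‖w.1 - z₀.1‖ ^ 2 + (w.2 - z₀.2) ^ 2 :=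
      ((contDiff_normSq_sub z₀.1).comp contDiff_fst).add
        ((contDiff_snd.sub contDiff_const).pow 2)
    have h2 : ContDiff ℝ 1 fun w : E n × ℝ => (ε⁻¹) ^ 2 * ‖w.1 - ε • η‖ ^ 2 :=
      contDiff_const.mul ((contDiff_normSq_sub (ε • η)).comp contDiff_fst)
    exact (hφ.add h1.contDiffOn).add h2.contDiffOn
  have hd2 : ‖η - ε⁻¹ • z.1‖ = ‖d‖ := by rw [← hξ, norm_sub_rev, hξη]
  have hloc : IsLocalMax (fun w => u i w - ψ w) z := by
    refine mem_of_superset (Metric.isOpen_ball.mem_nhds hzb) fun w hw => ?_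
    have h1 := hglob i w (Metric.ball_subset_closedBall hw) η
    rw [← hd2, hscale, hscale] at h1
    simp only [q] at h1
    change u i w - ψ w ≤ u i z - ψ z
    simp only [ψ]
    linarith
  have hvisc := hsub i ψ hψ z hzT hloc
  have hsg : spaceGrad ψ z = spaceGrad φ z + (2 : ℝ) • (z.1 - z₀.1) + p := by
    have h := (hasGradientAt_add (hasGradientAt_add (hasGradientAt_slice hφ hzT)
      (hasGradientAt_add_const (hasGradientAt_normSq_sub z₀.1 z.1) ((z.2 - z₀.2) ^ 2)))
      (hasGradientAt_const_mul ((ε⁻¹) ^ 2) (hasGradientAt_normSq_sub (ε • η) z.1))).gradient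
    refine Eq.trans h ?_
    congr 1
    rw [hp, hξ, smul_smul, smul_sub, smul_sub, smul_smul, smul_smul]
    congr 2
    · ring
    · field_simp
  have htd : timeDeriv ψ z = timeDeriv φ z + 2 * (z.2 - z₀.2) := by
    have h1 : HasDerivAt (fun t : ℝ => ‖z.1 - z₀.1‖ ^ 2 + (t - z₀.2) ^ 2)
        (2 * (z.2 - z₀.2)) z.2 := by
      have h := (((hasDerivAt_id z.2).sub_const z₀.2).pow 2).const_add (‖z.1 - z₀.1‖ ^ 2)
      simpa using h
    exact (((hasDerivAt_slice hφ hzT).add h1).add_const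
      ((ε⁻¹) ^ 2 * ‖z.1 - ε • η‖ ^ 2)).deriv
  rw [htd, hsg] at hvisc
  -- test for `v i`
  have hcell := hsuper i (fun ζ => -(ε⁻¹ * ‖ζ - ξ‖ ^ 2))
    (contDiff_const.mul (contDiff_normSq_sub ξ)).neg η
    (Eventually.of_forall fun ζ => by
      have h1 := hglob i z hz ζ
      rw [← hξ, ← hd2, ← hξ] at h1
      have h2 : ε * v i η + ‖η - ξ‖ ^ 2 ≤ ε * v i ζ + ‖ζ - ξ‖ ^ 2 := by linarith
      have h3 := mul_le_mul_of_nonneg_left h2 (inv_nonneg.2 hε.le)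
      rw [mul_add, mul_add, inv_mul_cancel_left₀ hε.ne', inv_mul_cancel_left₀ hε.ne'] at h3
      simp only
      linarith)
  rw [(hasGradientAt_neg (hasGradientAt_const_mul ε⁻¹ (hasGradientAt_normSq_sub ξ η))).gradient,
    show -(ε⁻¹ • (2 : ℝ) • (η - ξ)) = p by
      rw [hp, smul_smul, ← smul_neg, neg_sub, mul_comm]] at hcell
  -- Maximality over the index; the factor `ε` in front of `v` matches the rate `1/ε`.
  have hcoup : v i η - v i.rev η ≤ (u i z - u i.rev z) / ε := by
    have h1 := hglob i.rev z hz η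
    rw [hd2] at h1
    rw [le_div_iff₀ hε]
    linarith
  refine ⟨i, z, hzb, η, p, hpR, by rw [hd2]; exact hdR, ?_⟩
  simp only [shiftHam] at hcell
  linarith

/-- If the conclusion failed, a test function perturbed by the corrector `v` would touch some `u ε`
near `z₀`. The touching inequalities for `u ε` and `v` carry nearly the same Hamiltonian value, so
subtracting them contradicts the failure. -/
theorem upperLim_subsolution {n : ℕ} {K : Fin 2 → E n → E n → ℝ} {T c R : ℝ}
    {u : ℝ → Fin 2 → E n × ℝ → ℝ} (hK : ∀ i, Continuous fun q : E n × E n => K i q.1 q.2)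
    (hper : ∀ i p, IsPeriodic fun ξ => K i ξ p)
    (hu : ∀ ε, 0 < ε → ∀ i, ContinuousOn (u ε i) (closedCyl n T))
    (hsub : ∀ ε, 0 < ε → IsSystemSubsolution K T ε (u ε))
    (hbd : ∀ z ∈ openCyl n T, IsBoundedNear u z) {φ : E n × ℝ → ℝ}
    (hφ : ContDiffOn ℝ 1 φ (openCyl n T)) {z₀ : E n × ℝ} (hz₀ : z₀ ∈ openCyl n T)
    (hmax : IsLocalMax (fun w => upperLim u w - φ w) z₀) {v : Fin 2 → E n → ℝ}
    (hv : ∀ i, Continuous (v i)) (hvp : ∀ i, IsPeriodic (v i)) (hR : 0 ≤ R)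
    (hvL : ∀ i x y, v i y - v i x ≤ R * ‖y - x‖)
    (hsuper : IsDiscSuper (shiftHam K (spaceGrad φ z₀)) 0 c v) : timeDeriv φ z₀ + c ≤ 0 := by
  by_contra! hcon
  set P := spaceGrad φ z₀ with hP
  -- The gap is `4 θ`: moving the time derivative from `z₀` costs `θ`, and the modulus of `K` allows
  -- `θ`, so `3 θ < θ` results.
  set θ := (timeDeriv φ z₀ + c) / 4 with hθ
  have hθ0 : 0 < θ := by positivity
  choose δ' hδ' hmod using fun i => exists_modulus_of_periodic (hK i) (hper i) (‖P‖ + 2 * R) hθ0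
  set δ := min (δ' 0) (δ' 1) with hδ
  have hδ0 : 0 < δ := lt_min (hδ' 0) (hδ' 1)
  have hδi : ∀ i, δ ≤ δ' i := by
    intro i
    fin_cases i
    · exact min_le_left _ _
    · exact min_le_right _ _
  choose V hV0 hV using fun i => exists_bound_of_isPeriodic (hv i) (hvp i)
  have hVs : 0 ≤ V 0 + V 1 := add_nonneg (hV0 0) (hV0 1)
  have hVi : ∀ i ξ, |v i ξ| ≤ V 0 + V 1 := by
    intro i ξ
    refine (hV i ξ).trans ?_
    fin_cases i
    · exact le_add_of_nonneg_right (hV0 1)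
    · exact le_add_of_nonneg_left (hV0 0)
  have hnhds := (isOpen_openCyl n T).mem_nhds hz₀
  have hgc : ContinuousAt (spaceGrad φ) z₀ := (continuousOn_spaceGrad hφ).continuousAt hnhds
  have htc : ContinuousAt (timeDeriv φ) z₀ := (continuousOn_timeDeriv hφ).continuousAt hnhds
  have hev : ∀ᶠ z in 𝓝 z₀, z ∈ openCyl n T ∧ upperLim u z - φ z ≤ upperLim u z₀ - φ z₀ ∧
      timeDeriv φ z₀ - θ < timeDeriv φ z + 2 * (z.2 - z₀.2) ∧
      ‖spaceGrad φ z + (2 : ℝ) • (z.1 - z₀.1) - P‖ < δ := by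
    have h1 : ContinuousAt (fun z : E n × ℝ => timeDeriv φ z + 2 * (z.2 - z₀.2)) z₀ :=
      htc.add (by fun_prop)
    have h2 : ContinuousAt (fun z : E n × ℝ =>
        ‖spaceGrad φ z + (2 : ℝ) • (z.1 - z₀.1) - P‖) z₀ :=
      ((hgc.add (by fun_prop)).sub continuousAt_const).norm
    have h3 : ∀ᶠ z in 𝓝 z₀, timeDeriv φ z₀ - θ < timeDeriv φ z + 2 * (z.2 - z₀.2) :=
      continuousAt_const.eventually_lt h1 (by simpa using hθ0)
    filter_upwards [hnhds, hmax, h3,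
      h2.eventually_lt continuousAt_const (by simpa [← hP] using hδ0)] with z a1 a2 a3 a4
    exact ⟨a1, a2, a3, a4⟩
  obtain ⟨r, hr, hball⟩ := Metric.nhds_basis_closedBall.mem_iff.1 hev
  have hr2 : 0 < r ^ 2 := by positivity
  set m := upperLim u z₀ - φ z₀ with hm
  -- uniform upper bound on the closed ball
  have hup : ∀ᶠ ε in 𝓝[>] (0 : ℝ), ∀ z ∈ Metric.closedBall z₀ r, ∀ i,
      u ε i z - φ z ≤ m + r ^ 2 / 4 := by
    have hmem : {p : ℝ × (E n × ℝ) | ∀ i, u p.1 i p.2 - φ p.2 ≤ m + r ^ 2 / 4} ∈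
        𝓝[>] (0 : ℝ) ×ˢ 𝓝ˢ (Metric.closedBall z₀ r) := by
      -- The relaxed limit bounds the family near each point for its own range of `ε`; compactness
      -- merges these ranges.
      refine (isCompact_closedBall z₀ r).mem_prod_nhdsSet_of_forall fun z hz => ?_
      obtain ⟨hzT, hzm, -, -⟩ := hball hz
      have h1 := eventually_lt_of_upperLim_lt (a := φ z + m + r ^ 2 / 8) (hbd z hzT)
        (by linarith)
      have hc : ContinuousAt φ z :=
        hφ.continuousOn.continuousAt ((isOpen_openCyl n T).mem_nhds hzT)
      have h2 : ∀ᶠ w in 𝓝 z, φ z - r ^ 2 / 8 < φ w :=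
        continuousAt_const.eventually_lt hc (by linarith)
      filter_upwards [h1, h2.prod_inr (𝓝[>] (0 : ℝ))] with p hp1 hp2 i
      linarith [hp1 i]
    obtain ⟨t₁, ht₁, t₂, ht₂, hsubset⟩ := mem_prod_iff.1 hmem
    filter_upwards [ht₁] with ε hε z hz i
    exact hsubset (mk_mem_prod hε (subset_of_mem_nhdsSet ht₂ hz)) i
  -- lower bound along a sequence
  have hlow := frequently_lt_of_lt_upperLim (hbd z₀ hz₀)
    (show upperLim u z₀ - r ^ 2 / 16 < upperLim u z₀ by linarith)
  have hcφ : ContinuousAt φ z₀ := hφ.continuousOn.continuousAt hnhds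
  have hnear : ∀ᶠ w in 𝓝 z₀, w ∈ Metric.closedBall z₀ r ∧
      φ w + (‖w.1 - z₀.1‖ ^ 2 + (w.2 - z₀.2) ^ 2) < φ z₀ + r ^ 2 / 16 := by
    have h1 : ContinuousAt (fun w : E n × ℝ =>
        φ w + (‖w.1 - z₀.1‖ ^ 2 + (w.2 - z₀.2) ^ 2)) z₀ := hcφ.add (by fun_prop)
    have h2 : ∀ᶠ w in 𝓝 z₀, φ w + (‖w.1 - z₀.1‖ ^ 2 + (w.2 - z₀.2) ^ 2) < φ z₀ + r ^ 2 / 16 :=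
      h1.eventually_lt continuousAt_const (by simpa using hr2)
    filter_upwards [Metric.closedBall_mem_nhds z₀ hr, h2] with w a1 a2
    exact ⟨a1, a2⟩
  have hsmall : ∀ᶠ ε in 𝓝[>] (0 : ℝ), 0 < ε ∧ ε * (V 0 + V 1) < r ^ 2 / 16 ∧ ε * R < δ := by
    have h1 : ∀ᶠ ε in 𝓝 (0 : ℝ), ε * (V 0 + V 1) < r ^ 2 / 16 ∧ ε * R < δ := by
      have c1 : ContinuousAt (fun ε : ℝ => ε * (V 0 + V 1)) 0 := by fun_prop
      have c2 : ContinuousAt (fun ε : ℝ => ε * R) 0 := by fun_prop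
      exact (c1.eventually_lt continuousAt_const (by simpa using hr2)).and
        (c2.eventually_lt continuousAt_const (by simpa using hδ0))
    filter_upwards [self_mem_nhdsWithin, nhdsWithin_le_nhds h1] with ε h0 h
    exact ⟨h0, h⟩
  obtain ⟨⟨ε, w⟩, ⟨i₁, hi₁⟩, ⟨hwb, hwφ⟩, hupε, hε, hεV, hεR⟩ := (hlow.and_eventually
    ((hnear.prod_inr _).and ((hup.and hsmall).prod_inl _))).exists
  obtain ⟨i, z, hz, η, p, hp, hη, hfin⟩ := exists_perturbed_touching hε (hu ε hε) (hsub ε hε) hφ hr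
    (fun z hz => (hball hz).1) hv hVi hR hvL hsuper (m := m) hεV.le
    (fun i z hz => hupε z hz i) ⟨i₁, w, hwb, by simp only at hi₁ hwφ; linarith⟩
  obtain ⟨-, -, ht, hg⟩ := hball (Metric.ball_subset_closedBall hz)
  have h1 := hmod i η (ε⁻¹ • z.1) (P + p)
    (spaceGrad φ z + (2 : ℝ) • (z.1 - z₀.1) + p)
    ((norm_add_le _ _).trans (by linarith)) ((hη.trans hεR.le).trans (hδi i)) (by
      rw [add_sub_add_right_eq_sub, norm_sub_rev]
      exact hg.le.trans (hδi i))
  linarith [(abs_le.1 h1).2]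

/-! ### Comparison for the effective equation -/

/-- The test function used to compare sub- and supersolutions of the effective equation. -/
def doublingTest {n : ℕ} (T L B ρ δ κ : ℝ) (w z : E n × ℝ) : ℝ :=
  L * √(ρ + ‖z.1 - w.1‖ ^ 2) + B * √(ρ + (z.2 - w.2) ^ 2) + δ * √(1 + ‖z.1 - 0‖ ^ 2) +
    κ / (T - z.2)

theorem contDiff_sqrt_add_sq_sub {ρ : ℝ} (hρ : 0 < ρ) (s : ℝ) :
    ContDiff ℝ 1 fun t : ℝ => √(ρ + (t - s) ^ 2) :=
  (contDiff_const.add ((contDiff_id.sub contDiff_const).pow 2)).sqrt fun t => by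
    have := sq_nonneg (t - s)
    simp only [id]
    positivity

theorem hasDerivAt_sqrt_add_sq_sub {ρ : ℝ} (hρ : 0 < ρ) (s t : ℝ) :
    HasDerivAt (fun t : ℝ => √(ρ + (t - s) ^ 2)) ((t - s) / √(ρ + (t - s) ^ 2)) t := by
  have h1 : HasDerivAt (fun t : ℝ => ρ + (t - s) ^ 2) (2 * (t - s)) t := by
    simpa using (((hasDerivAt_id t).sub_const s).pow 2).const_add ρ
  have hpos : 0 < ρ + (t - s) ^ 2 := by positivity
  refine (h1.sqrt hpos.ne').congr_deriv ?_
  rw [mul_div_mul_left _ _ two_ne_zero]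

section DoublingTest

variable {n : ℕ} {T L B ρ δ κ : ℝ} {w z : E n × ℝ}

theorem contDiffOn_doublingTest (hρ : 0 < ρ) (w : E n × ℝ) :
    ContDiffOn ℝ 1 (doublingTest T L B ρ δ κ w) (openCyl n T) := by
  have h1 : ContDiff ℝ 1 fun z : E n × ℝ => L * √(ρ + ‖z.1 - w.1‖ ^ 2) :=
    contDiff_const.mul ((contDiff_sqrt_add_normSq_sub hρ w.1).comp contDiff_fst)
  have h2 : ContDiff ℝ 1 fun z : E n × ℝ => B * √(ρ + (z.2 - w.2) ^ 2) :=
    contDiff_const.mul ((contDiff_sqrt_add_sq_sub hρ w.2).comp contDiff_snd)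
  have h3 : ContDiff ℝ 1 fun z : E n × ℝ => δ * √(1 + ‖z.1 - 0‖ ^ 2) :=
    contDiff_const.mul ((contDiff_sqrt_add_normSq_sub one_pos 0).comp contDiff_fst)
  exact ((h1.add h2).add h3).contDiffOn.add (contDiffOn_const_div_sub n κ T)

theorem spaceGrad_doublingTest (hρ : 0 < ρ) :
    spaceGrad (doublingTest T L B ρ δ κ w) z =
      L • ((√(ρ + ‖z.1 - w.1‖ ^ 2))⁻¹ • (z.1 - w.1)) +
        δ • ((√(1 + ‖z.1 - 0‖ ^ 2))⁻¹ • (z.1 - 0)) :=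
  (hasGradientAt_add_const (hasGradientAt_add (hasGradientAt_add_const
    (hasGradientAt_const_mul L (hasGradientAt_sqrt_add_normSq_sub ρ w.1 z.1 (by positivity)))
    (B * √(ρ + (z.2 - w.2) ^ 2)))
    (hasGradientAt_const_mul δ (hasGradientAt_sqrt_add_normSq_sub 1 0 z.1 (by positivity))))
    (κ / (T - z.2))).gradient

theorem timeDeriv_doublingTest (hρ : 0 < ρ) (hz : z.2 < T) :
    timeDeriv (doublingTest T L B ρ δ κ w) z =
      B * ((z.2 - w.2) / √(ρ + (z.2 - w.2) ^ 2)) + κ / (T - z.2) ^ 2 :=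
  (((((hasDerivAt_sqrt_add_sq_sub hρ w.2 z.2).const_mul B).const_add
    (L * √(ρ + ‖z.1 - w.1‖ ^ 2))).add_const (δ * √(1 + ‖z.1 - 0‖ ^ 2))).add
    (hasDerivAt_const_div_sub κ hz)).deriv

end DoublingTest

set_option maxHeartbeats 800000 in
-- Doubling with fixed slopes `L` and `B` instead of exploding ones: `K` does not depend on
-- position, so the two points need not be close, and the momenta differ only by the `δ` terms.
-- Those slopes dominate the data, so the doubled function is at most `2 B min(t, s)`, which keeps
-- its positive maximum away from time zero.
theorem effective_comparison_smooth {n : ℕ} {K : E n → ℝ} (hK : Continuous K) {T L B ρ : ℝ}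
    {g : E n → ℝ} (hg : ∀ x y, g x - g y ≤ L * ‖x - y‖) (hL : 0 ≤ L) (hB : 0 < B) (hρ : 0 < ρ)
    {a b : E n × ℝ → ℝ} (ha : UpperSemicontinuousOn a (openCyl n T))
    (hb : UpperSemicontinuousOn (fun z => -b z) (openCyl n T))
    (ha_le : ∀ z ∈ openCyl n T, a z ≤ g z.1 + B * z.2)
    (hb_ge : ∀ z ∈ openCyl n T, g z.1 - B * z.2 ≤ b z)
    (hsub : ∀ φ : E n × ℝ → ℝ, ContDiffOn ℝ 1 φ (openCyl n T) → ∀ z ∈ openCyl n T,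
      IsLocalMax (fun w => a w - φ w) z → timeDeriv φ z + K (spaceGrad φ z) ≤ 0)
    (hsuper : ∀ φ : E n × ℝ → ℝ, ContDiffOn ℝ 1 φ (openCyl n T) → ∀ z ∈ openCyl n T,
      IsLocalMin (fun w => b w - φ w) z → 0 ≤ timeDeriv φ z + K (spaceGrad φ z))
    {z₁ w₁ : E n × ℝ} (hz₁ : z₁ ∈ openCyl n T) (hw₁ : w₁ ∈ openCyl n T) :
    a z₁ - b w₁ ≤ L * √(ρ + ‖z₁.1 - w₁.1‖ ^ 2) + B * √(ρ + (z₁.2 - w₁.2) ^ 2) := by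
  by_contra! hcon
  have hT : 0 < T := hz₁.2.1.trans hz₁.2.2
  obtain ⟨Θ, hΘ⟩ : ∃ Θ, Θ = a z₁ - b w₁ -
      (L * √(ρ + ‖z₁.1 - w₁.1‖ ^ 2) + B * √(ρ + (z₁.2 - w₁.2) ^ 2)) := ⟨_, rfl⟩
  have hΘ0 : 0 < Θ := by linarith
  have ht₁ : 0 < T - z₁.2 := sub_pos.2 hz₁.2.2
  have hs₁ : 0 < T - w₁.2 := sub_pos.2 hw₁.2.2
  -- Each `κ` term costs at most `Θ / 8` at the reference pair and the `δ` term at most `Θ / 4`,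
  -- leaving `Θ / 2`.
  set κ := Θ * (T - z₁.2) * (T - w₁.2) / (8 * T) with hκ
  have hκ0 : 0 < κ := by positivity
  have hκz : κ / (T - z₁.2) ≤ Θ / 8 := by
    rw [div_le_iff₀ ht₁, hκ, div_le_iff₀ (by positivity)]
    have h1 : T - w₁.2 ≤ T := by linarith [hw₁.2.1]
    have h2 : 0 ≤ Θ * (T - z₁.2) := by positivity
    nlinarith
  have hκw : κ / (T - w₁.2) ≤ Θ / 8 := by
    rw [div_le_iff₀ hs₁, hκ, div_le_iff₀ (by positivity)]
    have h1 : T - z₁.2 ≤ T := by linarith [hz₁.2.1]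
    have h2 : 0 ≤ Θ * (T - w₁.2) := by positivity
    nlinarith
  -- The two `κ` terms together gain at least `2 κ / T²` in the equations, twice the tolerated
  -- change of `K`.
  obtain ⟨d, hd, hmod⟩ := exists_modulus_of_periodic (K := fun _ p => K p)
    (hK.comp continuous_snd) (fun _ _ _ => rfl) (L + 1) (show 0 < κ / T ^ 2 by positivity)
  obtain ⟨N, hN⟩ : ∃ N, N = √(1 + ‖z₁.1 - 0‖ ^ 2) + √(1 + ‖w₁.1 - 0‖ ^ 2) := ⟨_, rfl⟩
  have hN0 : 0 < N := by rw [hN]; positivity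
  -- `1` keeps the momenta below `L + 1`, `d / 2` keeps them within `d` of each other, and the last
  -- entry limits the cost at the reference pair.
  set δ := min (min 1 (d / 2)) (Θ / (4 * N)) with hδ
  have hδ0 : 0 < δ := by positivity
  have hδ1 : δ ≤ 1 := (min_le_left _ _).trans (min_le_left _ _)
  have hδd : δ ≤ d / 2 := (min_le_left _ _).trans (min_le_right _ _)
  have hδN : δ * N ≤ Θ / 4 := by
    have h1 : δ ≤ Θ / (4 * N) := min_le_right _ _
    have h2 : Θ / (4 * N) * N = Θ / 4 := by field_simp
    nlinarith
  let Ψ : (E n × ℝ) × (E n × ℝ) → ℝ := fun y =>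
    L * √(ρ + ‖y.1.1 - y.2.1‖ ^ 2) + B * √(ρ + (y.1.2 - y.2.2) ^ 2) +
      δ * (√(1 + ‖y.1.1 - 0‖ ^ 2) + √(1 + ‖y.2.1 - 0‖ ^ 2)) +
      (κ / (T - y.1.2) + κ / (T - y.2.2))
  let F : (E n × ℝ) × (E n × ℝ) → ℝ := fun y => a y.1 + -b y.2 + -Ψ y
  have hF₁ : Θ / 2 ≤ F (z₁, w₁) := by
    simp only [F, Ψ]
    rw [← hN]
    linarith
  have hbound : ∀ z ∈ openCyl n T, ∀ w ∈ openCyl n T, F (z, w) ≤ B * (z.2 + w.2) -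
      B * |z.2 - w.2| - δ * ‖z.1‖ - δ * ‖w.1‖ - κ / (T - z.2) - κ / (T - w.2) := by
    intro z hz w hw
    have h1 := ha_le z hz
    have h2 := hb_ge w hw
    have h3 := hg z.1 w.1
    have h4 := mul_le_mul_of_nonneg_left (norm_le_sqrt_add_normSq hρ.le (z.1 - w.1)) hL
    have h5 : B * |z.2 - w.2| ≤ B * √(ρ + (z.2 - w.2) ^ 2) :=
      mul_le_mul_of_nonneg_left (Real.abs_le_sqrt (by linarith)) hB.le
    have h6 := mul_le_mul_of_nonneg_left (norm_le_sqrt_add_normSq zero_le_one (z.1 - 0)) hδ0.le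
    have h7 := mul_le_mul_of_nonneg_left (norm_le_sqrt_add_normSq zero_le_one (w.1 - 0)) hδ0.le
    simp only [F, Ψ]
    rw [sub_zero] at h6 h7 ⊢
    rw [sub_zero]
    linarith
  set rad := 2 * B * T / δ with hrad
  set τ₁ := Θ / (4 * B) with hτ₁
  set τ₂ := κ / (2 * B * T) with hτ₂
  have hτ₁0 : 0 < τ₁ := by positivity
  have hτ₂0 : 0 < τ₂ := by positivity
  let S₀ : Set (E n × ℝ) := Metric.closedBall 0 rad ×ˢ Icc τ₁ (T - τ₂)
  have hS₀ : S₀ ⊆ openCyl n T := fun z hz =>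
    ⟨mem_univ _, by linarith [hz.2.1], by linarith [hz.2.2]⟩
  have hcoer : ∀ (x : E n) (t : ℝ), t < T → Θ / 2 ≤ 2 * B * t → δ * ‖x‖ ≤ 2 * B * T →
      κ / (T - t) ≤ 2 * B * T → (x, t) ∈ S₀ := by
    intro x t ht h1 h2 h3
    refine ⟨?_, ?_, ?_⟩
    · rw [mem_closedBall_zero_iff, hrad, le_div_iff₀ hδ0, mul_comm]
      exact h2
    · simp only [hτ₁]
      rw [div_le_iff₀ (by positivity)]
      linarith
    · rw [div_le_iff₀ (by linarith)] at h3
      have h4 : τ₂ ≤ T - t := by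
        rw [hτ₂, div_le_iff₀ (by positivity)]
        linarith
      simp only
      linarith
  have hin : ∀ z ∈ openCyl n T, ∀ w ∈ openCyl n T, Θ / 2 ≤ F (z, w) → (z, w) ∈ S₀ ×ˢ S₀ := by
    intro z hz w hw h
    have h1 := hbound z hz w hw
    have p1 : 0 < κ / (T - z.2) := div_pos hκ0 (sub_pos.2 hz.2.2)
    have p2 : 0 < κ / (T - w.2) := div_pos hκ0 (sub_pos.2 hw.2.2)
    have p3 : 0 ≤ δ * ‖z.1‖ := by positivity
    have p4 : 0 ≤ δ * ‖w.1‖ := by positivity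
    have p5 := mul_le_mul_of_nonneg_left (le_abs_self (z.2 - w.2)) hB.le
    have p6 := mul_le_mul_of_nonneg_left (neg_abs_le (z.2 - w.2)) hB.le
    have p7 : B * z.2 ≤ B * T := mul_le_mul_of_nonneg_left hz.2.2.le hB.le
    have p8 : B * w.2 ≤ B * T := mul_le_mul_of_nonneg_left hw.2.2.le hB.le
    exact ⟨hcoer z.1 z.2 hz.2.2 (by linarith) (by linarith) (by linarith),
      hcoer w.1 w.2 hw.2.2 (by linarith) (by linarith) (by linarith)⟩
  have hFusc : UpperSemicontinuousOn F (S₀ ×ˢ S₀) := by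
    have h1 : UpperSemicontinuousOn (fun y : (E n × ℝ) × (E n × ℝ) => a y.1) (S₀ ×ˢ S₀) :=
      (ha.mono hS₀).comp continuousOn_fst fun y hy => hy.1
    have h2 : UpperSemicontinuousOn (fun y : (E n × ℝ) × (E n × ℝ) => -b y.2) (S₀ ×ˢ S₀) :=
      (hb.mono hS₀).comp continuousOn_snd fun y hy => hy.2
    have h3 : ContinuousOn Ψ (S₀ ×ˢ S₀) := by
      have c1 : Continuous fun y : (E n × ℝ) × (E n × ℝ) =>
          L * √(ρ + ‖y.1.1 - y.2.1‖ ^ 2) + B * √(ρ + (y.1.2 - y.2.2) ^ 2) +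
          δ * (√(1 + ‖y.1.1 - 0‖ ^ 2) + √(1 + ‖y.2.1 - 0‖ ^ 2)) := by fun_prop
      have c2 : ContinuousOn (fun y : (E n × ℝ) × (E n × ℝ) => κ / (T - y.1.2)) (S₀ ×ˢ S₀) :=
        continuousOn_const.div (by fun_prop) fun y hy => (sub_pos.2 (hS₀ hy.1).2.2).ne'
      have c3 : ContinuousOn (fun y : (E n × ℝ) × (E n × ℝ) => κ / (T - y.2.2)) (S₀ ×ˢ S₀) :=
        continuousOn_const.div (by fun_prop) fun y hy => (sub_pos.2 (hS₀ hy.2).2.2).ne'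
      exact c1.continuousOn.add (c2.add c3)
    exact (h1.add h2).add h3.neg.upperSemicontinuousOn
  have hS₀c : IsCompact S₀ := (isCompact_closedBall (0 : E n) rad).prod isCompact_Icc
  have hmem₁ := hin z₁ hz₁ w₁ hw₁ hF₁
  obtain ⟨⟨z, w⟩, ⟨hzS, hwS⟩, hmax⟩ := hFusc.exists_isMaxOn ⟨_, hmem₁⟩ (hS₀c.prod hS₀c)
  have hz : z ∈ openCyl n T := hS₀ hzS
  have hw : w ∈ openCyl n T := hS₀ hwS
  have hglob : ∀ z' ∈ openCyl n T, ∀ w' ∈ openCyl n T, F (z', w') ≤ F (z, w) := by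
    intro z' hz' w' hw'
    by_cases h : (z', w') ∈ S₀ ×ˢ S₀
    · exact hmax h
    · have h1 : F (z₁, w₁) ≤ F (z, w) := hmax hmem₁
      have h2 : F (z', w') < Θ / 2 := not_le.1 fun h' => h (hin z' hz' w' hw' h')
      linarith
  have hsubz := hsub (doublingTest T L B ρ δ κ w) (contDiffOn_doublingTest hρ w) z hz
    (mem_of_superset ((isOpen_openCyl n T).mem_nhds hz) fun z' hz' => by
      have h := hglob z' hz' w hw
      simp only [F, Ψ] at h
      change a z' - doublingTest T L B ρ δ κ w z' ≤ a z - doublingTest T L B ρ δ κ w z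
      simp only [doublingTest]
      linarith)
  have hsupw := hsuper (fun w' => -doublingTest T L B ρ δ κ z w')
    (contDiffOn_doublingTest hρ z).neg w hw
    (mem_of_superset ((isOpen_openCyl n T).mem_nhds hw) fun w' hw' => by
      have h := hglob z hz w' hw'
      simp only [F, Ψ] at h
      change b w - -doublingTest T L B ρ δ κ z w ≤ b w' - -doublingTest T L B ρ δ κ z w'
      simp only [doublingTest]
      rw [norm_sub_rev w'.1 z.1, norm_sub_rev w.1 z.1, ← neg_sub z.2 w'.2, neg_sq,
        ← neg_sub z.2 w.2, neg_sq]
      linarith)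
  rw [spaceGrad_doublingTest hρ, timeDeriv_doublingTest hρ hz.2.2] at hsubz
  rw [spaceGrad_neg, timeDeriv_neg, spaceGrad_doublingTest hρ,
    timeDeriv_doublingTest hρ hw.2.2] at hsupw
  have e1 : -(B * ((w.2 - z.2) / √(ρ + (w.2 - z.2) ^ 2)) + κ / (T - w.2) ^ 2) =
      B * ((z.2 - w.2) / √(ρ + (z.2 - w.2) ^ 2)) - κ / (T - w.2) ^ 2 := by
    rw [← neg_sub z.2 w.2, neg_sq]
    ring
  obtain ⟨q₁, hq₁⟩ : ∃ q, q = (√(1 + ‖z.1 - 0‖ ^ 2))⁻¹ • (z.1 - 0) := ⟨_, rfl⟩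
  obtain ⟨q₂, hq₂⟩ : ∃ q, q = (√(1 + ‖w.1 - 0‖ ^ 2))⁻¹ • (w.1 - 0) := ⟨_, rfl⟩
  obtain ⟨p, hp⟩ : ∃ p, p = L • ((√(ρ + ‖z.1 - w.1‖ ^ 2))⁻¹ • (z.1 - w.1)) := ⟨_, rfl⟩
  have e2 : -(L • ((√(ρ + ‖w.1 - z.1‖ ^ 2))⁻¹ • (w.1 - z.1)) + δ • q₂) = p - δ • q₂ := by
    rw [hp, norm_sub_rev w.1 z.1, ← neg_sub z.1 w.1, smul_neg, smul_neg]
    abel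
  rw [← hq₂, e1, e2] at hsupw
  rw [← hp, ← hq₁] at hsubz
  have hq₁n : ‖q₁‖ ≤ 1 := by rw [hq₁]; exact norm_inv_sqrt_smul_le one_pos _
  have hq₂n : ‖q₂‖ ≤ 1 := by rw [hq₂]; exact norm_inv_sqrt_smul_le one_pos _
  have hpn : ‖p‖ ≤ L := by
    rw [hp, norm_smul, Real.norm_eq_abs, abs_of_nonneg hL]
    have := norm_inv_sqrt_smul_le hρ (z.1 - w.1)
    nlinarith
  have hδq₁ : ‖δ • q₁‖ ≤ δ := by
    rw [norm_smul, Real.norm_eq_abs, abs_of_pos hδ0]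
    nlinarith
  have hδq₂ : ‖δ • q₂‖ ≤ δ := by
    rw [norm_smul, Real.norm_eq_abs, abs_of_pos hδ0]
    nlinarith
  have hmodz := hmod 0 0 (p - δ • q₂) (p + δ • q₁) ((norm_sub_le _ _).trans (by linarith))
    (by simpa using hd.le) (by
      rw [show p - δ • q₂ - (p + δ • q₁) = -(δ • q₂ + δ • q₁) by abel, norm_neg]
      exact (norm_add_le _ _).trans (by linarith))
  have hκT : ∀ t, 0 < t → t < T → κ / T ^ 2 ≤ κ / (T - t) ^ 2 := by
    intro t h0 h1
    refine div_le_div_of_nonneg_left hκ0.le (pow_pos (sub_pos.2 h1) 2) ?_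
    exact pow_le_pow_left₀ (by linarith) (by linarith) 2
  have k1 := hκT z.2 hz.2.1 hz.2.2
  have k2 := hκT w.2 hw.2.1 hw.2.2
  have k3 : 0 < κ / T ^ 2 := by positivity
  linarith [(abs_le.1 hmodz).2]

/-- Comparison of a subsolution and a supersolution of `u_t + K(Du) = 0` with the same Lipschitz
initial data; it also contains the Lipschitz regularity of solutions. -/
theorem effective_comparison {n : ℕ} {K : E n → ℝ} (hK : Continuous K) {T L B : ℝ}
    {g : E n → ℝ} (hg : ∀ x y, g x - g y ≤ L * ‖x - y‖) (hL : 0 ≤ L) (hB : 0 < B)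
    {a b : E n × ℝ → ℝ} (ha : UpperSemicontinuousOn a (openCyl n T))
    (hb : UpperSemicontinuousOn (fun z => -b z) (openCyl n T))
    (ha_le : ∀ z ∈ openCyl n T, a z ≤ g z.1 + B * z.2)
    (hb_ge : ∀ z ∈ openCyl n T, g z.1 - B * z.2 ≤ b z)
    (hsub : ∀ φ : E n × ℝ → ℝ, ContDiffOn ℝ 1 φ (openCyl n T) → ∀ z ∈ openCyl n T,
      IsLocalMax (fun w => a w - φ w) z → timeDeriv φ z + K (spaceGrad φ z) ≤ 0)
    (hsuper : ∀ φ : E n × ℝ → ℝ, ContDiffOn ℝ 1 φ (openCyl n T) → ∀ z ∈ openCyl n T,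
      IsLocalMin (fun w => b w - φ w) z → 0 ≤ timeDeriv φ z + K (spaceGrad φ z))
    {z w : E n × ℝ} (hz : z ∈ openCyl n T) (hw : w ∈ openCyl n T) :
    a z - b w ≤ L * ‖z.1 - w.1‖ + B * |z.2 - w.2| := by
  have hc : Continuous fun ρ : ℝ =>
      L * √(ρ + ‖z.1 - w.1‖ ^ 2) + B * √(ρ + (z.2 - w.2) ^ 2) := by fun_prop
  have ht := (hc.tendsto 0).mono_left (nhdsWithin_le_nhds (s := Ioi 0))
  simp only [zero_add, Real.sqrt_sq (norm_nonneg _), Real.sqrt_sq_eq_abs] at ht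
  refine ge_of_tendsto ht ?_
  filter_upwards [self_mem_nhdsWithin] with ρ hρ
  have hρ : 0 < ρ := hρ
  exact effective_comparison_smooth hK hg hL hB hρ ha hb ha_le hb_ge hsub hsuper hz hw

/-! ### Convergence -/

/-- The relaxation exponential dies out near any positive time; this is where the averaged initial
datum comes from. -/
theorem tendsto_initialLayer {n : ℕ} {f : Fin 2 → E n → ℝ} (hf : ∀ i, Continuous (f i))
    (i : Fin 2) {z : E n × ℝ} (hz : 0 < z.2) :
    Tendsto (fun p : ℝ × (E n × ℝ) => initialLayer f p.1 i p.2) (𝓝[>] 0 ×ˢ 𝓝 z)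
      (𝓝 ((f 0 z.1 + f 1 z.1) / 2)) := by
  have hsum : (f 0 z.1 + f 1 z.1) / 2 = (f i z.1 + f i.rev z.1) / 2 := by
    fin_cases i
    · rfl
    · exact congrArg (· / 2) (add_comm (f 0 z.1) (f 1 z.1))
  have hx : Tendsto (fun p : ℝ × (E n × ℝ) => p.2.1) (𝓝[>] 0 ×ˢ 𝓝 z) (𝓝 z.1) :=
    (continuous_fst.tendsto z).comp tendsto_snd
  have ht : Tendsto (fun p : ℝ × (E n × ℝ) => p.2.2) (𝓝[>] 0 ×ˢ 𝓝 z) (𝓝 z.2) :=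
    (continuous_snd.tendsto z).comp tendsto_snd
  have hfi := fun j => ((hf j).tendsto z.1).comp hx
  have hinv : Tendsto (fun p : ℝ × (E n × ℝ) => 2 / p.1) (𝓝[>] 0 ×ˢ 𝓝 z) atTop := by
    have h1 : Tendsto (fun p : ℝ × (E n × ℝ) => p.1⁻¹) (𝓝[>] 0 ×ˢ 𝓝 z) atTop :=
      tendsto_inv_nhdsGT_zero.comp tendsto_fst
    simpa [div_eq_mul_inv] using h1.const_mul_atTop two_pos
  have hexp : Tendsto (fun p : ℝ × (E n × ℝ) => Real.exp (-(2 / p.1) * p.2.2))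
      (𝓝[>] 0 ×ˢ 𝓝 z) (𝓝 0) := by
    refine Real.tendsto_exp_atBot.comp ?_
    simp only [neg_mul]
    exact tendsto_neg_atTop_atBot.comp (hinv.atTop_mul_pos hz ht)
  have h := (((hfi i).add (hfi i.rev)).div_const 2).add
    ((((hfi i).sub (hfi i.rev)).div_const 2).mul hexp)
  rw [mul_zero, add_zero, ← hsum] at h
  exact h

/-- Supplies the corrector for the reflected problem, where the test function `-φ` has gradient
`-P`. -/
theorem isDiscSuper_shiftHam_reflect {n : ℕ} {H : Fin 2 → E n → E n → ℝ} {P : E n} {lam c : ℝ}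
    {v : Fin 2 → E n → ℝ} (h : IsDiscSub (shiftHam H P) lam c v) :
    IsDiscSuper (shiftHam (reflect H) (-P)) lam (-c) (fun i ξ => -v i ξ) := by
  rw [← isDiscSub_reflect_neg_iff]
  have e : reflect (shiftHam (reflect H) (-P)) = shiftHam H P := by
    funext i ξ p
    simp only [reflect, shiftHam, neg_neg]
    congr 1
    abel
  simpa [e] using h

section Convergence

variable {n : ℕ} {H : Fin 2 → E n → E n → ℝ} {f : Fin 2 → E n → ℝ} {T : ℝ}
  {u : ℝ → Fin 2 → E n × ℝ → ℝ}

/-- Uniform two-sided barriers for the solutions of the oscillating system. -/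
theorem exists_barriers (hH : ∀ i, Continuous fun q : E n × E n => H i q.1 q.2)
    (hper : ∀ i p, IsPeriodic fun ξ => H i ξ p) (hf : ∀ i, ContDiff ℝ 1 (f i)) {L : ℝ}
    (hL : ∀ i x, ‖gradient (f i) x‖ ≤ L)
    (hu : ∀ ε : ℝ, 0 < ε → IsSystemSolution H f T ε (u ε))
    (hgrow : ∀ ε : ℝ, 0 < ε → ∀ i, HasLinearGrowth T (u ε i)) :
    ∃ B, 0 < B ∧ ∀ ε, 0 < ε → ∀ i, ∀ z ∈ openCyl n T,
      u ε i z ≤ initialLayer f ε i z + B * z.2 ∧ initialLayer f ε i z - B * z.2 ≤ u ε i z := by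
  choose b hb0 hb using fun i => exists_bound_of_periodic (hH i) (hper i) (L + 1)
  have hbs : 0 ≤ b 0 + b 1 := add_nonneg (hb0 0) (hb0 1)
  have hB : ∀ i ξ p, ‖p‖ ≤ L + 1 → |H i ξ p| ≤ b 0 + b 1 + 1 := by
    intro i ξ p hp
    refine (hb i ξ p hp).trans ?_
    have h0 := hb0 0
    have h1 := hb0 1
    fin_cases i
    · simp only [Fin.zero_eta]; linarith
    · simp only [Fin.mk_one]; linarith
  refine ⟨b 0 + b 1 + 1, by linarith, fun ε hε i z hz => ⟨?_, ?_⟩⟩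
  · exact le_initialLayer_add hε hH hper hf hL (hu ε hε).continuousOn (hu ε hε).subsolution
      (fun i x => ((hu ε hε).initial i x).le) (hgrow ε hε) (by linarith)
      (fun i ξ p hp => (abs_le.1 (hB i ξ p hp)).1) i z.1 hz.2.1.le hz.2.2
  · have h := le_initialLayer_add (f := fun i x => -f i x) (B := b 0 + b 1 + 1) (L := L) hε
      (fun i => continuous_reflect (hH i)) (fun i => isPeriodic_reflect (hper i))
      (fun i => (hf i).neg) (fun i x => by rw [gradient_neg_fun, norm_neg]; exact hL i x)
      (fun i => ((hu ε hε).continuousOn i).neg)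
      (isSystemSubsolution_reflect_neg (hu ε hε).supersolution)
      (fun i x => (neg_le_neg ((hu ε hε).initial i x).ge))
      (fun i => by
        obtain ⟨C, hC⟩ := hgrow ε hε i
        exact ⟨C, fun z hz => by rw [Pi.neg_apply, abs_neg]; exact hC z hz⟩)
      (by linarith)
      (fun i ξ p hp => neg_le_neg (abs_le.1 (hB i ξ (-p) (by rwa [norm_neg]))).2) i z.1
      hz.2.1.le hz.2.2
    rw [initialLayer_neg] at h
    change -u ε i z ≤ -initialLayer f ε i z + (b 0 + b 1 + 1) * z.2 at h
    linarith

variable {B : ℝ}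

theorem eventually_near_mean (hf : ∀ i, Continuous (f i))
    (hbar : ∀ ε, 0 < ε → ∀ i, ∀ z ∈ openCyl n T,
      u ε i z ≤ initialLayer f ε i z + B * z.2 ∧ initialLayer f ε i z - B * z.2 ≤ u ε i z)
    {z : E n × ℝ} (hz : z ∈ openCyl n T) {η : ℝ} (hη : 0 < η) :
    ∀ᶠ p : ℝ × (E n × ℝ) in 𝓝[>] 0 ×ˢ 𝓝 z, ∀ i,
      u p.1 i p.2 ≤ (f 0 z.1 + f 1 z.1) / 2 + B * z.2 + η ∧
      (f 0 z.1 + f 1 z.1) / 2 - B * z.2 - η ≤ u p.1 i p.2 := by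
  have hlay : ∀ᶠ p : ℝ × (E n × ℝ) in 𝓝[>] 0 ×ˢ 𝓝 z, ∀ i,
      dist (initialLayer f p.1 i p.2) ((f 0 z.1 + f 1 z.1) / 2) < η / 2 := by
    rw [eventually_all]
    exact fun i => Metric.tendsto_nhds.1 (tendsto_initialLayer hf i hz.2.1) _ (half_pos hη)
  have ht : ∀ᶠ p : ℝ × (E n × ℝ) in 𝓝[>] 0 ×ˢ 𝓝 z, dist (B * p.2.2) (B * z.2) < η / 2 := by
    have h1 : Tendsto (fun w : E n × ℝ => B * w.2) (𝓝 z) (𝓝 (B * z.2)) :=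
      (continuous_const.mul continuous_snd).tendsto z
    exact (Metric.tendsto_nhds.1 h1 _ (half_pos hη)).prod_inr _
  have hmem : ∀ᶠ p : ℝ × (E n × ℝ) in 𝓝[>] 0 ×ˢ 𝓝 z, p.2 ∈ openCyl n T :=
    Eventually.prod_inr (p := fun w => w ∈ openCyl n T) ((isOpen_openCyl n T).mem_nhds hz) _
  have hpos : ∀ᶠ p : ℝ × (E n × ℝ) in 𝓝[>] 0 ×ˢ 𝓝 z, 0 < p.1 :=
    Eventually.prod_inl (p := fun ε : ℝ => 0 < ε) self_mem_nhdsWithin _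
  filter_upwards [hlay, ht, hmem, hpos] with p h1 h2 h3 h4 i
  obtain ⟨h5, h6⟩ := hbar p.1 h4 i p.2 h3
  have h7 := abs_lt.1 (h1 i)
  have h8 := abs_lt.1 h2
  constructor <;> linarith [h7.1, h7.2, h8.1, h8.2]

theorem isBoundedNear_of_barriers (hf : ∀ i, Continuous (f i))
    (hbar : ∀ ε, 0 < ε → ∀ i, ∀ z ∈ openCyl n T,
      u ε i z ≤ initialLayer f ε i z + B * z.2 ∧ initialLayer f ε i z - B * z.2 ≤ u ε i z)
    {z : E n × ℝ} (hz : z ∈ openCyl n T) : IsBoundedNear u z := by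
  refine ⟨|(f 0 z.1 + f 1 z.1) / 2| + |B * z.2| + 1, ?_⟩
  filter_upwards [eventually_near_mean hf hbar hz one_pos] with p hp i
  have h1 := hp i
  have h2 := abs_le.1 (le_refl |(f 0 z.1 + f 1 z.1) / 2|)
  have h3 := abs_le.1 (le_refl |B * z.2|)
  exact abs_le.2 ⟨by linarith [h1.2, h2.1, h3.2], by linarith [h1.1, h2.2, h3.2]⟩

theorem upperLim_le_mean_add (hf : ∀ i, Continuous (f i))
    (hbar : ∀ ε, 0 < ε → ∀ i, ∀ z ∈ openCyl n T,
      u ε i z ≤ initialLayer f ε i z + B * z.2 ∧ initialLayer f ε i z - B * z.2 ≤ u ε i z)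
    {z : E n × ℝ} (hz : z ∈ openCyl n T) :
    upperLim u z ≤ (f 0 z.1 + f 1 z.1) / 2 + B * z.2 :=
  le_of_forall_pos_le_add fun _ hη => upperLim_le (isBoundedNear_of_barriers hf hbar hz)
    ((eventually_near_mean hf hbar hz hη).mono fun _ hp i => (hp i).1)

theorem mean_sub_le_neg_upperLim_neg (hf : ∀ i, Continuous (f i))
    (hbar : ∀ ε, 0 < ε → ∀ i, ∀ z ∈ openCyl n T,
      u ε i z ≤ initialLayer f ε i z + B * z.2 ∧ initialLayer f ε i z - B * z.2 ≤ u ε i z)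
    {z : E n × ℝ} (hz : z ∈ openCyl n T) :
    (f 0 z.1 + f 1 z.1) / 2 - B * z.2 ≤ -upperLim (fun ε i w => -u ε i w) z := by
  rw [le_neg]
  refine le_of_forall_pos_le_add fun η hη =>
    upperLim_le (isBoundedNear_of_barriers hf hbar hz).neg
    ((eventually_near_mean hf hbar hz hη).mono fun p hp i => ?_)
  linarith [(hp i).2]

theorem upperLim_effective_subsolution (hH : ∀ i, Continuous fun q : E n × E n => H i q.1 q.2)
    (hcoer : ∀ i, IsUniformlyCoercive (H i)) (hper : ∀ i p, IsPeriodic fun ξ => H i ξ p)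
    (hu : ∀ ε : ℝ, 0 < ε → IsSystemSolution H f T ε (u ε))
    (hbd : ∀ z ∈ openCyl n T, IsBoundedNear u z) {φ : E n × ℝ → ℝ}
    (hφ : ContDiffOn ℝ 1 φ (openCyl n T)) {z : E n × ℝ} (hz : z ∈ openCyl n T)
    (hmax : IsLocalMax (fun w => upperLim u w - φ w) z) :
    timeDeriv φ z + effectiveHamiltonian H (spaceGrad φ z) ≤ 0 := by
  obtain ⟨v, hv⟩ := isCellConstant_effectiveHamiltonian hH hper hcoer (spaceGrad φ z)
  obtain ⟨h1, h2, h3, h4⟩ := isCellSolution_iff.1 hv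
  obtain ⟨R, hR0, hR⟩ := exists_lipschitz_of_cell (continuous_shiftHam hH _)
    (fun i p => hper i (_ + p)) (isUniformlyCoercive_shiftHam hcoer _) h1 h2 h3
  exact upperLim_subsolution hH hper (fun ε hε => (hu ε hε).continuousOn)
    (fun ε hε => (hu ε hε).subsolution) hbd hφ hz hmax h1 h2 hR0 hR h4

/-- The reflected Hamiltonians are not coercive, so the corrector and its Lipschitz bound are
obtained for `H` and then negated. -/
theorem lowerLim_effective_supersolution
    (hH : ∀ i, Continuous fun q : E n × E n => H i q.1 q.2)
    (hcoer : ∀ i, IsUniformlyCoercive (H i)) (hper : ∀ i p, IsPeriodic fun ξ => H i ξ p)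
    (hu : ∀ ε : ℝ, 0 < ε → IsSystemSolution H f T ε (u ε))
    (hbd : ∀ z ∈ openCyl n T, IsBoundedNear u z) {φ : E n × ℝ → ℝ}
    (hφ : ContDiffOn ℝ 1 φ (openCyl n T)) {z : E n × ℝ} (hz : z ∈ openCyl n T)
    (hmin : IsLocalMin (fun w => -upperLim (fun ε i w => -u ε i w) w - φ w) z) :
    0 ≤ timeDeriv φ z + effectiveHamiltonian H (spaceGrad φ z) := by
  obtain ⟨v, hv⟩ := isCellConstant_effectiveHamiltonian hH hper hcoer (spaceGrad φ z)
  obtain ⟨h1, h2, h3, h4⟩ := isCellSolution_iff.1 hv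
  obtain ⟨R, hR0, hR⟩ := exists_lipschitz_of_cell (continuous_shiftHam hH _)
    (fun i p => hper i (_ + p)) (isUniformlyCoercive_shiftHam hcoer _) h1 h2 h3
  have hmax : IsLocalMax (fun w => upperLim (fun ε i w => -u ε i w) w - -φ w) z := by
    simpa using isLocalMax_neg_sub_neg.2 hmin
  have h := upperLim_subsolution (fun i => continuous_reflect (hH i))
    (fun i => isPeriodic_reflect (hper i)) (fun ε hε i => ((hu ε hε).continuousOn i).neg)
    (fun ε hε => isSystemSubsolution_reflect_neg (hu ε hε).supersolution)
    (fun z hz => (hbd z hz).neg) hφ.neg hz hmax (v := fun i ξ => -v i ξ) (fun i => (h1 i).neg)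
    (fun i ξ ζ => congrArg Neg.neg (h2 i ξ ζ)) hR0
    (fun i x y => by have h := hR i y x; rw [norm_sub_rev] at h; linarith)
    (c := -effectiveHamiltonian H (spaceGrad φ z))
    (by rw [spaceGrad_neg]; exact isDiscSuper_shiftHam_reflect h3)
  rw [timeDeriv_neg] at h
  linarith

end Convergence

end WeaklyCoupledHJ

end

/-! ### The homogenization theorem -/

theorem theorem1p2 {n : ℕ} (H : Fin 2 → WeaklyCoupledHJ.E n → WeaklyCoupledHJ.E n → ℝ)
    (hHcont : ∀ i, Continuous (fun q : WeaklyCoupledHJ.E n × WeaklyCoupledHJ.E n => H i q.1 q.2))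
    (hHcoer : ∀ i, WeaklyCoupledHJ.IsUniformlyCoercive (H i))
    (hHper : ∀ i p, WeaklyCoupledHJ.IsPeriodic (fun ξ => H i ξ p))
    (f : Fin 2 → WeaklyCoupledHJ.E n → ℝ)
    (hf : ∀ i, ContDiff ℝ 1 (f i))
    (hDf : ∀ i, ∃ L : ℝ, ∀ x, ‖gradient (f i) x‖ ≤ L)
    (T : ℝ) (hT : 0 < T)
    (u : ℝ → Fin 2 → WeaklyCoupledHJ.E n × ℝ → ℝ)
    (hu : ∀ ε : ℝ, 0 < ε → WeaklyCoupledHJ.IsSystemSolution H f T ε (u ε))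
    (hugrowth : ∀ ε : ℝ, 0 < ε → ∀ i, WeaklyCoupledHJ.HasLinearGrowth T (u ε i)) :
    (∀ (P : WeaklyCoupledHJ.E n) (c : ℝ), WeaklyCoupledHJ.IsCellConstant H P c ↔
        c = WeaklyCoupledHJ.effectiveHamiltonian H P) ∧
    ∃ ulim : WeaklyCoupledHJ.E n × ℝ → ℝ,
      (∀ i, TendstoLocallyUniformlyOn (fun ε => u ε i) ulim (𝓝[>] 0)
        (WeaklyCoupledHJ.openCyl n T)) ∧
      (∃ K : NNReal, LipschitzOnWith K ulim (WeaklyCoupledHJ.closedCyl n T)) ∧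
      WeaklyCoupledHJ.IsHJSolution (WeaklyCoupledHJ.effectiveHamiltonian H)
        (fun x => (f 0 x + f 1 x) / 2) T ulim := by
  open WeaklyCoupledHJ in
  refine ⟨isCellConstant_iff hHcont hHper hHcoer, ?_⟩
  choose Lf hLf using hDf
  obtain ⟨L, hL⟩ : ∃ L, ∀ i x, ‖gradient (f i) x‖ ≤ L := by
    refine ⟨max (Lf 0) (Lf 1), fun i x => (hLf i x).trans ?_⟩
    fin_cases i
    · exact le_max_left _ _
    · exact le_max_right _ _
  have hL0 : 0 ≤ L := (norm_nonneg _).trans (hL 0 0)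
  have hfc : ∀ i, Continuous (f i) := fun i => (hf i).continuous
  obtain ⟨B, hB0, hbar⟩ := exists_barriers hHcont hHper hf hL hu hugrowth
  have hbd := fun z (hz : z ∈ openCyl n T) => isBoundedNear_of_barriers hfc hbar hz
  have hmean : ∀ x y, (f 0 x + f 1 x) / 2 - (f 0 y + f 1 y) / 2 ≤ L * ‖x - y‖ := by
    intro x y
    have h0 := (abs_le.1 (abs_sub_le_of_gradient_le (hf 0) (hL 0) x y)).2
    have h1 := (abs_le.1 (abs_sub_le_of_gradient_le (hf 1) (hL 1) x y)).2
    linarith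
  have hcomp : ∀ z ∈ openCyl n T, ∀ w ∈ openCyl n T,
      upperLim u z - -upperLim (fun ε i w => -u ε i w) w ≤
        L * ‖z.1 - w.1‖ + B * |z.2 - w.2| := by
    intro z hz w hw
    refine effective_comparison (continuous_effectiveHamiltonian hHcont hHper hHcoer) hmean hL0
      hB0 (upperSemicontinuousOn_upperLim hbd) ?_ (fun z hz => upperLim_le_mean_add hfc hbar hz)
      (fun z hz => mean_sub_le_neg_upperLim_neg hfc hbar hz) ?_ ?_ hz hw
    · simpa using upperSemicontinuousOn_upperLim fun z hz => (hbd z hz).neg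
    · exact fun φ hφ z hz hmax =>
        upperLim_effective_subsolution hHcont hHcoer hHper hu hbd hφ hz hmax
    · exact fun φ hφ z hz hmin =>
        lowerLim_effective_supersolution hHcont hHcoer hHper hu hbd hφ hz hmin
  have heq : ∀ z ∈ openCyl n T, -upperLim (fun ε i w => -u ε i w) z = upperLim u z := by
    intro z hz
    refine le_antisymm (neg_upperLim_neg_le (hbd z hz) (hbd z hz).neg) ?_
    have h := hcomp z hz z hz
    simp only [sub_self, norm_zero, mul_zero, abs_zero, add_zero] at h
    linarith
  have hlip : LipschitzOnWith (L + B).toNNReal (upperLim u) (openCyl n T) := by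
    refine LipschitzOnWith.of_le_add_mul _ fun z hz w hw => ?_
    have h := hcomp z hz w hw
    rw [heq w hw] at h
    rw [Real.coe_toNNReal _ (by linarith)]
    have h1 : ‖z.1 - w.1‖ ≤ dist z w := by
      rw [← dist_eq_norm, Prod.dist_eq]; exact le_max_left _ _
    have h2 : |z.2 - w.2| ≤ dist z w := by
      rw [← Real.dist_eq, Prod.dist_eq]; exact le_max_right _ _
    nlinarith [mul_le_mul_of_nonneg_left h1 hL0, mul_le_mul_of_nonneg_left h2 hB0.le]
  -- The relaxed limits are controlled only for `0 < t < T`; at `t = 0` the components equal `f i`,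
  -- not the mean. The Lipschitz extension supplies the boundary values.
  obtain ⟨ulim, hulim, hEq⟩ := hlip.extend_real
  have hnear : ∀ z ∈ openCyl n T, ulim =ᶠ[𝓝 z] upperLim u := fun z hz =>
    mem_of_superset ((isOpen_openCyl n T).mem_nhds hz) fun w hw => (hEq hw).symm
  refine ⟨ulim, fun i => ?_, ⟨_, hulim.lipschitzOnWith⟩, ?_, ?_, ?_, ?_⟩
  · rw [Metric.tendstoLocallyUniformlyOn_iff]
    intro η hη z hz
    have h1 := eventually_lt_of_upperLim_lt (hbd z hz)
      (lt_add_of_pos_right (upperLim u z) (half_pos hη))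
    have h2 := eventually_lt_of_upperLim_lt (hbd z hz).neg
      (lt_add_of_pos_right (upperLim (fun ε i w => -u ε i w) z) (half_pos hη))
    have h3 : ∀ᶠ w in 𝓝 z, dist (ulim w) (ulim z) < η / 2 :=
      Metric.tendsto_nhds.1 (hulim.continuous.tendsto z) _ (half_pos hη)
    obtain ⟨p₁, hp₁, p₂, hp₂, hp⟩ := eventually_prod_iff.1 ((h1.and h2).and (h3.prod_inr _))
    refine ⟨{w | p₂ w}, nhdsWithin_le_nhds hp₂, ?_⟩
    filter_upwards [hp₁] with ε hε w hw
    obtain ⟨⟨h4, h5⟩, h6⟩ := hp hε hw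
    have h4 := h4 i
    have h5 := h5 i
    have h6 := abs_lt.1 h6
    have h7 := heq z hz
    rw [← hEq hz] at h6
    simp only at h4 h5 h6
    rw [Real.dist_eq, abs_lt]
    constructor <;> linarith [h6.1, h6.2]
  · exact hulim.continuous.continuousOn
  · intro φ hφ z hz hmax
    refine upperLim_effective_subsolution hHcont hHcoer hHper hu hbd hφ hz ?_
    have hz0 := (hnear z hz).self_of_nhds
    filter_upwards [hmax, hnear z hz] with w hw hw'
    rwa [hw', hz0] at hw
  · intro φ hφ z hz hmin
    refine lowerLim_effective_supersolution hHcont hHcoer hHper hu hbd hφ hz ?_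
    have hz0 := (hnear z hz).self_of_nhds
    filter_upwards [hmin, hnear z hz, (isOpen_openCyl n T).mem_nhds hz] with w hw hw' hwT
    rw [heq w hwT, heq z hz]
    rwa [hw', hz0] at hw
  · intro x
    have hIoo : ∀ᶠ t in 𝓝[>] (0 : ℝ), (x, t) ∈ openCyl n T := by
      filter_upwards [Ioo_mem_nhdsGT hT] with t ht
      exact ⟨mem_univ _, ht⟩
    have hc : Continuous fun t : ℝ => ulim (x, t) := hulim.continuous.comp (by fun_prop)
    have h1 : Tendsto (fun t => ulim (x, t)) (𝓝[>] (0 : ℝ)) (𝓝 (ulim (x, 0))) :=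
      (hc.tendsto 0).mono_left nhdsWithin_le_nhds
    have hlin : ∀ C : ℝ, Tendsto (fun t : ℝ => (f 0 x + f 1 x) / 2 + C * t) (𝓝[>] 0)
        (𝓝 ((f 0 x + f 1 x) / 2)) := by
      intro C
      have hc : Continuous fun t : ℝ => (f 0 x + f 1 x) / 2 + C * t := by fun_prop
      simpa using (hc.tendsto 0).mono_left nhdsWithin_le_nhds
    -- The bounds `mean ± B t` squeeze the continuous extension as `t → 0⁺`.
    refine le_antisymm (le_of_tendsto_of_tendsto h1 (hlin B) ?_)
      (le_of_tendsto_of_tendsto (hlin (-B)) h1 ?_)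
    · filter_upwards [hIoo] with t ht
      rw [← hEq ht]
      exact upperLim_le_mean_add hfc hbar ht
    · filter_upwards [hIoo] with t ht
      rw [← hEq ht, ← heq _ ht]
      have := mean_sub_le_neg_upperLim_neg hfc hbar ht
      simp only at this
      linarith
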